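/- **Setting.** Let $\Omega\subset\mathbb R^2$ be open and let $\mathcal T_h$ be a finite partition of $\Omega$ into polygons: each $T\in\mathcal T_h$ is the (open) region, convex or not, bounded by a simple closed polygonal curve with $N=N_T\ge 3$ edges; the elements are pairwise disjoint, are contained in $\Omega$, and their closures cover $\Omega$; two edges of different elements either coincide or meet at most in common end points. (A single finite partition of this kind is always shape-regular for suitable constants.) Assume also that two distinct edges of one element never lie on a common straight line, unless both are contained in $\partial\Omega$. Let $\boldsymbol n$ be the outward unit normal on $\partial T$ and $h=\max_T \operatorname{diam} T$. Let $k,p,q,m\ge1$ be integers with $q\le k$ and $m\le k$. $W_h^0$ is the space of pairs $v=\{v_0,v_b\}$ with $v_0|_T\in P_k(T)$ for every element $T$, $v_b|_e\in P_p(e)$ for every edge $e$ (one function per edge, shared by the two adjacent elements), and $v_b=0$ on every edge $e\subset\partial\Omega$. $\Theta_h^0$ is the space of pairs $\boldsymbol\eta=\{\boldsymbol\eta_0,\boldsymbol\eta_b\}$ with $\boldsymbol\eta_0|_T\in[P_q(T)]^2$, $\boldsymbol\eta_b|_e\in[P_m(e)]^2$, and $\boldsymbol\eta_b=0$ on every edge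 $e\subset\partial\Omega$. On each $T$ put $r=r_1=r_2=N_T+k-1$ if $T$ is convex and $r=r_1=r_2=2N_T+k-1$ if it is not. The discrete weak gradient $\nabla_w v\in[P_r(T)]^2$ and the discrete weak symmetric gradient $\epsilon_w(\boldsymbol\eta)\in[P_r(T)]^{2\times2}_{\rm sym}$ are defined on each $T$ by $$(\nabla_w v,\boldsymbol\phi)_T=-(v_0,\nabla\!\cdot\boldsymbol\phi)_T+\langle v_b,\boldsymbol\phi\cdot\boldsymbol n\rangle_{\partial T}\quad\forall\boldsymbol\phi\in[P_r(T)]^2,$$ $$(\epsilon_w(\boldsymbol\eta),\boldsymbol\tau)_T=-(\boldsymbol\eta_0,\nabla\!\cdot\boldsymbol\tau)_T+\langle\boldsymbol\eta_b,\boldsymbol\tau\boldsymbol n\rangle_{\partial T}\quad\forall\boldsymbol\tau\in[P_r(T)]^{2\times2}_{\rm sym}.$$ $\mathcal Q_{r_1}$ is the $L^2(T)$ projection onto $[P_{r}(T)]^2$ on each $T$, and $(\cdot,\cdot)=\sum_T(\cdot,\cdot)_T$. Let $\mathcal C$ be a constant linear map on $2\times2$ matrices with $\mathcal C\boldsymbol\tau:\boldsymbol\tau>0$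 for all symmetric $\boldsymbol\tau\ne0$ (tensor of bending moduli), let $\lambda>0$ (shear correction factor) and $d>0$ (plate thickness), and let $g\in L^2(\Omega)$. **Theorem.** The weak Galerkin scheme for the clamped Reissner–Mindlin plate, namely: find $(\boldsymbol\theta_h,w_h)\in\Theta_h^0\times W_h^0$, $\boldsymbol\theta_h=\{\boldsymbol\theta_0,\boldsymbol\theta_b\}$, $w_h=\{w_0,w_b\}$, such that $$(\mathcal C\epsilon_w(\boldsymbol\theta_h),\epsilon_w(\boldsymbol\eta))+\lambda d^{-2}\,(\nabla_w w_h-\mathcal Q_{r_1}\boldsymbol\theta_0,\ \nabla_w v-\mathcal Q_{r_1}\boldsymbol\eta_0)+\sum_{T\in\mathcal T_h}h^{-1}\langle w_0-w_b,\,v_0-v_b\rangle_{\partial T}=(g,v_0)$$ for all $(\boldsymbol\eta,v)\in\Theta_h^0\times W_h^0$, has exactly one solution. -/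

import Mathlib

open MeasureTheory

namespace WG

noncomputable section

/-- The Euclidean plane. -/
abbrev Plane : Type := EuclideanSpace ℝ (Fin 2)

/-- Real polynomials in the two coordinates. -/
abbrev Poly : Type := MvPolynomial (Fin 2) ℝ

/-- The value of a polynomial at a point of the plane. -/
def evalAt (P : Poly) (x : Plane) : ℝ := MvPolynomial.eval (fun i => x i) P

/-- The space `P_r` of polynomials of total degree at most `r`. -/
abbrev polyLE (r : ℕ) : Submodule ℝ Poly := MvPolynomial.restrictTotalDegree (Fin 2) ℝ r

/-! ### Polygonal elements -/

/-- A polygonal element, not necessarily convex: `carrier` is the (open) interior of a simple closed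
polygonal curve with `N` vertices and the `N` edges `[vertex i, vertex (i+1)]` (cyclically).
A bounded connected open set whose boundary is a Jordan curve is the region enclosed by it.
`normal i` is the outward unit normal on the `i`-th edge. -/
structure PolygonalElement where
  N : ℕ
  three_le : 3 ≤ N
  vertex : Fin N → Plane
  vertex_injective : Function.Injective vertex
  simple : ∀ i j : Fin N, i ≠ j →
    segment ℝ (vertex i) (vertex (finRotate N i)) ∩ segment ℝ (vertex j) (vertex (finRotate N j)) ⊆
      {vertex i, vertex (finRotate N i)} ∩ {vertex j, vertex (finRotate N j)}
  carrier : Set Plane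
  isOpen_carrier : IsOpen carrier
  isConnected_carrier : IsConnected carrier
  isBounded_carrier : Bornology.IsBounded carrier
  frontier_carrier :
    frontier carrier = ⋃ i : Fin N, segment ℝ (vertex i) (vertex (finRotate N i))
  normal : Fin N → Plane
  norm_normal : ∀ i, ‖normal i‖ = 1
  normal_orthogonal : ∀ i, inner ℝ (normal i) (vertex (finRotate N i) - vertex i) = 0
  normal_outward : ∀ i, ∀ x ∈ openSegment ℝ (vertex i) (vertex (finRotate N i)),
    ∀ᶠ s : ℝ in nhdsWithin 0 (Set.Ioi 0), x - s • normal i ∈ carrier ∧ x + s • normal i ∉ carrier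

namespace PolygonalElement

variable (K : PolygonalElement)

/-- The `i`-th edge, a closed segment. -/
def edge (i : Fin K.N) : Set Plane := segment ℝ (K.vertex i) (K.vertex (finRotate K.N i))

/-- The two end points of the `i`-th edge. -/
def ends (i : Fin K.N) : Set Plane := {K.vertex i, K.vertex (finRotate K.N i)}

/-- The integral `∫_K f dx`. -/
def integral (f : Plane → ℝ) : ℝ := ∫ x in K.carrier, f x

/-- The integral `∫_e f ds` with respect to arc length over the `i`-th edge `e`. -/
def edgeIntegral (i : Fin K.N) (f : Plane → ℝ) : ℝ :=
  dist (K.vertex i) (K.vertex (finRotate K.N i)) *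
    ∫ s in (0 : ℝ)..1, f (AffineMap.lineMap (K.vertex i) (K.vertex (finRotate K.N i)) s)

/-- The degree `r₁ = r₂` of the discrete weak gradients on an element with `N` edges:
`N + k - 1` on convex elements and `2 N + k - 1` on non-convex ones. -/
def gradDegree (k : ℕ) : ℕ :=
  open Classical in if Convex ℝ K.carrier then K.N + k - 1 else 2 * K.N + k - 1

/-- `G` is the discrete weak gradient in `[P_r]²` of the weak function `{w₀, w_b}` on the element:
`(G, q) = -(w₀, ∇·q) + ⟨w_b, q·n⟩` for all `q ∈ [P_r]²`. The boundary part is given edge by edge. -/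
def IsWeakGrad (r : ℕ) (w₀ : Plane → ℝ) (wb : Fin K.N → Plane → ℝ) (G : Fin 2 → Poly) : Prop :=
  (∀ l, G l ∈ polyLE r) ∧
  ∀ q : Fin 2 → Poly, (∀ l, q l ∈ polyLE r) →
    K.integral (fun x => ∑ l, evalAt (G l) x * evalAt (q l) x) =
      -K.integral (fun x => w₀ x * ∑ l, evalAt (MvPolynomial.pderiv l (q l)) x) +
        ∑ i, K.edgeIntegral i (fun x => wb i x * ∑ l, evalAt (q l) x * K.normal i l)

/-- `E` is the discrete weak symmetric gradient in `[P_r]^{2×2}_sym` of `{η₀, η_b}`: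
`(E, τ) = -(η₀, ∇·τ) + ⟨η_b, τ n⟩` for all `τ ∈ [P_r]^{2×2}_sym`. -/
def IsWeakSymGrad (r : ℕ) (η₀ : Fin 2 → Plane → ℝ) (ηb : Fin K.N → Fin 2 → Plane → ℝ)
    (E : Matrix (Fin 2) (Fin 2) Poly) : Prop :=
  (E.IsSymm ∧ ∀ l m, E l m ∈ polyLE r) ∧
  ∀ τ : Matrix (Fin 2) (Fin 2) Poly, τ.IsSymm → (∀ l m, τ l m ∈ polyLE r) →
    K.integral (fun x => ∑ l, ∑ m, evalAt (E l m) x * evalAt (τ l m) x) =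
      -K.integral (fun x => ∑ l, η₀ l x * ∑ m, evalAt (MvPolynomial.pderiv m (τ l m)) x) +
        ∑ i, K.edgeIntegral i (fun x => ∑ l, ηb i l x * ∑ m, evalAt (τ l m) x * K.normal i m)

/-- `G` is the `L²(K)` projection of `f` onto `[P_r]²`. -/
def IsL2Proj (r : ℕ) (f : Fin 2 → Plane → ℝ) (G : Fin 2 → Poly) : Prop :=
  (∀ l, G l ∈ polyLE r) ∧
  ∀ q : Fin 2 → Poly, (∀ l, q l ∈ polyLE r) →
    K.integral (fun x => ∑ l, evalAt (G l) x * evalAt (q l) x) =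
      K.integral (fun x => ∑ l, f l x * evalAt (q l) x)

/-- The discrete weak gradient `∇_{w,r,K}` of `{w₀, w_b}`; see `existsUnique_isWeakGrad`. -/
def weakGrad (r : ℕ) (w₀ : Plane → ℝ) (wb : Fin K.N → Plane → ℝ) : Fin 2 → Poly :=
  Classical.epsilon (K.IsWeakGrad r w₀ wb)

/-- The discrete weak symmetric gradient `ε_{w,r,K}` of `{η₀, η_b}`; see
`existsUnique_isWeakSymGrad`. -/
def weakSymGrad (r : ℕ) (η₀ : Fin 2 → Plane → ℝ) (ηb : Fin K.N → Fin 2 → Plane → ℝ) :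
    Matrix (Fin 2) (Fin 2) Poly :=
  Classical.epsilon (K.IsWeakSymGrad r η₀ ηb)

/-- The `L²(K)` projection onto `[P_r]²`; see `existsUnique_isL2Proj`. -/
def l2Proj (r : ℕ) (f : Fin 2 → Plane → ℝ) : Fin 2 → Poly :=
  Classical.epsilon (K.IsL2Proj r f)

end PolygonalElement

/-! ### Well-definedness of the element-wise operators -/

theorem continuous_evalAt (P : Poly) : Continuous (evalAt P) := by
  unfold evalAt
  have h : Continuous fun x : Plane => (fun i => x i : Fin 2 → ℝ) := by fun_prop
  exact (MvPolynomial.continuous_eval P).comp h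

@[simp] theorem evalAt_add (P Q : Poly) (x : Plane) :
    evalAt (P + Q) x = evalAt P x + evalAt Q x := by simp [evalAt]

@[simp] theorem evalAt_smul (c : ℝ) (P : Poly) (x : Plane) :
    evalAt (c • P) x = c * evalAt P x := by simp [evalAt]

/-- A polynomial that vanishes on a non-empty open set is zero. -/
theorem eq_zero_of_evalAt_eq_zero {S : Set Plane} (hS : IsOpen S) (hne : S.Nonempty) (P : Poly)
    (h : ∀ x ∈ S, evalAt P x = 0) : P = 0 := by
  obtain ⟨x₀, hx₀⟩ := hne
  have hc : Continuous (fun y : Fin 2 → ℝ => (WithLp.toLp 2 y : Plane)) := by fun_prop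
  have hU := hS.preimage hc
  have hm : (fun i => x₀ i) ∈ (fun y : Fin 2 → ℝ => (WithLp.toLp 2 y : Plane)) ⁻¹' S := hx₀
  obtain ⟨ε, hε, hb⟩ := Metric.isOpen_iff.1 hU _ hm
  refine MvPolynomial.funext_set (fun i => Metric.ball (x₀ i) ε) (fun i => ?_) fun y hy => ?_
  · rw [Real.ball_eq_Ioo]
    exact Set.Ioo_infinite (by linarith)
  · have hy' : y ∈ Metric.ball (fun i => x₀ i) ε := by
      rw [ball_pi _ hε]; exact hy
    have := h _ (hb hy')
    simpa [evalAt] using this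

theorem existsUnique_of_definite {V : Type*} [AddCommGroup V] [Module ℝ V]
    [FiniteDimensional ℝ V] (B : V →ₗ[ℝ] V →ₗ[ℝ] ℝ) (hB : ∀ v, B v v = 0 → v = 0)
    (L : V →ₗ[ℝ] ℝ) : ∃! u, ∀ v, B u v = L v := by
  have hi : Function.Injective B := by
    rw [← LinearMap.ker_eq_bot, LinearMap.ker_eq_bot']
    intro m hm
    exact hB m (by rw [hm]; rfl)
  have hs : Function.Surjective B :=
    (LinearMap.injective_iff_surjective_of_finrank_eq_finrank
      (Subspace.dual_finrank_eq (K := ℝ) (V := V)).symm).1 hi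
  obtain ⟨u, hu⟩ := hs L
  exact ⟨u, fun v => by rw [hu], fun y hy => hi (by rw [hu]; ext v; exact hy v)⟩

namespace PolygonalElement

variable (K : PolygonalElement)

theorem integrableOn_of_continuous {f : Plane → ℝ} (hf : Continuous f) :
    IntegrableOn f K.carrier :=
  (hf.continuousOn.integrableOn_compact K.isBounded_carrier.isCompact_closure).mono_set
    subset_closure

theorem integrableOn_mul_of_continuous {f g : Plane → ℝ} (hf : IntegrableOn f K.carrier)
    (hg : Continuous g) : IntegrableOn (fun x => f x * g x) K.carrier := by
  obtain ⟨C, hC⟩ := K.isBounded_carrier.isCompact_closure.exists_bound_of_continuousOn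
    hg.continuousOn
  refine Integrable.mul_bdd (c := C) hf hg.aestronglyMeasurable ?_
  filter_upwards [ae_restrict_mem K.isOpen_carrier.measurableSet] with x hx
  exact hC x (subset_closure hx)

theorem integral_add {f g : Plane → ℝ} (hf : IntegrableOn f K.carrier)
    (hg : IntegrableOn g K.carrier) :
    K.integral (fun x => f x + g x) = K.integral f + K.integral g :=
  MeasureTheory.integral_add hf hg

theorem integral_const_mul (c : ℝ) (f : Plane → ℝ) :
    K.integral (fun x => c * f x) = c * K.integral f :=
  MeasureTheory.integral_const_mul c f

/-- The trace on the `i`-th edge is integrable with respect to arc length. -/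
def EdgeIntegrable (i : Fin K.N) (f : Plane → ℝ) : Prop :=
  IntervalIntegrable
    (fun s => f (AffineMap.lineMap (K.vertex i) (K.vertex (finRotate K.N i)) s)) volume 0 1

theorem edgeIntegral_add (i : Fin K.N) {f g : Plane → ℝ} (hf : K.EdgeIntegrable i f)
    (hg : K.EdgeIntegrable i g) :
    K.edgeIntegral i (fun x => f x + g x) = K.edgeIntegral i f + K.edgeIntegral i g := by
  unfold edgeIntegral
  rw [intervalIntegral.integral_add hf hg, mul_add]

theorem edgeIntegral_const_mul (i : Fin K.N) (c : ℝ) (f : Plane → ℝ) :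
    K.edgeIntegral i (fun x => c * f x) = c * K.edgeIntegral i f := by
  unfold edgeIntegral
  rw [intervalIntegral.integral_const_mul]; ring

theorem EdgeIntegrable.mul_continuous {K : PolygonalElement} {i : Fin K.N} {f g : Plane → ℝ}
    (hf : K.EdgeIntegrable i f) (hg : Continuous g) :
    K.EdgeIntegrable i (fun x => f x * g x) := by
  refine IntervalIntegrable.mul_continuousOn hf (Continuous.continuousOn ?_)
  exact hg.comp AffineMap.lineMap_continuous

/-- Riesz representation in a finite-dimensional space `V` of tuples of polynomials with the
`L²(K)` inner product. -/
theorem existsUnique_repr {V : Type*} [AddCommGroup V] [Module ℝ V] [FiniteDimensional ℝ V]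
    {κ : Type*} [Fintype κ] (J : V →ₗ[ℝ] κ → Poly) (hJ : Function.Injective J)
    (L : V →ₗ[ℝ] ℝ) :
    ∃! u : V, ∀ v : V, K.integral (fun x => ∑ c, evalAt (J u c) x * evalAt (J v c) x) = L v := by
  have hint : ∀ u v : V,
      IntegrableOn (fun x => ∑ c, evalAt (J u c) x * evalAt (J v c) x) K.carrier := fun u v =>
    K.integrableOn_of_continuous (continuous_finsetSum _ fun c _ =>
      (continuous_evalAt _).mul (continuous_evalAt _))
  let B : V →ₗ[ℝ] V →ₗ[ℝ] ℝ := LinearMap.mk₂ ℝ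
    (fun u v => K.integral (fun x => ∑ c, evalAt (J u c) x * evalAt (J v c) x))
    (fun u u' v => by
      rw [← K.integral_add (hint _ _) (hint _ _)]
      simp [add_mul, Finset.sum_add_distrib])
    (fun c u v => by
      rw [smul_eq_mul, ← K.integral_const_mul]
      simp [Finset.mul_sum, mul_assoc])
    (fun u v v' => by
      rw [← K.integral_add (hint _ _) (hint _ _)]
      simp [mul_add, Finset.sum_add_distrib])
    (fun c u v => by
      rw [smul_eq_mul, ← K.integral_const_mul]
      simp [Finset.mul_sum, mul_left_comm])
  refine existsUnique_of_definite B (fun v hv => ?_) L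
  have hnn : ∀ x, 0 ≤ ∑ c, evalAt (J v c) x * evalAt (J v c) x := fun x =>
    Finset.sum_nonneg fun c _ => mul_self_nonneg _
  have h0 : (fun x => ∑ c, evalAt (J v c) x * evalAt (J v c) x) =ᵐ[volume.restrict K.carrier] 0 :=
    (integral_eq_zero_iff_of_nonneg hnn (hint v v)).1 hv
  have h1 : Set.EqOn (fun x => ∑ c, evalAt (J v c) x * evalAt (J v c) x) 0 K.carrier :=
    Measure.eqOn_open_of_ae_eq h0 K.isOpen_carrier
      (continuous_finsetSum _ fun c _ =>
        (continuous_evalAt _).mul (continuous_evalAt _)).continuousOn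
      continuousOn_const
  apply hJ
  rw [map_zero]
  funext c
  refine eq_zero_of_evalAt_eq_zero K.isOpen_carrier K.isConnected_carrier.nonempty _ fun x hx => ?_
  have h2 := (Finset.sum_eq_zero_iff_of_nonneg fun c _ => mul_self_nonneg (evalAt (J v c) x)).1
    (h1 hx) c (Finset.mem_univ c)
  exact mul_self_eq_zero.1 h2

/-- The `L²` projection onto `[P_r]²` is well defined. -/
theorem existsUnique_isL2Proj (r : ℕ) (f : Fin 2 → Plane → ℝ)
    (hf : ∀ l, IntegrableOn (f l) K.carrier) : ∃! G, K.IsL2Proj r f G := by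
  let J : (Fin 2 → polyLE r) →ₗ[ℝ] Fin 2 → Poly := LinearMap.compLeft (polyLE r).subtype (Fin 2)
  have hJ : Function.Injective J := fun a b h => funext fun l => Subtype.ext (congrFun h l)
  have hi : ∀ q : Fin 2 → polyLE r,
      IntegrableOn (fun x => ∑ l, f l x * evalAt (q l : Poly) x) K.carrier := fun q =>
    integrable_finsetSum _ fun l _ => K.integrableOn_mul_of_continuous (hf l)
      (continuous_evalAt _)
  let L : (Fin 2 → polyLE r) →ₗ[ℝ] ℝ :=
    { toFun := fun q => K.integral (fun x => ∑ l, f l x * evalAt (q l : Poly) x)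
      map_add' := fun q q' => by
        rw [← K.integral_add (hi _) (hi _)]
        simp [mul_add, Finset.sum_add_distrib]
      map_smul' := fun c q => by
        simp only [RingHom.id_apply, smul_eq_mul]
        rw [← K.integral_const_mul]
        simp [mul_left_comm, mul_add] }
  obtain ⟨u, hu, huu⟩ := K.existsUnique_repr J hJ L
  refine ⟨fun l => u l, ⟨fun l => (u l).2, fun q hq => hu fun l => ⟨q l, hq l⟩⟩, ?_⟩
  rintro G ⟨hG, hG'⟩
  have := huu (fun l => ⟨G l, hG l⟩) fun v => hG' (fun l => v l) fun l => (v l).2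
  funext l
  exact congrArg Subtype.val (congrFun this l)

/-- The discrete weak gradient is well defined. -/
theorem existsUnique_isWeakGrad (r : ℕ) (w₀ : Plane → ℝ) (wb : Fin K.N → Plane → ℝ)
    (h₀ : IntegrableOn w₀ K.carrier) (hb : ∀ i, K.EdgeIntegrable i (wb i)) :
    ∃! G, K.IsWeakGrad r w₀ wb G := by
  let J : (Fin 2 → polyLE r) →ₗ[ℝ] Fin 2 → Poly := LinearMap.compLeft (polyLE r).subtype (Fin 2)
  have hJ : Function.Injective J := fun a b h => funext fun l => Subtype.ext (congrFun h l)
  have hi : ∀ q : Fin 2 → polyLE r,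
      IntegrableOn (fun x => w₀ x * ∑ l, evalAt (MvPolynomial.pderiv l (q l : Poly)) x) K.carrier :=
    fun q => K.integrableOn_mul_of_continuous h₀
      (continuous_finsetSum _ fun l _ => continuous_evalAt _)
  have he : ∀ (q : Fin 2 → polyLE r) i,
      K.EdgeIntegrable i (fun x => wb i x * ∑ l, evalAt (q l : Poly) x * K.normal i l) := fun q i =>
    (hb i).mul_continuous
      (continuous_finsetSum _ fun l _ => (continuous_evalAt _).mul continuous_const)
  let L : (Fin 2 → polyLE r) →ₗ[ℝ] ℝ :=
    { toFun := fun q =>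
        -K.integral (fun x => w₀ x * ∑ l, evalAt (MvPolynomial.pderiv l (q l : Poly)) x) +
        ∑ i, K.edgeIntegral i (fun x => wb i x * ∑ l, evalAt (q l : Poly) x * K.normal i l)
      map_add' := fun q q' => by
        have e1 := K.integral_add (hi q) (hi q')
        have e2 := fun i => K.edgeIntegral_add i (he q i) (he q' i)
        have : ∀ a b c d : ℝ, -a + b + (-c + d) = -(a + c) + (b + d) := fun a b c d => by ring
        rw [this, ← e1, ← Finset.sum_add_distrib]
        simp_rw [← e2]
        simp [mul_add, add_mul, Finset.sum_add_distrib]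
      map_smul' := fun c q => by
        simp only [RingHom.id_apply, smul_eq_mul]
        rw [mul_add, mul_neg, ← K.integral_const_mul, Finset.mul_sum]
        simp_rw [← K.edgeIntegral_const_mul]
        have e : ∀ a b d : ℝ, a * (c * b + c * d) = c * (a * (b + d)) := fun a b d => by ring
        have e' : ∀ a b d b' d' : ℝ, a * (c * b * d + c * b' * d') =
          c * (a * (b * d + b' * d')) := fun a b d b' d' => by ring
        simp [e, e'] }
  obtain ⟨u, hu, huu⟩ := K.existsUnique_repr J hJ L
  refine ⟨fun l => u l, ⟨fun l => (u l).2, fun q hq => hu fun l => ⟨q l, hq l⟩⟩, ?_⟩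
  rintro G ⟨hG, hG'⟩
  have := huu (fun l => ⟨G l, hG l⟩) fun v => hG' (fun l => v l) fun l => (v l).2
  funext l
  exact congrArg Subtype.val (congrFun this l)

/-- The space `[P_r]^{2×2}_sym`. -/
def symPoly (r : ℕ) : Submodule ℝ (Fin 2 × Fin 2 → polyLE r) where
  carrier := {τ | ∀ l m, τ (m, l) = τ (l, m)}
  add_mem' := fun ha hb l m => by simp [ha l m, hb l m]
  zero_mem' := fun _ _ => rfl
  smul_mem' := fun c a ha l m => by simp [ha l m]

/-- The discrete weak symmetric gradient is well defined. -/
theorem existsUnique_isWeakSymGrad (r : ℕ) (η₀ : Fin 2 → Plane → ℝ)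
    (ηb : Fin K.N → Fin 2 → Plane → ℝ) (h₀ : ∀ l, IntegrableOn (η₀ l) K.carrier)
    (hb : ∀ i l, K.EdgeIntegrable i (ηb i l)) : ∃! E, K.IsWeakSymGrad r η₀ ηb E := by
  let J : symPoly r →ₗ[ℝ] Fin 2 × Fin 2 → Poly :=
    (LinearMap.compLeft (polyLE r).subtype (Fin 2 × Fin 2)).comp (symPoly r).subtype
  have hJ : Function.Injective J :=
    fun a b h => Subtype.ext (funext fun l => Subtype.ext (congrFun h l))
  have hi : ∀ τ : symPoly r, IntegrableOn (fun x => ∑ l, η₀ l x *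
      ∑ m, evalAt (MvPolynomial.pderiv m (τ.1 (l, m) : Poly)) x) K.carrier := fun τ =>
    integrable_finsetSum _ fun l _ => K.integrableOn_mul_of_continuous (h₀ l)
      (continuous_finsetSum _ fun m _ => continuous_evalAt _)
  have he : ∀ (τ : symPoly r) i, K.EdgeIntegrable i
      (fun x => ∑ l, ηb i l x * ∑ m, evalAt (τ.1 (l, m) : Poly) x * K.normal i m) := fun τ i => by
    have h := fun l => (hb i l).mul_continuous
      (g := fun x => ∑ m, evalAt (τ.1 (l, m) : Poly) x * K.normal i m)
      (continuous_finsetSum _ fun m _ => (continuous_evalAt _).mul continuous_const)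
    have h' := IntervalIntegrable.add (h 0) (h 1)
    unfold EdgeIntegrable
    simp only [Fin.sum_univ_two] at h' ⊢
    exact h'
  let L : symPoly r →ₗ[ℝ] ℝ :=
    { toFun := fun τ =>
        -K.integral (fun x => ∑ l, η₀ l x *
          ∑ m, evalAt (MvPolynomial.pderiv m (τ.1 (l, m) : Poly)) x) +
        ∑ i, K.edgeIntegral i
          (fun x => ∑ l, ηb i l x * ∑ m, evalAt (τ.1 (l, m) : Poly) x * K.normal i m)
      map_add' := fun q q' => by
        have e1 := K.integral_add (hi q) (hi q')
        have e2 := fun i => K.edgeIntegral_add i (he q i) (he q' i)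
        have : ∀ a b c d : ℝ, -a + b + (-c + d) = -(a + c) + (b + d) := fun a b c d => by ring
        rw [this, ← e1, ← Finset.sum_add_distrib]
        simp_rw [← e2]
        simp [mul_add, add_mul, Finset.sum_add_distrib]
      map_smul' := fun c q => by
        simp only [RingHom.id_apply, smul_eq_mul]
        rw [mul_add, mul_neg, ← K.integral_const_mul, Finset.mul_sum]
        simp_rw [← K.edgeIntegral_const_mul]
        simp [mul_assoc, mul_left_comm, mul_add] }
  obtain ⟨u, hu, huu⟩ := K.existsUnique_repr (V := symPoly r) J hJ L
  refine ⟨Matrix.of fun l m => u.1 (l, m), ⟨⟨?_, fun l m => (u.1 (l, m)).2⟩, fun τ hs hτ => ?_⟩, ?_⟩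
  · ext1 l m
    exact congrArg Subtype.val (u.2 l m)
  · have := hu ⟨fun c => ⟨τ c.1 c.2, hτ _ _⟩, fun l m => Subtype.ext (hs.apply l m)⟩
    simp_rw [Fintype.sum_prod_type] at this
    exact this
  · rintro E ⟨⟨hs, hE⟩, hE'⟩
    have := huu ⟨fun c => ⟨E c.1 c.2, hE _ _⟩, fun l m => Subtype.ext (hs.apply l m)⟩ fun v => by
      simp_rw [Fintype.sum_prod_type]
      exact hE' (Matrix.of fun l m => v.1 (l, m))
        (by ext1 l m; exact congrArg Subtype.val (v.2 l m)) fun l m => (v.1 (l, m)).2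
    ext1 l m
    exact congrArg Subtype.val (congrFun (congrArg Subtype.val this) (l, m))

end PolygonalElement

/-! ### Polygonal partitions -/

/-- The elements `T i` form an edge-to-edge partition of `Ω` into polygons: they are disjoint, lie
in `Ω`, their closures cover `Ω`, and edges of different elements either coincide or meet at most in
common end points. -/
structure IsPolygonalPartition {ι : Type*} (Ω : Set Plane) (T : ι → PolygonalElement) : Prop where
  subset : ∀ i, (T i).carrier ⊆ Ω
  cover : Ω ⊆ ⋃ i, closure (T i).carrier
  disjoint : ∀ i j, i ≠ j → Disjoint (T i).carrier (T j).carrier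
  conforming : ∀ i j, i ≠ j → ∀ (a : Fin (T i).N) (b : Fin (T j).N),
    (T i).edge a = (T j).edge b ∨ (T i).edge a ∩ (T j).edge b ⊆ (T i).ends a ∩ (T j).ends b

section Mesh

variable {ι : Type*} (T : ι → PolygonalElement)

/-- The set of all edges of the partition. -/
def edges : Set (Set Plane) := {e | ∃ i, ∃ a, e = (T i).edge a}

/-- `f` restricted to the edge `e` is a polynomial of degree at most `r`, that is `f ∈ P_r(e)`;
outside `e`, where its values are irrelevant, `f` is normalized to be zero. -/
def IsEdgePoly (e : Set Plane) (r : ℕ) (f : Plane → ℝ) : Prop :=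
  ∃ P ∈ polyLE r, f = e.indicator (evalAt P)

/-- Discrete scalar weak functions `{v₀, v_b}` on the partition: a polynomial on each element and a
function on each edge. An edge common to two elements carries one function. -/
abbrev WeakFun : Type _ := (ι → Poly) × (edges T → Plane → ℝ)

/-- The part `v_b` of a weak function, on the `a`-th edge of the element `T i`. -/
def WeakFun.bdry {T : ι → PolygonalElement} (v : WeakFun T) (i : ι) (a : Fin (T i).N) :
    Plane → ℝ :=
  v.2 ⟨(T i).edge a, i, a, rfl⟩

/-- The space `W_h`: `v₀ ∈ P_k` on each element and `v_b ∈ P_p(e)` on each edge. -/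
def weakSpace (k p : ℕ) : Set (WeakFun T) :=
  {v | (∀ i, v.1 i ∈ polyLE k) ∧ ∀ e : edges T, IsEdgePoly e.1 p (v.2 e)}

/-- The space `W_h^0`: moreover `v_b = 0` on the edges contained in `∂Ω`. -/
def weakSpace₀ (Ω : Set Plane) (k p : ℕ) : Set (WeakFun T) :=
  {v | v ∈ weakSpace T k p ∧ ∀ e : edges T, e.1 ⊆ frontier Ω → v.2 e = 0}

/-- The space `Θ_h^0`: vector-valued weak functions with `η₀ ∈ [P_q]²` on each element,
`η_b ∈ [P_m(e)]²` on each edge and `η_b = 0` on the edges contained in `∂Ω`. -/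
def rotationSpace₀ (Ω : Set Plane) (q m : ℕ) : Set (Fin 2 → WeakFun T) :=
  {η | ∀ l, η l ∈ weakSpace₀ T Ω q m}

variable {T}

/-- `∇_w v` on the element `T i`, of degree `gradDegree k`. -/
def meshWeakGrad (k : ℕ) (v : WeakFun T) (i : ι) : Fin 2 → Poly :=
  (T i).weakGrad ((T i).gradDegree k) (evalAt (v.1 i)) (fun a => v.bdry i a)

/-- `ε_w η` on the element `T i`, of degree `gradDegree k`. -/
def meshWeakSymGrad (k : ℕ) (η : Fin 2 → WeakFun T) (i : ι) : Matrix (Fin 2) (Fin 2) Poly :=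
  (T i).weakSymGrad ((T i).gradDegree k) (fun l => evalAt ((η l).1 i)) (fun a l => (η l).bdry i a)

/-- The discrete shear strain `∇_w v - 𝒬_{r₁} η₀` on the element `T i`. -/
def shear (k : ℕ) (v : WeakFun T) (η : Fin 2 → WeakFun T) (i : ι) : Fin 2 → Poly :=
  meshWeakGrad k v i - (T i).l2Proj ((T i).gradDegree k) (fun l => evalAt ((η l).1 i))

/-- The value of a matrix of polynomials at a point. -/
def matAt (E : Matrix (Fin 2) (Fin 2) Poly) (x : Plane) : Matrix (Fin 2) (Fin 2) ℝ :=
  E.map fun P => evalAt P x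

variable [Fintype ι]

/-- The bending form `(𝒞 ε_w θ, ε_w η)`. -/
def bendingForm (k : ℕ) (C : Matrix (Fin 2) (Fin 2) ℝ →ₗ[ℝ] Matrix (Fin 2) (Fin 2) ℝ)
    (θ η : Fin 2 → WeakFun T) : ℝ :=
  ∑ i, (T i).integral fun x => ∑ l, ∑ m,
    C (matAt (meshWeakSymGrad k θ i) x) l m * matAt (meshWeakSymGrad k η i) x l m

/-- The shear form `b((w, θ₀), (v, η₀)) = (∇_w w - 𝒬 θ₀, ∇_w v - 𝒬 η₀)`. -/
def shearForm (k : ℕ) (w : WeakFun T) (θ : Fin 2 → WeakFun T) (v : WeakFun T)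
    (η : Fin 2 → WeakFun T) : ℝ :=
  ∑ i, (T i).integral fun x => ∑ l, evalAt (shear k w θ i l) x * evalAt (shear k v η i l) x

/-- The mesh size `h`, the largest diameter of an element. -/
def meshSize (T : ι → PolygonalElement) : ℝ := ⨆ i, Metric.diam (T i).carrier

/-- The stabilizer `s(w, v) = ∑_T h⁻¹ ⟨w₀ - w_b, v₀ - v_b⟩_{∂T}`. -/
def stabilizer (w v : WeakFun T) : ℝ :=
  ∑ i, (meshSize T)⁻¹ * ∑ a, (T i).edgeIntegral a fun x =>
    (evalAt (w.1 i) x - w.bdry i a x) * (evalAt (v.1 i) x - v.bdry i a x)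

/-- The load functional `(g, v₀)`. -/
def load (g : Plane → ℝ) (v : WeakFun T) : ℝ :=
  ∑ i, (T i).integral fun x => g x * evalAt (v.1 i) x

/-- The pair `(θ, w) ∈ Θ_h^0 × W_h^0` solves the weak Galerkin scheme for the clamped
Reissner–Mindlin plate with bending tensor `C`, shear correction factor `lam`, thickness `d` and
load `g`; the space `W_h` has degrees `k, p` and the space `Θ_h` has degrees `q, m`. -/
structure IsWGSolution (Ω : Set Plane) (k p q m : ℕ)
    (C : Matrix (Fin 2) (Fin 2) ℝ →ₗ[ℝ] Matrix (Fin 2) (Fin 2) ℝ) (lam d : ℝ) (g : Plane → ℝ)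
    (θ : Fin 2 → WeakFun T) (w : WeakFun T) : Prop where
  rotation_mem : θ ∈ rotationSpace₀ T Ω q m
  displacement_mem : w ∈ weakSpace₀ T Ω k p
  equation : ∀ η ∈ rotationSpace₀ T Ω q m, ∀ v ∈ weakSpace₀ T Ω k p,
    bendingForm k C θ η + lam * (d ^ 2)⁻¹ * shearForm k w θ v η + stabilizer w v = load g v

end Mesh

end

end WG

/-! The scheme is a square linear system on the finite-dimensional space `Θ_h^0 × W_h^0`, so it is
enough that its form is definite (`existsUnique_of_definite`, `eq_zero_of_form_eq_zero`). If the
form vanishes at `(θ, w)`, three nonnegative terms vanish: `ε_w θ = 0`, the shear strain is zero,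
and `w_b = w_0` on all edges. The stabilizer does not see the jumps of `θ`, so `θ = 0` has to follow
from `ε_w θ = 0` alone; this is what the large degree `r` is for.

By Green's formula (`integral_pderiv`, obtained by slicing the polygon along lines), `ε_w θ = 0`
says that `(∇θ_0, τ)_T + ⟨θ_b - θ_0, τ n⟩ = 0` for all symmetric `τ` of degree `r`. A bubble that
vanishes on every edge and is nonnegative on `T`, multiplied by the strain of `θ_0`, is an
admissible `τ`; hence the strain is zero (`strain_eq_zero`). What remains is a balance of jumps. A
bubble attached to one edge, multiplied by a symmetric tensor that maps the normal to the jump,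
shows that the jump is zero on that edge (`jump_eq_zero`). Several edges of one element on a common
line cannot be separated by products of affine functions, but then all of them lie on `∂Ω`, where
the jump is the single polynomial `-θ_0`. On those with opposite normal a quadratic factor reverses
the sign of the bubble, so that no cancellation occurs.

Now `θ_0` is a rigid motion on each element. Rigid motions that agree at both ends of a common edge
coincide, and they vanish next to `∂Ω`. Elements with a given nonzero value would, up to finitely
many vertices, fill a set that is open and closed in the plane, contradicting boundedness
(`eq_zero_of_edges`); connectedness of `Ω` plays no role. So `θ = 0`, hence `∇_w w = 0`, and since
`w` has no jumps, `w_0` is constant on each element. The same propagation gives `w = 0`. -/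

namespace WG

noncomputable section

namespace PolygonalElement

variable (K : PolygonalElement)

/-! ### Local structure of an element near an edge -/

/-- The end point of the `i`-th edge other than `vertex i`. -/
abbrev next (i : Fin K.N) : Plane := K.vertex (finRotate K.N i)

theorem finRotate_ne_self {n : ℕ} (hn : 2 ≤ n) (i : Fin n) : finRotate n i ≠ i := by
  obtain ⟨n, rfl⟩ : ∃ k, n = k + 1 := ⟨n - 1, by omega⟩
  intro h
  rw [finRotate_apply] at h
  have h1 : (1 : Fin (n + 1)) = 0 := by simpa using h
  have := congrArg Fin.val h1
  rw [Fin.val_one', Fin.val_zero, Nat.mod_eq_of_lt (by omega)] at this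
  omega

theorem next_ne_vertex (i : Fin K.N) : K.next i ≠ K.vertex i := fun h =>
  finRotate_ne_self (by have := K.three_le; omega) i (K.vertex_injective h)

theorem isCompact_edge (i : Fin K.N) : IsCompact (K.edge i) := by
  unfold edge
  rw [← convexHull_pair]
  exact (Set.toFinite _).isCompact_convexHull ..

theorem edge_subset_frontier (i : Fin K.N) : K.edge i ⊆ frontier K.carrier := by
  rw [K.frontier_carrier]
  exact Set.subset_iUnion (fun i => segment ℝ (K.vertex i) (K.vertex (finRotate K.N i))) i

theorem openSegment_subset_edge (i : Fin K.N) :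
    openSegment ℝ (K.vertex i) (K.next i) ⊆ K.edge i := openSegment_subset_segment ..

theorem mem_edge_iff (i : Fin K.N) (x : Plane) :
    x ∈ K.edge i ↔ x ∈ openSegment ℝ (K.vertex i) (K.next i) ∨ x ∈ K.ends i := by
  unfold edge ends
  rw [← insert_endpoints_openSegment]
  simp only [Set.mem_insert_iff, Set.mem_singleton_iff]
  tauto

theorem not_mem_ends_of_mem_openSegment (i : Fin K.N) {x : Plane}
    (hx : x ∈ openSegment ℝ (K.vertex i) (K.next i)) : x ∉ K.ends i := by
  rintro (h | h)
  · rw [h, left_mem_openSegment_iff] at hx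
    exact K.next_ne_vertex i hx.symm
  · rw [Set.mem_singleton_iff] at h
    rw [h, right_mem_openSegment_iff] at hx
    exact K.next_ne_vertex i hx.symm

theorem not_mem_edge_of_ne {i j : Fin K.N} (h : i ≠ j) {x : Plane}
    (hx : x ∈ openSegment ℝ (K.vertex i) (K.next i)) : x ∉ K.edge j := fun hj =>
  K.not_mem_ends_of_mem_openSegment i hx
    (K.simple i j h ⟨K.openSegment_subset_edge i hx, hj⟩).1

/-- An edge is orthogonal to its normal. -/
theorem inner_normal_eq_zero (i : Fin K.N) {x y : Plane} (hx : x ∈ K.edge i) (hy : y ∈ K.edge i) :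
    inner ℝ (K.normal i) (x - y) = 0 := by
  have key : ∀ z ∈ K.edge i, inner ℝ (K.normal i) (z - K.vertex i) = 0 := by
    rintro z hz
    unfold edge at hz
    rw [segment_eq_image'] at hz
    obtain ⟨t, -, rfl⟩ := hz
    rw [add_sub_cancel_left, inner_smul_right, K.normal_orthogonal i, mul_zero]
  have := key x hx
  have h2 := key y hy
  rw [← sub_sub_sub_cancel_right x y (K.vertex i), inner_sub_right, this, h2, sub_zero]

/-- An open set is relatively clopen in any set that avoids its frontier. This serves for half discs
next to an edge and for the plane without the vertices. -/
theorem _root_.IsPreconnected.subset_of_disjoint_frontier {X : Type*} [TopologicalSpace X]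
    {s t : Set X} (hs : IsPreconnected s) (ht : IsOpen t) (hd : Disjoint (frontier t) s)
    (hne : (s ∩ t).Nonempty) : s ⊆ t := by
  have : PreconnectedSpace s := isPreconnected_iff_preconnectedSpace.1 hs
  obtain ⟨x, hx, hxt⟩ := hne
  have h := (isClopen_preimage_val ht hd).eq_univ ⟨⟨x, hx⟩, hxt⟩
  intro y hy
  have : (⟨y, hy⟩ : s) ∈ (Subtype.val ⁻¹' t : Set s) := by rw [h]; trivial
  exact this

/-- Near an interior point of an edge the element is the half plane on the inner side. -/
theorem exists_half_disc (i : Fin K.N) {x : Plane}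
    (hx : x ∈ openSegment ℝ (K.vertex i) (K.next i)) :
    ∃ ε > 0, ∀ z ∈ Metric.ball x ε,
      (inner ℝ (K.normal i) (z - x) < 0 → z ∈ K.carrier) ∧
      (0 < inner ℝ (K.normal i) (z - x) → z ∉ closure K.carrier) := by
  -- The other edges form a closed set that misses `x`, so a small disc around `x` meets the
  -- frontier only in the line of the `i`-th edge.
  have hcl : IsClosed (⋃ j ∈ {j | j ≠ i}, K.edge j) :=
    (Set.toFinite _).isClosed_biUnion fun j _ => (K.isCompact_edge j).isClosed
  have hxn : x ∈ (⋃ j ∈ {j | j ≠ i}, K.edge j)ᶜ := by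
    simp only [Set.mem_compl_iff, Set.mem_iUnion, not_exists]
    exact fun j hj => K.not_mem_edge_of_ne (Ne.symm hj) hx
  obtain ⟨ε, hε, hball⟩ := Metric.isOpen_iff.1 hcl.isOpen_compl x hxn
  have hfr : ∀ z ∈ Metric.ball x ε, z ∈ frontier K.carrier →
      inner ℝ (K.normal i) (z - x) = 0 := by
    intro z hz hzf
    rw [K.frontier_carrier] at hzf
    obtain ⟨j, hj⟩ := Set.mem_iUnion.1 hzf
    by_cases hji : j = i
    · subst hji
      exact K.inner_normal_eq_zero j hj (K.openSegment_subset_edge j hx)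
    · exact absurd (Set.mem_biUnion (t := K.edge) (x := j) hji hj) (hball hz)
  have hlin : IsLinearMap ℝ fun z : Plane => inner ℝ (K.normal i) z :=
    ⟨fun a b => inner_add_right .., fun c a => inner_smul_right ..⟩
  have hsmall : ∀ᶠ s : ℝ in nhdsWithin 0 (Set.Ioi 0), s < ε ∧ 0 < s := by
    filter_upwards [Ioo_mem_nhdsGT hε] with s hs using ⟨hs.2, hs.1⟩
  -- One small `s` decides for both half discs: `x - s n` is in the element, `x + s n` is not.
  obtain ⟨s, ⟨hs1, hs2⟩, hsε, hs0⟩ := ((K.normal_outward i x hx).and hsmall).exists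
  have hnn : inner ℝ (K.normal i) (K.normal i) = (1 : ℝ) := by
    rw [real_inner_self_eq_norm_sq, K.norm_normal, one_pow]
  have hm : x - s • K.normal i ∈ Metric.ball x ε := by
    simp [norm_smul, K.norm_normal, abs_of_pos hs0, hsε]
  have hp : x + s • K.normal i ∈ Metric.ball x ε := by
    simp [norm_smul, K.norm_normal, abs_of_pos hs0, hsε]
  have hcont : Continuous fun z : Plane => inner ℝ (K.normal i) (z - x) := by fun_prop
  have e : ∀ z : Plane, inner ℝ (K.normal i) (z - x) =
      inner ℝ (K.normal i) z - inner ℝ (K.normal i) x := fun z => inner_sub_right ..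
  refine ⟨ε, hε, fun z hz => ⟨fun hz0 => ?_, fun hz0 hzc => ?_⟩⟩
  · have hconv : Convex ℝ (Metric.ball x ε ∩ {z | inner ℝ (K.normal i) (z - x) < 0}) := by
      refine (convex_ball x ε).inter ?_
      simp only [e, sub_neg]
      exact convex_halfSpace_lt hlin _
    refine hconv.isPreconnected.subset_of_disjoint_frontier K.isOpen_carrier ?_ ?_ ⟨hz, hz0⟩
    · rw [Set.disjoint_left]
      rintro y hy ⟨hyb, hy0⟩
      exact absurd (hfr y hyb hy) (ne_of_lt hy0)
    · refine ⟨_, ⟨hm, ?_⟩, hs1⟩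
      simp only [Set.mem_ofPred_eq, sub_sub_cancel_left, inner_neg_right, inner_smul_right, hnn]
      linarith
  · have hconv : Convex ℝ (Metric.ball x ε ∩ {z | 0 < inner ℝ (K.normal i) (z - x)}) := by
      refine (convex_ball x ε).inter ?_
      simp only [e, sub_pos]
      exact convex_halfSpace_gt hlin _
    have hopen : IsOpen (Metric.ball x ε ∩ {z | 0 < inner ℝ (K.normal i) (z - x)}) :=
      Metric.isOpen_ball.inter (isOpen_lt continuous_const hcont)
    -- A closure point in the outer half disc would put the whole half disc inside the element,
    -- together with `x + s n`.
    have hsub := hconv.isPreconnected.subset_of_disjoint_frontier K.isOpen_carrier (by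
      rw [Set.disjoint_left]
      rintro y hy ⟨hyb, hy0⟩
      exact absurd (hfr y hyb hy) (ne_of_gt hy0)) (mem_closure_iff.1 hzc _ hopen ⟨hz, hz0⟩)
    refine hs2 (hsub ⟨hp, ?_⟩)
    simp only [Set.mem_ofPred_eq, add_sub_cancel_left, inner_smul_right, hnn]
    linarith

end PolygonalElement

/-! ### The fundamental theorem of calculus on a finite union of intervals -/

/-- A real function that vanishes on a punctured neighbourhood of each point is zero almost
everywhere. -/
theorem ae_eq_zero_of_eventually_nhdsNE {D : ℝ → ℝ}
    (h : ∀ x, ∀ᶠ t in nhdsWithin x {x}ᶜ, D t = 0) : ∀ᵐ t, D t = 0 := by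
  refine measure_null_of_locally_null _ fun x _ => ?_
  have hx := eventually_nhdsWithin_iff.1 (h x)
  refine ⟨{t | D t ≠ 0} ∩ {t | t ∈ ({x}ᶜ : Set ℝ) → D t = 0},
    inter_mem_nhdsWithin _ hx, measure_mono_null (t := {x}) ?_ (by simp)⟩
  rintro t ⟨ht, ht'⟩
  by_contra hne
  exact ht (ht' hne)

/-- A real function that is constant on a punctured neighbourhood of each point and vanishes on some
open interval vanishes on a punctured neighbourhood of each point. -/
theorem eventually_nhdsNE_eq_zero_of_locally_const {D : ℝ → ℝ}
    (h : ∀ x, ∃ k, ∀ᶠ t in nhdsWithin x {x}ᶜ, D t = k) {x₀ : ℝ}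
    (h₀ : ∀ᶠ t in nhdsWithin x₀ {x₀}ᶜ, D t = 0) (x : ℝ) :
    ∀ᶠ t in nhdsWithin x {x}ᶜ, D t = 0 := by
  set A : Set ℝ := {x | ∀ᶠ t in nhdsWithin x {x}ᶜ, D t = 0} with hA
  -- The property of being equal to `k` on a punctured neighbourhood passes to nearby points with
  -- the same `k`. Hence `A` is open; it is also closed, because a limit point shares its constant
  -- with points of `A`.
  have key : ∀ x k, (∀ᶠ t in nhdsWithin x {x}ᶜ, D t = k) →
      ∀ᶠ y in nhds x, ∀ᶠ t in nhdsWithin y {y}ᶜ, D t = k := by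
    intro x k hk
    obtain ⟨u, hux, hu, hxu⟩ := eventually_nhds_iff.1 (eventually_nhdsWithin_iff.1 hk)
    refine eventually_nhds_iff.2 ⟨u, fun y hy => ?_, hu, hxu⟩
    by_cases hyx : y = x
    · rwa [hyx]
    · have : u ∩ {x}ᶜ ∈ nhds y := (hu.inter isOpen_compl_singleton).mem_nhds ⟨hy, hyx⟩
      exact Filter.Eventually.filter_mono nhdsWithin_le_nhds
        (Filter.mem_of_superset this fun t ht => hux t ht.1 ht.2)
  have hopen : IsOpen A := isOpen_iff_mem_nhds.2 fun x hx => key x 0 hx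
  have hclosed : IsClosed A := by
    refine isClosed_of_closure_subset fun x hx => ?_
    obtain ⟨k, hk⟩ := h x
    obtain ⟨y, hyA, hyk⟩ := ((mem_closure_iff_frequently.1 hx).and_eventually (key x k hk)).exists
    obtain ⟨t, ht0, htk⟩ := (Filter.Eventually.and (show ∀ᶠ t in nhdsWithin y {y}ᶜ, D t = 0 from hyA)
      hyk).exists
    have hk0 : k = 0 := htk.symm.trans ht0
    rwa [hk0] at hk
  have hAu : A = Set.univ := IsClopen.eq_univ ⟨hclosed, hopen⟩ ⟨x₀, h₀⟩
  exact (Set.ext_iff.1 hAu x).2 trivial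

theorem eventually_nhdsNE_indicator_Iio {c x : ℝ} (h : c ≠ x) :
    ∀ᶠ t in nhdsWithin x {x}ᶜ, (Set.Iio c).indicator (fun _ => (1 : ℝ)) t =
      (Set.Iio c).indicator (fun _ => (1 : ℝ)) x := by
  refine Filter.Eventually.filter_mono nhdsWithin_le_nhds ?_
  rcases lt_or_gt_of_ne h with h | h
  · filter_upwards [Ioi_mem_nhds h] with t ht
    rw [Set.indicator_of_notMem (by simpa using le_of_lt ht),
      Set.indicator_of_notMem (by simpa using h.le)]
  · filter_upwards [Iio_mem_nhds h] with t ht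
    rw [Set.indicator_of_mem ht, Set.indicator_of_mem (show x ∈ Set.Iio c from h)]

/-- The integral of a derivative over a bounded set `U` of the line whose indicator function jumps
by `-σ i` at the points `c i` and is locally constant elsewhere. -/
theorem setIntegral_deriv_eq_sum {κ : Type*} (s : Finset κ) (c σ : κ → ℝ) (hc : Set.InjOn c s)
    {U : Set ℝ} (hU : MeasurableSet U) (hb : Bornology.IsBounded U)
    (hloc : ∀ x, (∀ i ∈ s, c i ≠ x) →
      ∃ k, ∀ᶠ t in nhdsWithin x {x}ᶜ, U.indicator (fun _ => (1 : ℝ)) t = k)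
    (hjump : ∀ i ∈ s, ∃ k, ∀ᶠ t in nhdsWithin (c i) {c i}ᶜ, U.indicator (fun _ => (1 : ℝ)) t =
      k + σ i * (Set.Iio (c i)).indicator (fun _ => (1 : ℝ)) t)
    {f f' : ℝ → ℝ} (hf : ∀ x, HasDerivAt f (f' x) x) (hf' : Continuous f') :
    ∫ x in U, f' x = ∑ i ∈ s, σ i * f (c i) := by
  classical
  -- `D` compares the indicator of `U` with a combination of indicators of half lines that has the
  -- same jumps. It is therefore constant up to isolated points, and it is zero to the right of
  -- everything, so it vanishes almost everywhere.
  set D : ℝ → ℝ := fun t => U.indicator (fun _ => (1 : ℝ)) t -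
    ∑ i ∈ s, σ i * (Set.Iio (c i)).indicator (fun _ => (1 : ℝ)) t with hD
  have hsum : ∀ (s' : Finset κ) x, (∀ i ∈ s', c i ≠ x) → ∃ k, ∀ᶠ t in nhdsWithin x {x}ᶜ,
      ∑ i ∈ s', σ i * (Set.Iio (c i)).indicator (fun _ => (1 : ℝ)) t = k := by
    intro s' x hx
    refine ⟨∑ i ∈ s', σ i * (Set.Iio (c i)).indicator (fun _ => (1 : ℝ)) x, ?_⟩
    have := (Filter.eventually_all_finset s').2 fun i hi => eventually_nhdsNE_indicator_Iio (hx i hi)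
    filter_upwards [this] with t ht
    exact Finset.sum_congr rfl fun i hi => by rw [ht i hi]
  have hDloc : ∀ x, ∃ k, ∀ᶠ t in nhdsWithin x {x}ᶜ, D t = k := by
    intro x
    by_cases hx : ∀ i ∈ s, c i ≠ x
    · obtain ⟨k, hk⟩ := hloc x hx
      obtain ⟨k', hk'⟩ := hsum s x hx
      refine ⟨k - k', ?_⟩
      filter_upwards [hk, hk'] with t ht ht'
      rw [hD]
      simp only [ht, ht']
    · push Not at hx
      obtain ⟨j, hj, rfl⟩ := hx
      obtain ⟨k, hk⟩ := hjump j hj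
      obtain ⟨k', hk'⟩ := hsum (s.erase j) (c j) fun i hi h =>
        (Finset.mem_erase.1 hi).1 (hc (Finset.mem_erase.1 hi).2 hj h)
      refine ⟨k - k', ?_⟩
      filter_upwards [hk, hk'] with t ht ht'
      rw [hD]
      simp only [ht, ← Finset.add_sum_erase s _ hj, ht']
      ring
  obtain ⟨R₁, hR₁⟩ := hb.exists_norm_le
  obtain ⟨R, hRU, hRc⟩ : ∃ R : ℝ, (∀ x ∈ U, |x| < R) ∧ ∀ i ∈ s, |c i| < R := by
    obtain ⟨R₂, hR₂⟩ := (s.image fun i => |c i|).bddAbove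
    refine ⟨max R₁ R₂ + 1, fun x hx => ?_, fun i hi => ?_⟩
    · have := hR₁ x hx
      rw [Real.norm_eq_abs] at this
      have := le_max_left R₁ R₂
      linarith
    · have := hR₂ (Finset.mem_coe.2 (Finset.mem_image_of_mem (fun i => |c i|) hi))
      have := le_max_right R₁ R₂
      linarith
  have hDR : ∀ᶠ t in nhdsWithin R {R}ᶜ, D t = 0 := by
    obtain ⟨k, hk⟩ := hDloc R
    have hgt : ∀ᶠ t in nhdsWithin R (Set.Ioi R), D t = k :=
      hk.filter_mono (nhdsWithin_mono _ fun t ht => ne_of_gt ht)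
    obtain ⟨t, htk, htR⟩ := (hgt.and self_mem_nhdsWithin).exists
    have : D t = 0 := by
      have h1 : t ∉ U := fun h => absurd ((le_abs_self t).trans_lt (hRU t h)) (not_lt.2 htR.le)
      have h2 : ∀ i ∈ s, t ∉ Set.Iio (c i) := fun i hi h =>
        absurd ((lt_trans h ((le_abs_self _).trans_lt (hRc i hi)))) (not_lt.2 htR.le)
      simp only [hD, Set.indicator_of_notMem h1]
      rw [Finset.sum_eq_zero fun i hi => by rw [Set.indicator_of_notMem (h2 i hi), mul_zero],
        sub_zero]
    rwa [← htk.symm.trans this]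
  have hD0 := eventually_nhdsNE_eq_zero_of_locally_const hDloc hDR
  -- To the left of everything all the half lines are present and `U` is not. This relation removes
  -- the terms `f (-R)` below.
  have hσ : ∑ i ∈ s, σ i = 0 := by
    have hlt : ∀ᶠ t in nhdsWithin (-R) (Set.Iio (-R)), D t = 0 :=
      (hD0 (-R)).filter_mono (nhdsWithin_mono _ fun t ht => ne_of_lt ht)
    obtain ⟨t, ht0, htR⟩ := (hlt.and self_mem_nhdsWithin).exists
    have h1 : t ∉ U := fun h => by have := (abs_lt.1 (hRU t h)).1; linarith
    have h2 : ∀ i ∈ s, t ∈ Set.Iio (c i) := fun i hi => by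
      have := (abs_lt.1 (hRc i hi)).1
      rw [Set.mem_Iio]; linarith
    simp only [hD, Set.indicator_of_notMem h1] at ht0
    rw [Finset.sum_congr rfl fun i hi => by rw [Set.indicator_of_mem (h2 i hi), mul_one]] at ht0
    linarith
  have hae := ae_eq_zero_of_eventually_nhdsNE hD0
  have hi : ∀ i ∈ s, IntegrableOn f' (Set.Ioo (-R) (c i)) := fun i _ =>
    hf'.integrableOn_Ioc.mono_set Set.Ioo_subset_Ioc_self
  have hUR : ∫ x in U, f' x = ∫ x in Set.Ioi (-R), U.indicator f' x := by
    rw [setIntegral_indicator hU, Set.inter_eq_self_of_subset_right]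
    intro x hx
    have := (abs_lt.1 (hRU x hx)).1
    exact this
  calc ∫ x in U, f' x = ∫ x in Set.Ioi (-R), U.indicator f' x := hUR
    _ = ∫ x in Set.Ioi (-R), ∑ i ∈ s, σ i * (Set.Iio (c i)).indicator f' x := by
      refine integral_congr_ae (ae_restrict_of_ae ?_)
      filter_upwards [hae] with x hx
      have e : ∀ V : Set ℝ, V.indicator f' x = V.indicator (fun _ => (1 : ℝ)) x * f' x := by
        intro V
        by_cases h : x ∈ V <;> simp [h]
      simp only [hD, sub_eq_zero] at hx
      rw [e, hx, Finset.sum_mul]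
      exact Finset.sum_congr rfl fun i _ => by rw [e (Set.Iio (c i)), mul_assoc]
    _ = ∑ i ∈ s, σ i * (f (c i) - f (-R)) := by
      rw [integral_finsetSum]
      · refine Finset.sum_congr rfl fun i hi' => ?_
        rw [MeasureTheory.integral_const_mul, setIntegral_indicator measurableSet_Iio,
          Set.Ioi_inter_Iio, ← integral_Ioc_eq_integral_Ioo, ← intervalIntegral.integral_of_le
          (by have := (abs_lt.1 (hRc i hi')).1; linarith),
          intervalIntegral.integral_eq_sub_of_hasDerivAt (fun x _ => hf x)
            (hf'.intervalIntegrable _ _)]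
      · intro i hi'
        refine Integrable.const_mul ?_ _
        rw [integrable_indicator_iff measurableSet_Iio, IntegrableOn,
          Measure.restrict_restrict measurableSet_Iio, Set.inter_comm, Set.Ioi_inter_Iio]
        exact hi i hi'
    _ = ∑ i ∈ s, σ i * f (c i) := by
      simp only [mul_sub, Finset.sum_sub_distrib, ← Finset.sum_mul, hσ, zero_mul, sub_zero]

/-! ### Polynomials along lines -/

@[simp] theorem evalAt_mul (P Q : Poly) (x : Plane) :
    evalAt (P * Q) x = evalAt P x * evalAt Q x := by simp [evalAt]

@[simp] theorem evalAt_C (c : ℝ) (x : Plane) : evalAt (MvPolynomial.C c) x = c := by simp [evalAt]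

@[simp] theorem evalAt_X (l : Fin 2) (x : Plane) : evalAt (MvPolynomial.X l) x = x l := by
  simp [evalAt]

@[simp] theorem evalAt_sub (P Q : Poly) (x : Plane) :
    evalAt (P - Q) x = evalAt P x - evalAt Q x := by simp [evalAt]

@[simp] theorem evalAt_neg (P : Poly) (x : Plane) : evalAt (-P) x = -evalAt P x := by
  simp [evalAt]

@[simp] theorem evalAt_zero (x : Plane) : evalAt 0 x = 0 := by simp [evalAt]

@[simp] theorem evalAt_one (x : Plane) : evalAt 1 x = 1 := by simp [evalAt]

@[simp] theorem evalAt_sum {κ : Type*} (s : Finset κ) (P : κ → Poly) (x : Plane) :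
    evalAt (∑ i ∈ s, P i) x = ∑ i ∈ s, evalAt (P i) x := by simp [evalAt]

@[simp] theorem evalAt_prod {κ : Type*} (s : Finset κ) (P : κ → Poly) (x : Plane) :
    evalAt (∏ i ∈ s, P i) x = ∏ i ∈ s, evalAt (P i) x := by simp [evalAt, map_prod]

@[simp] theorem evalAt_pow (P : Poly) (n : ℕ) (x : Plane) :
    evalAt (P ^ n) x = evalAt P x ^ n := by simp [evalAt]

theorem hasDerivAt_evalAt_line (P : Poly) (a b : Plane) (t : ℝ) :
    HasDerivAt (fun t : ℝ => evalAt P (a + t • b))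
      (∑ l, b l * evalAt (MvPolynomial.pderiv l P) (a + t • b)) t := by
  induction P using MvPolynomial.induction_on with
  | C c => simpa using hasDerivAt_const t c
  | add p q hp hq =>
    simp only [evalAt_add, map_add, mul_add, Finset.sum_add_distrib]
    exact hp.add hq
  | mul_X p i hp =>
    have hX : HasDerivAt (fun t : ℝ => evalAt (MvPolynomial.X i) (a + t • b)) (b i) t := by
      simpa using ((hasDerivAt_id t).mul_const (b i)).const_add (a i)
    have h : HasDerivAt (fun t : ℝ => evalAt (p * MvPolynomial.X i) (a + t • b)) _ t :=
      (hp.mul hX).congr_of_eventuallyEq (Filter.Eventually.of_forall fun t => evalAt_mul _ _ _)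
    refine h.congr_deriv ?_
    fin_cases i <;> simp [MvPolynomial.pderiv_X, Pi.single_apply] <;> ring

/-- The point with `l`-th coordinate `x` and other coordinate `y`. -/
def pt (l : Fin 2) (x y : ℝ) : Plane := WithLp.toLp 2 fun i => if i = l then x else y

@[simp] theorem pt_self (l : Fin 2) (x y : ℝ) : pt l x y l = x := by simp [pt]

@[simp] theorem pt_rev (l : Fin 2) (x y : ℝ) : pt l x y l.rev = y := by
  fin_cases l <;> simp [pt]

/-- On `Fin 2`, `l.rev` is the index other than `l`; in this way one argument serves both
coordinates. -/
theorem ext_coord {l : Fin 2} {x y : Plane} (h : x l = y l) (h' : x l.rev = y l.rev) : x = y := by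
  ext i
  fin_cases l <;> fin_cases i <;> first | exact h | exact h'

theorem sum_coord (l : Fin 2) (f : Fin 2 → ℝ) : ∑ i, f i = f l + f l.rev := by
  fin_cases l
  · exact Fin.sum_univ_two f
  · exact (Fin.sum_univ_two f).trans (add_comm _ _)

theorem pt_coord (l : Fin 2) (z : Plane) : pt l (z l) (z l.rev) = z :=
  ext_coord (l := l) (by simp) (by simp)

theorem continuous_pt (l : Fin 2) (y : ℝ) : Continuous fun x => pt l x y := by
  unfold pt
  refine (PiLp.continuous_toLp 2 _).comp (continuous_pi fun i => ?_)
  by_cases h : i = l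
  · simpa [h] using continuous_id'
  · simpa [h] using continuous_const

theorem hasDerivAt_evalAt_pt (P : Poly) (l : Fin 2) (x y : ℝ) :
    HasDerivAt (fun x => evalAt P (pt l x y)) (evalAt (MvPolynomial.pderiv l P) (pt l x y)) x := by
  have h := hasDerivAt_evalAt_line P (pt l 0 y) (pt l 1 0) x
  have e : ∀ x : ℝ, pt l 0 y + x • pt l 1 0 = pt l x y := fun x =>
    ext_coord (l := l) (by simp) (by simp)
  simpa only [e, sum_coord l, pt_self, pt_rev, one_mul, zero_mul, add_zero] using h

/-- Fubini's theorem with the inner integral in the direction in which Green's formula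
differentiates. -/
theorem integral_plane (l : Fin 2) {F : Plane → ℝ} (hF : Integrable F) :
    ∫ z, F z = ∫ y, ∫ x, F (pt l x y) := by
  have h1 := PiLp.volume_preserving_toLp (Fin 2)
  have h2 := (volume_preserving_finTwoArrow ℝ).symm
  have h3 := h1.comp h2
  have hme : MeasurableEmbedding ((@WithLp.toLp 2 (Fin 2 → ℝ)) ∘
      (MeasurableEquiv.finTwoArrow (α := ℝ)).symm) :=
    (MeasurableEquiv.toLp 2 (Fin 2 → ℝ)).measurableEmbedding.comp
      (MeasurableEquiv.measurableEmbedding _)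
  have hint := (h3.integrable_comp_emb hme).2 hF
  rw [← h3.integral_comp hme]
  have e0 : ∀ x y : ℝ, (@WithLp.toLp 2 (Fin 2 → ℝ)) ((MeasurableEquiv.finTwoArrow).symm (x, y)) =
      pt 0 x y := fun x y => by
    ext i; fin_cases i <;> simp [pt, MeasurableEquiv.finTwoArrow]
  have e1 : ∀ x y : ℝ, pt 1 x y = pt 0 y x := fun x y => by
    ext i; fin_cases i <;> simp [pt]
  have hl : l = 0 ∨ l = 1 := by fin_cases l <;> simp
  rcases hl with rfl | rfl
  · exact (integral_prod_symm _ hint).trans (by simp only [Function.comp_apply, e0])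
  · exact (integral_prod _ hint).trans (by simp only [Function.comp_apply, e0, e1])

theorem lineMap_coord (a b : Plane) (s : ℝ) (l : Fin 2) :
    (AffineMap.lineMap a b s : Plane) l = a l + s * (b l - a l) := by
  simp [AffineMap.lineMap_apply]
  ring

namespace PolygonalElement

variable (K : PolygonalElement)

/-! ### Green's formula -/

/-- The parameter on the `i`-th edge of the point whose coordinate other than the `l`-th is `y`. -/
def edgeParam (l : Fin 2) (i : Fin K.N) (y : ℝ) : ℝ :=
  (y - K.vertex i l.rev) / (K.next i l.rev - K.vertex i l.rev)

/-- The point of the line through the `i`-th edge with parameter `s`. -/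
def edgePoint (i : Fin K.N) (s : ℝ) : Plane := AffineMap.lineMap (K.vertex i) (K.next i) s

theorem edgePoint_mem_openSegment (i : Fin K.N) {s : ℝ} (hs : s ∈ Set.Ioo (0 : ℝ) 1) :
    K.edgePoint i s ∈ openSegment ℝ (K.vertex i) (K.next i) := by
  rw [openSegment_eq_image_lineMap]
  exact ⟨s, hs, rfl⟩

theorem edgePoint_mem_edge (i : Fin K.N) {s : ℝ} (hs : s ∈ Set.Icc (0 : ℝ) 1) :
    K.edgePoint i s ∈ K.edge i := by
  unfold edge
  rw [segment_eq_image_lineMap]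
  exact ⟨s, hs, rfl⟩

theorem edgePoint_edgeParam_rev (l : Fin 2) (i : Fin K.N) {y : ℝ}
    (h : K.edgeParam l i y ∈ Set.Ioo (0 : ℝ) 1) :
    K.edgePoint i (K.edgeParam l i y) l.rev = y := by
  -- On an edge parallel to the `l`-th axis the parameter is a division by zero, hence `0`, which is
  -- not in the open interval.
  have hne : K.next i l.rev - K.vertex i l.rev ≠ 0 := fun h0 => by
    simp [edgeParam, h0] at h
  rw [edgePoint, lineMap_coord, edgeParam, div_mul_cancel₀ _ hne]
  ring

theorem normal_coord (l : Fin 2) (i : Fin K.N) :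
    K.normal i l * (K.next i l - K.vertex i l) +
      K.normal i l.rev * (K.next i l.rev - K.vertex i l.rev) = 0 := by
  have h := K.normal_orthogonal i
  rw [PiLp.inner_apply, sum_coord l] at h
  simpa [mul_comm, -finRotate_apply] using h

theorem normal_sq (l : Fin 2) (i : Fin K.N) : K.normal i l ^ 2 + K.normal i l.rev ^ 2 = 1 := by
  have h := EuclideanSpace.norm_sq_eq (K.normal i)
  rw [K.norm_normal, sum_coord l] at h
  simpa using h.symm

theorem dist_sq (l : Fin 2) (i : Fin K.N) : dist (K.vertex i) (K.next i) ^ 2 =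
    (K.next i l - K.vertex i l) ^ 2 + (K.next i l.rev - K.vertex i l.rev) ^ 2 := by
  rw [dist_comm, dist_eq_norm, EuclideanSpace.norm_sq_eq, sum_coord l]
  simp [-finRotate_apply]

/-- An edge crossed in its interior is not parallel to the `l`-th axis. The sign of this component
tells on which side of the crossing the element lies. -/
theorem normal_ne_zero_of_edgeParam (l : Fin 2) (i : Fin K.N) {y : ℝ}
    (h : K.edgeParam l i y ∈ Set.Ioo (0 : ℝ) 1) : K.normal i l ≠ 0 := by
  have hne : K.next i l.rev - K.vertex i l.rev ≠ 0 := fun h0 => by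
    simp [edgeParam, h0] at h
  intro h0
  have h1 := K.normal_coord l i
  rw [h0, zero_mul, zero_add, mul_eq_zero, or_iff_left hne] at h1
  have h2 := K.normal_sq l i
  rw [h0, h1] at h2
  norm_num at h2

/-- On a line parallel to the `l`-th axis that contains no vertex, the boundary points of the
element are the crossing points with the edges. -/
theorem exists_edgeParam_of_mem_frontier (l : Fin 2) {x y : ℝ} (hy : ∀ i, K.vertex i l.rev ≠ y)
    (h : pt l x y ∈ frontier K.carrier) :
    ∃ i, K.edgeParam l i y ∈ Set.Ioo (0 : ℝ) 1 ∧
      K.edgePoint i (K.edgeParam l i y) = pt l x y := by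
  rw [K.frontier_carrier] at h
  obtain ⟨i, hi⟩ := Set.mem_iUnion.1 h
  rw [segment_eq_image_lineMap] at hi
  obtain ⟨s, hs, hsx⟩ := hi
  have hsy := congrArg (fun z : Plane => z l.rev) hsx
  simp only [lineMap_coord, pt_rev] at hsy
  have hne : K.next i l.rev - K.vertex i l.rev ≠ 0 := fun h0 => by
    rw [h0] at hsy
    exact hy i (by simpa using hsy)
  have hsp : s = K.edgeParam l i y := by
    rw [edgeParam, eq_div_iff hne, ← hsy]
    ring
  refine ⟨i, ⟨?_, ?_⟩, by rw [← hsp]; exact hsx⟩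
  · rw [← hsp]
    refine lt_of_le_of_ne hs.1 fun h0 => hy i ?_
    rw [← h0] at hsy
    simpa using hsy
  · rw [← hsp]
    refine lt_of_le_of_ne hs.2 fun h0 => hy (finRotate K.N i) ?_
    rw [h0] at hsy
    simpa [-finRotate_apply] using hsy

theorem inner_pt_sub_pt (n : Plane) (l : Fin 2) (x x' y : ℝ) :
    inner ℝ n (pt l x y - pt l x' y) = n l * (x - x') := by
  rw [PiLp.inner_apply, sum_coord l]
  simp [mul_comm]

-- The one-dimensional fundamental theorem on a slice. Since the line avoids the vertices, every
-- crossing is interior to an edge, where `exists_half_disc` describes the element and so gives the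
-- jump of the indicator of the slice.
open Classical in
theorem setIntegral_slice (l : Fin 2) (P : Poly) {y : ℝ} (hy : ∀ i, K.vertex i l.rev ≠ y) :
    ∫ x in {x | pt l x y ∈ K.carrier}, evalAt (MvPolynomial.pderiv l P) (pt l x y) =
      ∑ i ∈ Finset.univ.filter fun i => K.edgeParam l i y ∈ Set.Ioo (0 : ℝ) 1,
        (SignType.sign (K.normal i l) : ℝ) * evalAt P (K.edgePoint i (K.edgeParam l i y)) := by
  have hmem : ∀ {i}, i ∈ Finset.univ.filter (fun i => K.edgeParam l i y ∈ Set.Ioo (0 : ℝ) 1) ↔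
      K.edgeParam l i y ∈ Set.Ioo (0 : ℝ) 1 := by simp
  have hpt : ∀ {i}, K.edgeParam l i y ∈ Set.Ioo (0 : ℝ) 1 →
      pt l (K.edgePoint i (K.edgeParam l i y) l) y = K.edgePoint i (K.edgeParam l i y) := by
    intro i hi
    have h := pt_coord l (K.edgePoint i (K.edgeParam l i y))
    rwa [K.edgePoint_edgeParam_rev l i hi] at h
  have hopen : IsOpen {x | pt l x y ∈ K.carrier} := K.isOpen_carrier.preimage (continuous_pt l y)
  have hin : ∀ {t}, pt l t y ∈ K.carrier →
      {x | pt l x y ∈ K.carrier}.indicator (fun _ => (1 : ℝ)) t = 1 := fun {t} ht =>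
    Set.indicator_of_mem (s := {x | pt l x y ∈ K.carrier}) ht _
  have hout : ∀ {t}, pt l t y ∉ K.carrier →
      {x | pt l x y ∈ K.carrier}.indicator (fun _ => (1 : ℝ)) t = 0 := fun {t} ht =>
    Set.indicator_of_notMem (s := {x | pt l x y ∈ K.carrier}) ht _
  rw [setIntegral_deriv_eq_sum _ (fun i => K.edgePoint i (K.edgeParam l i y) l)
    (fun i => (SignType.sign (K.normal i l) : ℝ)) ?_ hopen.measurableSet ?_ ?_ ?_
    (fun x => hasDerivAt_evalAt_pt P l x y)
    ((continuous_evalAt _).comp (continuous_pt l y))]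
  · exact Finset.sum_congr rfl fun i hi => by rw [hpt (hmem.1 hi)]
  -- Two edges crossed at the same point would share a point interior to both.
  · intro i hi j hj hij
    have hi' := hmem.1 hi
    have hj' := hmem.1 hj
    by_contra hne
    refine K.not_mem_edge_of_ne hne (K.edgePoint_mem_openSegment i hi') ?_
    rw [← hpt hi', show K.edgePoint i _ l = _ from hij, hpt hj']
    exact K.openSegment_subset_edge j (K.edgePoint_mem_openSegment j hj')
  · obtain ⟨R, hR⟩ := K.isBounded_carrier.exists_norm_le
    refine isBounded_iff_forall_norm_le.2 ⟨R, fun x hx => ?_⟩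
    have := PiLp.norm_apply_le (pt l x y) l
    rw [pt_self] at this
    exact this.trans (hR _ hx)
  · intro x hx
    have hnf : pt l x y ∉ frontier K.carrier := fun h => by
      obtain ⟨i, hi, hix⟩ := K.exists_edgeParam_of_mem_frontier l hy h
      exact hx i (hmem.2 hi) (by rw [hix, pt_self])
    by_cases hxK : pt l x y ∈ K.carrier
    · refine ⟨1, Filter.Eventually.filter_mono nhdsWithin_le_nhds ?_⟩
      filter_upwards [hopen.mem_nhds hxK] with t ht
      exact hin ht
    · refine ⟨0, Filter.Eventually.filter_mono nhdsWithin_le_nhds ?_⟩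
      have hc : pt l x y ∈ (closure K.carrier)ᶜ := fun h =>
        hnf ⟨h, fun h' => hxK (interior_subset h')⟩
      filter_upwards [(isClosed_closure.isOpen_compl.preimage (continuous_pt l y)).mem_nhds hc]
        with t ht
      exact hout fun h => ht (subset_closure h)
  · intro i hi
    have hi' := hmem.1 hi
    obtain ⟨ε, hε, hball⟩ := K.exists_half_disc i (K.edgePoint_mem_openSegment i hi')
    set c := K.edgePoint i (K.edgeParam l i y) l with hc
    have hnear : ∀ᶠ t in nhdsWithin c {c}ᶜ, t ≠ c ∧
        (K.normal i l * (t - c) < 0 → pt l t y ∈ K.carrier) ∧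
        (0 < K.normal i l * (t - c) → pt l t y ∉ K.carrier) := by
      have h1 : ∀ᶠ t in nhds c, pt l t y ∈ Metric.ball (pt l c y) ε :=
        (continuous_pt l y).continuousAt (Metric.ball_mem_nhds _ hε)
      filter_upwards [h1.filter_mono nhdsWithin_le_nhds, self_mem_nhdsWithin] with t ht htc
      rw [hpt hi'] at ht
      have h2 := hball _ ht
      rw [← hpt hi', inner_pt_sub_pt] at h2
      exact ⟨htc, h2.1, fun h h' => h2.2 h (subset_closure h')⟩
    -- If `n_l < 0` the element lies to the right of `c` and the indicator is `1 - 1_{t < c}`; if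
    -- `n_l > 0` it lies to the left and the indicator is `1_{t < c}`.
    rcases lt_or_gt_of_ne (K.normal_ne_zero_of_edgeParam l i hi') with hn | hn
    · refine ⟨1, ?_⟩
      filter_upwards [hnear] with t ⟨htc, ht1, ht2⟩
      rw [sign_neg hn]
      rcases lt_or_gt_of_ne htc with h | h
      · rw [hout (ht2 (mul_pos_of_neg_of_neg hn (sub_neg.2 h))),
          Set.indicator_of_mem (show t ∈ Set.Iio c from h)]
        simp
      · rw [hin (ht1 (mul_neg_of_neg_of_pos hn (sub_pos.2 h))),
          Set.indicator_of_notMem (show t ∉ Set.Iio c from not_lt.2 h.le)]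
        simp
    · refine ⟨0, ?_⟩
      filter_upwards [hnear] with t ⟨htc, ht1, ht2⟩
      rw [sign_pos hn]
      rcases lt_or_gt_of_ne htc with h | h
      · rw [hin (ht1 (mul_neg_of_pos_of_neg hn (sub_neg.2 h))),
          Set.indicator_of_mem (show t ∈ Set.Iio c from h)]
        simp
      · rw [hout (ht2 (mul_pos hn (sub_pos.2 h))),
          Set.indicator_of_notMem (show t ∉ Set.Iio c from not_lt.2 h.le)]
        simp

/-- A quarter turn takes the edge vector to plus or minus its length times the normal. This is the
Jacobian between arc length on the edge and the coordinate across the slices. -/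
theorem dist_mul_abs_normal (l : Fin 2) (i : Fin K.N) :
    dist (K.vertex i) (K.next i) * |K.normal i l| = |K.next i l.rev - K.vertex i l.rev| := by
  rw [← abs_of_nonneg (dist_nonneg (x := K.vertex i) (y := K.next i)), ← abs_mul]
  rw [abs_eq_abs, ← sq_eq_sq_iff_eq_or_eq_neg, mul_pow, K.dist_sq l i]
  linear_combination (K.normal i l * (K.next i l - K.vertex i l) -
      K.normal i l.rev * (K.next i l.rev - K.vertex i l.rev)) * K.normal_coord l i +
    (K.next i l.rev - K.vertex i l.rev) ^ 2 * K.normal_sq l i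

/-- Green's formula for polynomials on a polygonal element. -/
theorem integral_pderiv (P : Poly) (l : Fin 2) :
    K.integral (evalAt (MvPolynomial.pderiv l P)) =
      ∑ i, K.edgeIntegral i (fun x => evalAt P x * K.normal i l) := by
  classical
  have hF : Integrable (K.carrier.indicator (evalAt (MvPolynomial.pderiv l P))) :=
    (integrable_indicator_iff K.isOpen_carrier.measurableSet).2
      (K.integrableOn_of_continuous (continuous_evalAt _))
  set G : Fin K.N → ℝ → ℝ := fun i => (Set.Ioo (0 : ℝ) 1).indicator
    fun s => (SignType.sign (K.normal i l) : ℝ) * evalAt P (K.edgePoint i s) with hG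
  have hcont : ∀ i, Continuous fun s => evalAt P (K.edgePoint i s) := fun i =>
    (continuous_evalAt P).comp AffineMap.lineMap_continuous
  have hGi : ∀ i, Integrable (G i) := fun i => by
    rw [hG, integrable_indicator_iff measurableSet_Ioo]
    exact (((hcont i).const_mul _).integrableOn_Icc).mono_set Set.Ioo_subset_Icc_self
  have hGy : ∀ i, Integrable fun y => G i (K.edgeParam l i y) := fun i => by
    by_cases h0 : K.next i l.rev - K.vertex i l.rev = 0
    -- Edges parallel to the slices have parameter `0` by default and contribute nothing, in
    -- agreement with `n_l = 0`.
    · simp [edgeParam, h0, hG]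
    · exact ((hGi i).comp_div h0).comp_sub_right (K.vertex i l.rev)
  calc K.integral (evalAt (MvPolynomial.pderiv l P))
      = ∫ z, K.carrier.indicator (evalAt (MvPolynomial.pderiv l P)) z :=
        (integral_indicator K.isOpen_carrier.measurableSet).symm
    _ = ∫ y, ∫ x in {x | pt l x y ∈ K.carrier},
          evalAt (MvPolynomial.pderiv l P) (pt l x y) := by
        rw [integral_plane l hF]
        congr 1
        funext y
        exact integral_indicator (f := fun x => evalAt (MvPolynomial.pderiv l P) (pt l x y))
          (K.isOpen_carrier.preimage (continuous_pt l y)).measurableSet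
    _ = ∫ y, ∑ i, G i (K.edgeParam l i y) := by
        refine integral_congr_ae ?_
        -- Only finitely many slices pass through a vertex.
        have hfin : ∀ᵐ y : ℝ, y ∉ Set.range fun i => K.vertex i l.rev :=
          measure_eq_zero_iff_ae_notMem.1 ((Set.finite_range _).measure_zero _)
        filter_upwards [hfin] with y hy
        rw [K.setIntegral_slice l P fun i h => hy ⟨i, h⟩, Finset.sum_filter]
        exact Finset.sum_congr rfl fun i _ => by simp only [hG, Set.indicator_apply]
    _ = ∑ i, ∫ y, G i (K.edgeParam l i y) := integral_finsetSum _ fun i _ => hGy i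
    _ = ∑ i, K.edgeIntegral i (fun x => evalAt P x * K.normal i l) := by
        refine Finset.sum_congr rfl fun i _ => ?_
        -- The substitution `s = edgeParam l i y` yields the factor `dist * |n_l|`; with the sign of
        -- `n_l` it becomes `dist * n_l`.
        have h1 := integral_sub_right_eq_self
          (fun y => G i (y / (K.next i l.rev - K.vertex i l.rev))) (μ := volume) (K.vertex i l.rev)
        have h2 := Measure.integral_comp_div (G i) (K.next i l.rev - K.vertex i l.rev)
        rw [show (fun y => G i (K.edgeParam l i y)) = fun y => G i ((y - K.vertex i l.rev) /
          (K.next i l.rev - K.vertex i l.rev)) from rfl, h1, h2, hG]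
        simp only
        rw [integral_indicator measurableSet_Ioo, ← integral_Ioc_eq_integral_Ioo,
          ← intervalIntegral.integral_of_le zero_le_one, intervalIntegral.integral_const_mul,
          edgeIntegral, intervalIntegral.integral_mul_const, smul_eq_mul,
          ← K.dist_mul_abs_normal l i]
        have := sign_mul_abs (K.normal i l)
        change _ = dist (K.vertex i) (K.next i) *
          ((∫ s in (0 : ℝ)..1, evalAt P (K.edgePoint i s)) * K.normal i l)
        conv_rhs => rw [← this]
        ring

end PolygonalElement

/-! ### Degrees -/

theorem mem_polyLE {r : ℕ} {P : Poly} : P ∈ polyLE r ↔ P.totalDegree ≤ r :=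
  MvPolynomial.mem_restrictTotalDegree ..

theorem polyLE_mono {r s : ℕ} (h : r ≤ s) {P : Poly} (hP : P ∈ polyLE r) : P ∈ polyLE s :=
  mem_polyLE.2 ((mem_polyLE.1 hP).trans h)

theorem mul_mem_polyLE {r s : ℕ} {P Q : Poly} (hP : P ∈ polyLE r) (hQ : Q ∈ polyLE s) :
    P * Q ∈ polyLE (r + s) :=
  mem_polyLE.2 ((MvPolynomial.totalDegree_mul P Q).trans
    (add_le_add (mem_polyLE.1 hP) (mem_polyLE.1 hQ)))

theorem C_mem_polyLE (c : ℝ) (r : ℕ) : MvPolynomial.C c ∈ polyLE r :=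
  mem_polyLE.2 (by rw [MvPolynomial.totalDegree_C]; exact Nat.zero_le _)

theorem X_mem_polyLE (l : Fin 2) : (MvPolynomial.X l : Poly) ∈ polyLE 1 :=
  mem_polyLE.2 (MvPolynomial.totalDegree_X l).le

theorem C_mul_mem_polyLE (c : ℝ) {r : ℕ} {P : Poly} (hP : P ∈ polyLE r) :
    MvPolynomial.C c * P ∈ polyLE r := by
  simpa using mul_mem_polyLE (C_mem_polyLE c 0) hP

theorem mul_C_mem_polyLE (c : ℝ) {r : ℕ} {P : Poly} (hP : P ∈ polyLE r) :
    P * MvPolynomial.C c ∈ polyLE r := by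
  rw [mul_comm]; exact C_mul_mem_polyLE c hP

theorem prod_mem_polyLE {κ : Type*} (s : Finset κ) (P : κ → Poly) {r : ℕ}
    (h : ∀ i ∈ s, P i ∈ polyLE r) : ∏ i ∈ s, P i ∈ polyLE (s.card * r) :=
  mem_polyLE.2 ((MvPolynomial.totalDegree_finsetProd s P).trans
    ((Finset.sum_le_card_nsmul s _ r fun i hi => mem_polyLE.1 (h i hi)).trans_eq
      (smul_eq_mul _ _)))

/-- The truncated `r - 1` is harmless at `r = 0`, because constants have zero derivative. -/
theorem pderiv_mem_polyLE {r : ℕ} {P : Poly} (hP : P ∈ polyLE r) (l : Fin 2) :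
    MvPolynomial.pderiv l P ∈ polyLE (r - 1) := by
  rw [mem_polyLE] at hP ⊢
  refine Finset.sup_le fun m hm => ?_
  rw [MvPolynomial.mem_support_iff, MvPolynomial.coeff_pderiv] at hm
  have h : m + Finsupp.single l 1 ∈ P.support := by
    rw [MvPolynomial.mem_support_iff]
    exact left_ne_zero_of_mul hm
  have h1 := (MvPolynomial.le_totalDegree h).trans hP
  rw [Finsupp.sum_add_index' (fun _ => rfl) (fun _ _ _ => rfl), Finsupp.sum_single_index rfl] at h1
  omega

theorem eq_zero_of_forall_evalAt {P : Poly} (h : ∀ x, evalAt P x = 0) : P = 0 :=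
  eq_zero_of_evalAt_eq_zero isOpen_univ Set.univ_nonempty P fun x _ => h x

theorem continuous_evalAt_mul (P Q : Poly) : Continuous fun x => evalAt P x * evalAt Q x :=
  (continuous_evalAt P).mul (continuous_evalAt Q)

theorem continuous_evalAt_mul_const (P Q : Poly) (c : ℝ) :
    Continuous fun x => evalAt P x * (evalAt Q x * c) :=
  (continuous_evalAt P).mul ((continuous_evalAt Q).mul continuous_const)

namespace PolygonalElement

variable (K : PolygonalElement)

/-! ### Edge integrals and integration by parts. -/

theorem continuous_edgePoint (i : Fin K.N) : Continuous (K.edgePoint i) :=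
  AffineMap.lineMap_continuous

theorem exists_edgePoint {i : Fin K.N} {x : Plane} (hx : x ∈ K.edge i) :
    ∃ s ∈ Set.Icc (0 : ℝ) 1, K.edgePoint i s = x := by
  unfold edge at hx
  rw [segment_eq_image_lineMap] at hx
  exact hx

theorem edgeIntegral_congr (i : Fin K.N) {f g : Plane → ℝ} (h : ∀ x ∈ K.edge i, f x = g x) :
    K.edgeIntegral i f = K.edgeIntegral i g := by
  unfold edgeIntegral
  rw [intervalIntegral.integral_congr fun _ hs => ?_]
  rw [Set.uIcc_of_le zero_le_one] at hs
  exact h _ (K.edgePoint_mem_edge i hs)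

theorem edgeIntegral_zero (i : Fin K.N) : K.edgeIntegral i (fun _ => 0) = 0 := by
  simp [edgeIntegral]

theorem edgeIntegral_eq_zero (i : Fin K.N) {f : Plane → ℝ} (h : ∀ x ∈ K.edge i, f x = 0) :
    K.edgeIntegral i f = 0 :=
  (K.edgeIntegral_congr i h).trans (K.edgeIntegral_zero i)

theorem edgeIntegral_nonneg (i : Fin K.N) {f : Plane → ℝ} (h : ∀ x ∈ K.edge i, 0 ≤ f x) :
    0 ≤ K.edgeIntegral i f :=
  mul_nonneg dist_nonneg (intervalIntegral.integral_nonneg zero_le_one fun _ hs =>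
    h _ (K.edgePoint_mem_edge i hs))

theorem eq_zero_of_edgeIntegral_eq_zero (i : Fin K.N) {f : Plane → ℝ} (hf : Continuous f)
    (h : ∀ x ∈ K.edge i, 0 ≤ f x) (h0 : K.edgeIntegral i f = 0) : ∀ x ∈ K.edge i, f x = 0 := by
  intro x hx
  obtain ⟨s, hs, rfl⟩ := K.exists_edgePoint hx
  by_contra hne
  have hpos := intervalIntegral.integral_pos zero_lt_one
    (f := fun s => f (K.edgePoint i s))
    (hf.comp (K.continuous_edgePoint i)).continuousOn
    (fun t ht => h _ (K.edgePoint_mem_edge i (Set.Ioc_subset_Icc_self ht)))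
    ⟨s, hs, lt_of_le_of_ne (h _ hx) (Ne.symm hne)⟩
  have hd : 0 < dist (K.vertex i) (K.next i) := dist_pos.2 (K.next_ne_vertex i).symm
  exact absurd h0 (mul_pos hd hpos).ne'

theorem eq_zero_of_integral_eq_zero {f : Plane → ℝ} (hf : Continuous f)
    (h : ∀ x ∈ K.carrier, 0 ≤ f x) (h0 : K.integral f = 0) : ∀ x ∈ K.carrier, f x = 0 := by
  have hae : f =ᵐ[volume.restrict K.carrier] 0 :=
    (setIntegral_eq_zero_iff_of_nonneg_ae ((ae_restrict_iff'
      K.isOpen_carrier.measurableSet).2 (Filter.Eventually.of_forall h))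
      (K.integrableOn_of_continuous hf)).1 h0
  exact Measure.eqOn_open_of_ae_eq hae K.isOpen_carrier hf.continuousOn continuousOn_const

theorem integral_nonneg {f : Plane → ℝ} (h : ∀ x, 0 ≤ f x) : 0 ≤ K.integral f :=
  MeasureTheory.integral_nonneg h

theorem integral_finsetSum {κ : Type*} (s : Finset κ) {f : κ → Plane → ℝ}
    (hf : ∀ i ∈ s, Continuous (f i)) :
    K.integral (fun x => ∑ i ∈ s, f i x) = ∑ i ∈ s, K.integral (f i) :=
  MeasureTheory.integral_finsetSum _ fun i hi => K.integrableOn_of_continuous (hf i hi)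

theorem edgeIntegrable_of_continuous (i : Fin K.N) {f : Plane → ℝ} (hf : Continuous f) :
    K.EdgeIntegrable i f :=
  (hf.comp (K.continuous_edgePoint i)).intervalIntegrable _ _

theorem edgeIntegral_finsetSum (i : Fin K.N) {κ : Type*} (s : Finset κ) {f : κ → Plane → ℝ}
    (hf : ∀ j ∈ s, K.EdgeIntegrable i (f j)) :
    K.edgeIntegral i (fun x => ∑ j ∈ s, f j x) = ∑ j ∈ s, K.edgeIntegral i (f j) := by
  unfold edgeIntegral
  rw [intervalIntegral.integral_finsetSum hf, Finset.mul_sum]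

/-- Integration by parts for polynomials on a polygonal element. -/
theorem integral_mul_pderiv (P Q : Poly) (l : Fin 2) :
    K.integral (fun x => evalAt P x * evalAt (MvPolynomial.pderiv l Q) x) =
      (∑ i, K.edgeIntegral i fun x => evalAt P x * (evalAt Q x * K.normal i l)) -
        K.integral (fun x => evalAt (MvPolynomial.pderiv l P) x * evalAt Q x) := by
  have h := K.integral_pderiv (P * Q) l
  have e : evalAt (MvPolynomial.pderiv l (P * Q)) = fun x =>
      evalAt P x * evalAt (MvPolynomial.pderiv l Q) x +
        evalAt (MvPolynomial.pderiv l P) x * evalAt Q x := by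
    funext x
    rw [MvPolynomial.pderiv_mul, evalAt_add, evalAt_mul, evalAt_mul, add_comm]
  rw [e, K.integral_add (K.integrableOn_of_continuous
    (continuous_evalAt_mul _ _)) (K.integrableOn_of_continuous (continuous_evalAt_mul _ _))] at h
  simp only [evalAt_mul, mul_assoc] at h
  linarith

/-- If the discrete weak gradient of `{P, w_b}` vanishes and `w_b = P` on the edges, then the
gradient of `P` vanishes. -/
theorem pderiv_eq_zero_of_isWeakGrad_zero {r : ℕ} {P : Poly} (hP : P ∈ polyLE (r + 1))
    {wb : Fin K.N → Plane → ℝ} (hwb : ∀ i, ∀ x ∈ K.edge i, wb i x = evalAt P x)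
    (h : K.IsWeakGrad r (evalAt P) wb 0) (l : Fin 2) : MvPolynomial.pderiv l P = 0 := by
  -- Testing with the gradient of `P` itself: after integration by parts the boundary terms cancel,
  -- as `w_b = P` on the edges, and the integral of `|∇P|²` is left.
  have hq := h.2 (fun l => MvPolynomial.pderiv l P) fun l => by
    simpa using pderiv_mem_polyLE hP l
  have e1 : ∀ i, K.edgeIntegral i (fun x => wb i x *
      ∑ l, evalAt (MvPolynomial.pderiv l P) x * K.normal i l) =
      ∑ l, K.edgeIntegral i fun x =>
        evalAt P x * (evalAt (MvPolynomial.pderiv l P) x * K.normal i l) := by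
    intro i
    rw [← K.edgeIntegral_finsetSum i]
    · exact K.edgeIntegral_congr i fun x hx => by rw [hwb i x hx, Finset.mul_sum]
    · exact fun l _ => K.edgeIntegrable_of_continuous i (continuous_evalAt_mul_const _ _ _)
  have e2 : K.integral (fun x => evalAt P x *
      ∑ l, evalAt (MvPolynomial.pderiv l (MvPolynomial.pderiv l P)) x) =
      ∑ l, ((∑ i, K.edgeIntegral i fun x =>
        evalAt P x * (evalAt (MvPolynomial.pderiv l P) x * K.normal i l)) - K.integral fun x =>
          evalAt (MvPolynomial.pderiv l P) x * evalAt (MvPolynomial.pderiv l P) x) := by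
    simp only [Finset.mul_sum]
    rw [K.integral_finsetSum _ fun l _ => continuous_evalAt_mul _ _]
    exact Finset.sum_congr rfl fun l _ => K.integral_mul_pderiv _ _ _
  simp only [e1, e2, Pi.zero_apply, evalAt_zero, zero_mul, Finset.sum_const_zero,
    Finset.sum_sub_distrib] at hq
  rw [Finset.sum_comm] at hq
  have hz : K.integral (fun _ => 0) = 0 := MeasureTheory.integral_zero ..
  rw [hz] at hq
  have h0 : K.integral (fun x => ∑ l, evalAt (MvPolynomial.pderiv l P) x *
      evalAt (MvPolynomial.pderiv l P) x) = 0 := by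
    rw [K.integral_finsetSum _ fun l _ => continuous_evalAt_mul _ _]
    linarith
  have hc : Continuous fun x => ∑ l, evalAt (MvPolynomial.pderiv l P) x *
      evalAt (MvPolynomial.pderiv l P) x :=
    continuous_finsetSum _ fun l _ => continuous_evalAt_mul _ _
  have h1 := K.eq_zero_of_integral_eq_zero hc
    (fun x _ => Finset.sum_nonneg fun l _ => mul_self_nonneg _) h0
  refine eq_zero_of_evalAt_eq_zero K.isOpen_carrier K.isConnected_carrier.nonempty _ fun x hx => ?_
  exact mul_self_eq_zero.1 ((Finset.sum_eq_zero_iff_of_nonneg fun c _ =>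
    mul_self_nonneg (evalAt (MvPolynomial.pderiv c P) x)).1 (h1 x hx) l (Finset.mem_univ l))

/-- If the discrete weak symmetric gradient of `{θ, η_b}` vanishes, the strain of `θ` and the jump
`η_b - θ` on the edges are balanced for each symmetric polynomial tensor. -/
theorem strain_add_jump_eq_zero {r : ℕ} (θ : Fin 2 → Poly) {ηb : Fin K.N → Fin 2 → Plane → ℝ}
    (hb : ∀ i l, K.EdgeIntegrable i (ηb i l))
    (h : K.IsWeakSymGrad r (fun l => evalAt (θ l)) ηb 0)
    {τ : Matrix (Fin 2) (Fin 2) Poly} (hs : τ.IsSymm) (hτ : ∀ l m, τ l m ∈ polyLE r) :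
    K.integral (fun x => ∑ l, ∑ m, evalAt (MvPolynomial.pderiv m (θ l)) x * evalAt (τ l m) x) +
      ∑ i, K.edgeIntegral i (fun x => ∑ l, (ηb i l x - evalAt (θ l) x) *
        ∑ m, evalAt (τ l m) x * K.normal i m) = 0 := by
  -- With zero left-hand side this reads `(θ, ∇·τ) = ⟨η_b, τ n⟩`. Integrating by parts on the left
  -- produces the gradient of `θ` and moves its trace into the jump.
  have hq := h.2 τ hs hτ
  have hz : K.integral (fun _ => 0) = 0 := MeasureTheory.integral_zero ..
  simp only [Matrix.zero_apply, evalAt_zero, zero_mul, Finset.sum_const_zero, hz] at hq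
  have hc : ∀ l m, Continuous fun x => evalAt (MvPolynomial.pderiv m (θ l)) x * evalAt (τ l m) x :=
    fun l m => continuous_evalAt_mul _ _
  have hc' : ∀ l m, Continuous fun x => evalAt (θ l) x *
      evalAt (MvPolynomial.pderiv m (τ l m)) x :=
    fun l m => continuous_evalAt_mul _ _
  have hn : ∀ i l, Continuous fun x => ∑ m, evalAt (τ l m) x * K.normal i m := fun i l =>
    continuous_finsetSum _ fun m _ => (continuous_evalAt _).mul continuous_const
  have e1 : K.integral (fun x => ∑ l, ∑ m, evalAt (MvPolynomial.pderiv m (θ l)) x *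
      evalAt (τ l m) x) = ∑ l, ∑ m, K.integral fun x =>
        evalAt (MvPolynomial.pderiv m (θ l)) x * evalAt (τ l m) x := by
    rw [K.integral_finsetSum _ fun l _ => continuous_finsetSum _ fun m _ => hc l m]
    exact Finset.sum_congr rfl fun l _ => K.integral_finsetSum _ fun m _ => hc l m
  have e2 : K.integral (fun x => ∑ l, evalAt (θ l) x *
      ∑ m, evalAt (MvPolynomial.pderiv m (τ l m)) x) = ∑ l, ∑ m, K.integral fun x =>
        evalAt (θ l) x * evalAt (MvPolynomial.pderiv m (τ l m)) x := by
    simp only [Finset.mul_sum]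
    rw [K.integral_finsetSum _ fun l _ => continuous_finsetSum _ fun m _ => hc' l m]
    exact Finset.sum_congr rfl fun l _ => K.integral_finsetSum _ fun m _ => hc' l m
  have e3 : ∀ i, K.edgeIntegral i (fun x => ∑ l, (ηb i l x - evalAt (θ l) x) *
      ∑ m, evalAt (τ l m) x * K.normal i m) =
      K.edgeIntegral i (fun x => ∑ l, ηb i l x * ∑ m, evalAt (τ l m) x * K.normal i m) -
        ∑ l, ∑ m, K.edgeIntegral i
          (fun x => evalAt (θ l) x * (evalAt (τ l m) x * K.normal i m)) := by
    intro i
    have hθ : ∀ l, K.EdgeIntegrable i fun x => evalAt (θ l) x *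
        ∑ m, evalAt (τ l m) x * K.normal i m := fun l =>
      K.edgeIntegrable_of_continuous i ((continuous_evalAt _).mul (hn i l))
    have hη : ∀ l, K.EdgeIntegrable i fun x => ηb i l x *
        ∑ m, evalAt (τ l m) x * K.normal i m := fun l => (hb i l).mul_continuous (hn i l)
    have hd : ∀ l, K.EdgeIntegrable i fun x => (ηb i l x - evalAt (θ l) x) *
        ∑ m, evalAt (τ l m) x * K.normal i m := fun l => by
      simp only [sub_mul]
      exact IntervalIntegrable.sub (hη l) (hθ l)
    have e4 : ∀ l, K.edgeIntegral i (fun x => (ηb i l x - evalAt (θ l) x) *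
        ∑ m, evalAt (τ l m) x * K.normal i m) =
        K.edgeIntegral i (fun x => ηb i l x * ∑ m, evalAt (τ l m) x * K.normal i m) -
        ∑ m, K.edgeIntegral i (fun x => evalAt (θ l) x * (evalAt (τ l m) x * K.normal i m)) := by
      intro l
      rw [← K.edgeIntegral_finsetSum i _ fun m _ => K.edgeIntegrable_of_continuous i
        (continuous_evalAt_mul_const _ _ _)]
      simp only [← Finset.mul_sum]
      have := K.edgeIntegral_add i (hd l) (hθ l)
      simp only [sub_mul, sub_add_cancel] at this
      simp only [sub_mul, this, add_sub_cancel_right]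
    rw [K.edgeIntegral_finsetSum i _ fun l _ => hd l,
      K.edgeIntegral_finsetSum i _ fun l _ => hη l, ← Finset.sum_sub_distrib]
    exact Finset.sum_congr rfl fun l _ => e4 l
  rw [e2] at hq
  simp only [e1, e3, K.integral_mul_pderiv, Finset.sum_sub_distrib] at hq ⊢
  have e5 : ∑ i, ∑ l, ∑ m, K.edgeIntegral i
        (fun x => evalAt (θ l) x * (evalAt (τ l m) x * K.normal i m)) =
      ∑ l, ∑ m, ∑ i, K.edgeIntegral i
        (fun x => evalAt (θ l) x * (evalAt (τ l m) x * K.normal i m)) := by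
    rw [Finset.sum_comm]
    exact Finset.sum_congr rfl fun l _ => Finset.sum_comm
  rw [e5]
  linarith

end PolygonalElement

namespace PolygonalElement

variable (K : PolygonalElement)

/-! ### Bubble functions -/

/-- The affine function `x ↦ n_i · (v_i - x)`, zero on the `i`-th edge. -/
def lineFun (i : Fin K.N) : Poly :=
  ∑ l, MvPolynomial.C (K.normal i l) * (MvPolynomial.C (K.vertex i l) - MvPolynomial.X l)

theorem evalAt_lineFun (i : Fin K.N) (x : Plane) :
    evalAt (K.lineFun i) x = inner ℝ (K.normal i) (K.vertex i - x) := by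
  simp [lineFun, PiLp.inner_apply, mul_comm]

theorem lineFun_mem (i : Fin K.N) : K.lineFun i ∈ polyLE 1 :=
  Submodule.sum_mem _ fun l _ => C_mul_mem_polyLE _
    (Submodule.sub_mem _ (C_mem_polyLE _ _) (X_mem_polyLE l))

theorem vertex_mem_edge (i : Fin K.N) : K.vertex i ∈ K.edge i := left_mem_segment ..

theorem next_mem_edge (i : Fin K.N) : K.next i ∈ K.edge i := right_mem_segment ..

theorem evalAt_lineFun_of_mem_edge {i : Fin K.N} {x : Plane} (hx : x ∈ K.edge i) :
    evalAt (K.lineFun i) x = 0 := by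
  rw [evalAt_lineFun]
  exact K.inner_normal_eq_zero i (K.vertex_mem_edge i) hx

theorem lineFun_ne_zero (i : Fin K.N) : K.lineFun i ≠ 0 := fun h => by
  have h1 := K.evalAt_lineFun i (K.vertex i - K.normal i)
  rw [h, evalAt_zero, sub_sub_cancel, real_inner_self_eq_norm_sq, K.norm_normal] at h1
  norm_num at h1

/-- The exponent of the affine functions in the bubble functions. -/
def expo : ℕ := open Classical in if Convex ℝ K.carrier then 1 else 2

theorem one_le_expo : 1 ≤ K.expo := by
  unfold expo; split_ifs <;> norm_num

/-- This is exactly the degree of a product of all `N` weights, each of degree `expo`, with a strain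
of degree `k - 1`. -/
theorem gradDegree_eq (k : ℕ) : K.gradDegree k = K.N * K.expo + k - 1 := by
  unfold gradDegree expo; split_ifs <;> ring_nf

/-- The factor of the bubble functions that vanishes on the `i`-th edge. -/
def weight (i : Fin K.N) : Poly := K.lineFun i ^ K.expo

theorem weight_mem (i : Fin K.N) : K.weight i ∈ polyLE K.expo := by
  have h := prod_mem_polyLE (Finset.range K.expo) (fun _ => K.lineFun i) fun _ _ => K.lineFun_mem i
  simpa [weight] using h

theorem weight_ne_zero (i : Fin K.N) : K.weight i ≠ 0 := pow_ne_zero _ (K.lineFun_ne_zero i)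

theorem evalAt_weight_of_mem_edge {i : Fin K.N} {x : Plane} (hx : x ∈ K.edge i) :
    evalAt (K.weight i) x = 0 := by
  rw [weight, evalAt_pow, K.evalAt_lineFun_of_mem_edge hx,
    zero_pow (by have := K.one_le_expo; omega)]

theorem exists_mem_openSegment (i : Fin K.N) :
    ∃ x, x ∈ openSegment ℝ (K.vertex i) (K.next i) :=
  ⟨_, K.edgePoint_mem_openSegment i (s := 1 / 2) ⟨by norm_num, by norm_num⟩⟩

/-- A convex element lies on the inner side of each of its edges. -/
theorem lineFun_pos_of_convex (hK : Convex ℝ K.carrier) (i : Fin K.N) {z : Plane}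
    (hz : z ∈ K.carrier) : 0 < evalAt (K.lineFun i) z := by
  obtain ⟨y, hy⟩ := K.exists_mem_openSegment i
  have hyf := K.edge_subset_frontier i (K.openSegment_subset_edge i hy)
  have hyK : y ∉ K.carrier := fun h => by
    rw [K.isOpen_carrier.frontier_eq] at hyf; exact hyf.2 h
  -- A supporting functional at an interior point `y` of the edge. It turns out to be a positive
  -- multiple of the inner product with the outward normal.
  obtain ⟨f, hf⟩ := geometric_hahn_banach_open_point hK K.isOpen_carrier hyK
  have hcl : ∀ x ∈ closure K.carrier, f x ≤ f y :=
    closure_minimal (fun x hx => (hf x hx).le) (isClosed_le f.continuous continuous_const)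
  have hfe : ∀ x ∈ K.edge i, f x ≤ f y := fun x hx =>
    hcl x (frontier_subset_closure (K.edge_subset_frontier i hx))
  -- On the edge `f` is affine with its maximum at an interior point, hence constant.
  have hvn : f (K.next i - K.vertex i) = 0 := by
    obtain ⟨a, b, ha, hb, hab, rfl⟩ := hy
    have h1 := hfe _ (K.vertex_mem_edge i)
    have h2 := hfe _ (K.next_mem_edge i)
    simp only [map_add, map_smul, map_sub, smul_eq_mul] at h1 h2 ⊢
    have hb' : b = 1 - a := by linarith
    subst hb'
    have h3 : f (K.vertex i) ≤ f (K.next i) := by nlinarith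
    have h4 : f (K.next i) ≤ f (K.vertex i) := by nlinarith
    linarith
  obtain ⟨s, ⟨hs, -⟩, hs0⟩ := ((K.normal_outward i y hy).and self_mem_nhdsWithin).exists
  -- The point `y - s n` is in the element, so `f` is smaller there than at `y`.
  have hfn : 0 < f (K.normal i) := by
    have := hf _ hs
    rw [map_sub, map_smul, smul_eq_mul] at this
    have hs0' : 0 < s := hs0
    by_contra hle
    nlinarith [not_lt.1 hle]
  set e := K.next i - K.vertex i with he
  have he0 : e ≠ 0 := sub_ne_zero.2 (K.next_ne_vertex i)
  have hdec : ∃ c : ℝ, z - y = (inner ℝ (K.normal i) (z - y)) • K.normal i + c • e := by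
    have hn := K.normal_sq 0 i
    have ho := K.normal_coord 0 i
    have hd : (0 : ℝ) < e 0 ^ 2 + e 1 ^ 2 := by
      have := norm_pos_iff.2 he0
      have h2 := EuclideanSpace.norm_sq_eq e
      simp only [Fin.sum_univ_two, Real.norm_eq_abs, sq_abs] at h2
      rw [← h2]; positivity
    refine ⟨(inner ℝ e (z - y)) / (e 0 ^ 2 + e 1 ^ 2), ?_⟩
    simp only [show (0 : Fin 2).rev = 1 from rfl] at hn ho
    change K.normal i 0 * e 0 + K.normal i 1 * e 1 = 0 at ho
    ext l
    simp only [PiLp.inner_apply, Fin.sum_univ_two, PiLp.add_apply, PiLp.smul_apply, smul_eq_mul,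
      RCLike.inner_apply, conj_trivial]
    set u := (z - y) 0
    set v := (z - y) 1
    set p := K.normal i 0
    set q := K.normal i 1
    set a := e 0
    set b := e 1
    -- These three identities are the entries of `n nᵀ + e eᵀ / |e|² = 1`, the decomposition along
    -- the orthogonal vectors `n` and `e`.
    have h1 : q * q * (a ^ 2 + b ^ 2) = a * a := by
      linear_combination (q * b - p * a) * ho + a ^ 2 * hn
    have h2 : p * p * (a ^ 2 + b ^ 2) = b * b := by
      linear_combination (p * a - q * b) * ho + b ^ 2 * hn
    have h3 : p * q * (a ^ 2 + b ^ 2) = -(a * b) := by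
      linear_combination (q * a + p * b) * ho - a * b * hn
    have hl : l = 0 ∨ l = 1 := by fin_cases l <;> simp
    rcases hl with rfl | rfl
    · change u = (u * p + v * q) * p + (u * a + v * b) / (a ^ 2 + b ^ 2) * a
      field_simp
      linear_combination -u * h2 - v * h3
    · change v = (u * p + v * q) * q + (u * a + v * b) / (a ^ 2 + b ^ 2) * b
      field_simp
      linear_combination -u * h3 - v * h1
  obtain ⟨c, hc⟩ := hdec
  have h1 : f (z - y) < 0 := by rw [map_sub]; linarith [hf z hz]
  rw [hc, map_add, map_smul, map_smul, hvn, smul_zero, add_zero, smul_eq_mul] at h1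
  have h2 : inner ℝ (K.normal i) (z - y) < 0 := by
    by_contra hle
    nlinarith [not_lt.1 hle]
  have h3 := K.inner_normal_eq_zero i (K.vertex_mem_edge i) (K.openSegment_subset_edge i hy)
  rw [evalAt_lineFun, ← sub_add_sub_cancel _ y z, inner_add_right, h3, zero_add,
    ← neg_sub, inner_neg_right]
  linarith

/-- On a convex element the affine function has a sign. Otherwise the element may lie on both sides
of the line, and the square is needed; this is why `expo` is `2` there. -/
theorem weight_nonneg (i : Fin K.N) {x : Plane} (hx : x ∈ closure K.carrier) :
    0 ≤ evalAt (K.weight i) x := by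
  rw [weight, evalAt_pow]
  by_cases hK : Convex ℝ K.carrier
  · refine pow_nonneg ?_ _
    exact closure_minimal (fun z hz => (K.lineFun_pos_of_convex hK i hz).le)
      (isClosed_le continuous_const (continuous_evalAt _)) hx
  · rw [expo, if_neg hK]
    positivity

/-- The strain component `(∂_m θ_l + ∂_l θ_m) / 2`. -/
def _root_.WG.strain (θ : Fin 2 → Poly) : Matrix (Fin 2) (Fin 2) Poly :=
  Matrix.of fun l m => MvPolynomial.C (1 / 2) *
    (MvPolynomial.pderiv m (θ l) + MvPolynomial.pderiv l (θ m))

/-- If the discrete weak symmetric gradient of `{θ, η_b}` vanishes, so does the strain of `θ`. -/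
theorem strain_eq_zero {k : ℕ} (hk : 1 ≤ k) {θ : Fin 2 → Poly} (hθ : ∀ l, θ l ∈ polyLE k)
    {ηb : Fin K.N → Fin 2 → Plane → ℝ} (hb : ∀ i l, K.EdgeIntegrable i (ηb i l))
    (h : K.IsWeakSymGrad (K.gradDegree k) (fun l => evalAt (θ l)) ηb 0) : strain θ = 0 := by
  -- Vanishing on all edges, `B` removes the unknown jumps from the balance.
  set B : Poly := ∏ i, K.weight i with hB
  have hBdeg : B ∈ polyLE (K.N * K.expo) := by
    simpa using prod_mem_polyLE Finset.univ K.weight fun i _ => K.weight_mem i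
  have hB0 : B ≠ 0 := Finset.prod_ne_zero_iff.2 fun i _ => K.weight_ne_zero i
  have hBe : ∀ i, ∀ x ∈ K.edge i, evalAt B x = 0 := fun i x hx => by
    rw [hB, evalAt_prod]
    exact Finset.prod_eq_zero (Finset.mem_univ i) (K.evalAt_weight_of_mem_edge hx)
  have hεsymm : ∀ l m, strain θ l m = strain θ m l := fun l m => by
    simp only [strain, Matrix.of_apply, add_comm]
  have hdeg : ∀ l m, B * strain θ l m ∈ polyLE (K.gradDegree k) := fun l m => by
    rw [K.gradDegree_eq]
    -- Here `1 ≤ k` makes `N * expo + (k - 1)` equal to `N * expo + k - 1`.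
    refine polyLE_mono (r := K.N * K.expo + (k - 1)) (by omega) (mul_mem_polyLE hBdeg ?_)
    exact C_mul_mem_polyLE _ (Submodule.add_mem _ (pderiv_mem_polyLE (hθ l) m)
      (pderiv_mem_polyLE (hθ m) l))
  have key := K.strain_add_jump_eq_zero θ hb h (τ := Matrix.of fun l m => B * strain θ l m)
    (by ext1 l m; simp [hεsymm l m]) hdeg
  have hedge : ∀ i, K.edgeIntegral i (fun x => ∑ l, (ηb i l x - evalAt (θ l) x) *
      ∑ m, evalAt ((Matrix.of fun l m => B * strain θ l m) l m) x * K.normal i m) = 0 := fun i =>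
    K.edgeIntegral_eq_zero i fun x hx => by simp [hBe i x hx]
  rw [Finset.sum_eq_zero fun i _ => hedge i, add_zero] at key
  -- A symmetric tensor sees only the symmetric part of the gradient, so the integrand is `B` times
  -- the squared norm of the strain.
  have hpt : ∀ x, (∑ l, ∑ m, evalAt (MvPolynomial.pderiv m (θ l)) x *
      evalAt ((Matrix.of fun l m => B * strain θ l m) l m) x) =
      evalAt (B * ∑ l, ∑ m, strain θ l m * strain θ l m) x := fun x => by
    simp [strain, Fin.sum_univ_two]
    ring
  simp only [hpt] at key
  have hnn : ∀ x, 0 ≤ evalAt (∑ l, ∑ m, strain θ l m * strain θ l m) x := fun x => by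
    simp only [evalAt_sum, evalAt_mul]
    exact Finset.sum_nonneg fun l _ => Finset.sum_nonneg fun m _ => mul_self_nonneg _
  have h0 := K.eq_zero_of_integral_eq_zero (continuous_evalAt _) (fun x hx => by
    rw [evalAt_mul]
    refine mul_nonneg ?_ (hnn x)
    rw [hB, evalAt_prod]
    exact Finset.prod_nonneg fun i _ => K.weight_nonneg i (subset_closure hx)) key
  have h1 := eq_zero_of_evalAt_eq_zero K.isOpen_carrier K.isConnected_carrier.nonempty _ h0
  -- Polynomials form an integral domain, so the zeros of `B` inside the element do not matter.
  have h2 := (mul_eq_zero.1 h1).resolve_left hB0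
  ext1 l m
  refine eq_zero_of_forall_evalAt fun x => ?_
  have h3 : evalAt (∑ l, ∑ m, strain θ l m * strain θ l m) x = 0 := by rw [h2, evalAt_zero]
  simp only [evalAt_sum, evalAt_mul] at h3
  have h4 := (Finset.sum_eq_zero_iff_of_nonneg fun l _ => Finset.sum_nonneg fun m _ =>
    mul_self_nonneg (evalAt (strain θ l m) x)).1 h3 l (Finset.mem_univ _)
  exact mul_self_eq_zero.1 ((Finset.sum_eq_zero_iff_of_nonneg fun m _ =>
    mul_self_nonneg (evalAt (strain θ l m) x)).1 h4 m (Finset.mem_univ _))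

end PolygonalElement

/-- Two unit vectors orthogonal to a nonzero vector of the plane agree up to sign. -/
theorem eq_or_eq_neg_of_inner_eq_zero {n m e : Plane} (hn : ‖n‖ = 1) (hm : ‖m‖ = 1) (he : e ≠ 0)
    (hne : inner ℝ n e = 0) (hme : inner ℝ m e = 0) : m = n ∨ m = -n := by
  have hn2 := EuclideanSpace.norm_sq_eq n
  have hm2 := EuclideanSpace.norm_sq_eq m
  simp only [hn, hm, Fin.sum_univ_two, Real.norm_eq_abs, sq_abs, one_pow] at hn2 hm2
  simp only [PiLp.inner_apply, Fin.sum_univ_two, RCLike.inner_apply, conj_trivial] at hne hme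
  have hd : e 0 ≠ 0 ∨ e 1 ≠ 0 := by
    by_contra! hc
    exact he (ext_coord (l := 0) hc.1 hc.2)
  -- Both vectors are orthogonal to `e`, hence parallel. Lagrange's identity then gives `n · m =
  -- ±1`.
  have hcross : n 0 * m 1 - n 1 * m 0 = 0 := by
    rcases hd with hd | hd
    · refine (mul_eq_zero.1 (?_ : e 0 * (n 0 * m 1 - n 1 * m 0) = 0)).resolve_left hd
      linear_combination m 1 * hne - n 1 * hme
    · refine (mul_eq_zero.1 (?_ : e 1 * (n 0 * m 1 - n 1 * m 0) = 0)).resolve_left hd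
      linear_combination -m 0 * hne + n 0 * hme
  have hc : (n 0 * m 0 + n 1 * m 1 - 1) * (n 0 * m 0 + n 1 * m 1 + 1) = 0 := by
    linear_combination -(m 0 ^ 2 + m 1 ^ 2) * hn2 - hm2 - (n 0 * m 1 - n 1 * m 0) * hcross
  rcases mul_eq_zero.1 hc with hc | hc
  · left
    refine ext_coord (l := 0) ?_ ?_
    · linear_combination m 0 * hn2 + n 0 * hc - n 1 * hcross
    · change m 1 = n 1
      linear_combination m 1 * hn2 + n 1 * hc + n 0 * hcross
  · right
    refine ext_coord (l := 0) ?_ ?_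
    · change m 0 = -n 0
      linear_combination m 0 * hn2 + n 0 * hc - n 1 * hcross
    · change m 1 = -n 1
      linear_combination m 1 * hn2 + n 1 * hc + n 0 * hcross

namespace PolygonalElement

variable (K : PolygonalElement)

/-! ### Restriction to an edge -/

/-- The restriction of a polynomial to the line through the `i`-th edge. -/
def restrictEdge (i : Fin K.N) : Poly →ₐ[ℝ] Polynomial ℝ :=
  MvPolynomial.aeval fun l =>
    Polynomial.C (K.vertex i l) + Polynomial.X * Polynomial.C (K.next i l - K.vertex i l)

theorem eval_restrictEdge (i : Fin K.N) (P : Poly) (s : ℝ) :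
    (K.restrictEdge i P).eval s = evalAt P (K.edgePoint i s) := by
  induction P using MvPolynomial.induction_on with
  | C c => simp [restrictEdge, evalAt]
  | add p q hp hq => rw [map_add, Polynomial.eval_add, hp, hq, evalAt_add]
  | mul_X p l hp =>
    rw [map_mul, Polynomial.eval_mul, hp, evalAt_mul, evalAt_X, edgePoint, lineMap_coord]
    simp [restrictEdge, -finRotate_apply]

/-- A polynomial in one variable that vanishes on `[0, 1]` is zero. Working in this integral domain
allows nonzero factors to be cancelled on an edge. -/
theorem restrictEdge_eq_zero_iff (i : Fin K.N) (P : Poly) :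
    K.restrictEdge i P = 0 ↔ ∀ x ∈ K.edge i, evalAt P x = 0 := by
  constructor
  · intro h x hx
    obtain ⟨s, -, rfl⟩ := K.exists_edgePoint hx
    rw [← eval_restrictEdge, h, Polynomial.eval_zero]
  · intro h
    refine Polynomial.eq_zero_of_infinite_isRoot _
      ((Set.Icc_infinite (zero_lt_one (α := ℝ))).mono fun s hs => ?_)
    have := h _ (K.edgePoint_mem_edge i hs)
    rwa [← eval_restrictEdge] at this

/-- The `b`-th edge lies on the line through the `a`-th edge. -/
def SameLine (a b : Fin K.N) : Prop := ∀ x ∈ K.edge a, inner ℝ (K.normal b) (x - K.vertex b) = 0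

theorem sameLine_self (a : Fin K.N) : K.SameLine a a := fun _ hx =>
  K.inner_normal_eq_zero a hx (K.vertex_mem_edge a)

/-- Points on the line through an edge, in terms of the parameter on the edge. -/
theorem exists_edgePoint_of_inner_eq_zero {b : Fin K.N} {x : Plane}
    (hx : inner ℝ (K.normal b) (x - K.vertex b) = 0) : ∃ s, x = K.edgePoint b s := by
  have hd := K.dist_sq 0 b
  have hn := K.normal_sq 0 b
  have ho := K.normal_coord 0 b
  rw [PiLp.inner_apply, sum_coord 0] at hx
  have hd0 : 0 < dist (K.vertex b) (K.next b) := dist_pos.2 (K.next_ne_vertex b).symm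
  have hd1 : (K.next b 0 - K.vertex b 0) ^ 2 + (K.next b 1 - K.vertex b 1) ^ 2 ≠ 0 := by
    have := pow_pos hd0 2
    rw [hd] at this
    exact this.ne'
  simp only [show (0 : Fin 2).rev = 1 from rfl, RCLike.inner_apply, conj_trivial,
    PiLp.sub_apply] at hn ho hx
  -- The parameter is the coefficient of the orthogonal projection onto the edge vector.
  refine ⟨((x 0 - K.vertex b 0) * (K.next b 0 - K.vertex b 0) +
    (x 1 - K.vertex b 1) * (K.next b 1 - K.vertex b 1)) /
    ((K.next b 0 - K.vertex b 0) ^ 2 + (K.next b 1 - K.vertex b 1) ^ 2), ?_⟩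
  have hcross : (x 0 - K.vertex b 0) * (K.next b 1 - K.vertex b 1) =
      (x 1 - K.vertex b 1) * (K.next b 0 - K.vertex b 0) := by
    set u := x 0 - K.vertex b 0
    set v := x 1 - K.vertex b 1
    set p := K.normal b 0
    set q := K.normal b 1
    set a := K.next b 0 - K.vertex b 0
    set c := K.next b 1 - K.vertex b 1
    linear_combination (v * a - u * c) * hn + (q * u - p * v) * ho + (p * c - q * a) * hx
  ext l
  rw [edgePoint, lineMap_coord]
  have hl : l = 0 ∨ l = 1 := by fin_cases l <;> simp
  rcases hl with rfl | rfl
  · field_simp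
    linear_combination (K.next b 1 - K.vertex b 1) * hcross
  · field_simp
    linear_combination -(K.next b 0 - K.vertex b 0) * hcross

/-- The link to the hypothesis on the partition, which is stated in terms of collinearity. -/
theorem SameLine.collinear {K : PolygonalElement} {a b : Fin K.N} (h : K.SameLine a b) :
    Collinear ℝ (K.edge a ∪ K.edge b) := by
  rw [collinear_iff_of_mem (p₀ := K.vertex b) (Or.inr (K.vertex_mem_edge b))]
  refine ⟨K.next b - K.vertex b, fun x hx => ?_⟩
  have hx0 : inner ℝ (K.normal b) (x - K.vertex b) = 0 := by
    rcases hx with hx | hx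
    · exact h x hx
    · exact K.sameLine_self b x hx
  obtain ⟨s, rfl⟩ := K.exists_edgePoint_of_inner_eq_zero hx0
  exact ⟨s, by rw [edgePoint, AffineMap.lineMap_apply]; rfl⟩

theorem restrictEdge_lineFun_ne_zero {a b : Fin K.N} (h : ¬ K.SameLine a b) :
    K.restrictEdge a (K.lineFun b) ≠ 0 := fun h0 => h fun x hx => by
  have := (K.restrictEdge_eq_zero_iff a _).1 h0 x hx
  rw [evalAt_lineFun, ← neg_sub, inner_neg_right] at this
  linarith

theorem SameLine.normal_eq {K : PolygonalElement} {a b : Fin K.N} (h : K.SameLine a b) :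
    K.normal b = K.normal a ∨ K.normal b = -K.normal a := by
  refine eq_or_eq_neg_of_inner_eq_zero (K.norm_normal a) (K.norm_normal b)
    (sub_ne_zero.2 (K.next_ne_vertex a)) (K.normal_orthogonal a) ?_
  rw [← sub_sub_sub_cancel_right _ _ (K.vertex b), inner_sub_right, h _ (K.next_mem_edge a),
    h _ (K.vertex_mem_edge a), sub_zero]

/-- With opposite normals, a point of the element would lie strictly on both sides of the line. -/
theorem normal_eq_of_convex (hK : Convex ℝ K.carrier) {a b : Fin K.N} (h : K.SameLine a b) :
    K.normal b = K.normal a := by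
  refine h.normal_eq.resolve_right fun hneg => ?_
  obtain ⟨z, hz⟩ := K.isConnected_carrier.nonempty
  have h1 := K.lineFun_pos_of_convex hK a hz
  have h2 := K.lineFun_pos_of_convex hK b hz
  have h3 := h _ (K.vertex_mem_edge a)
  rw [evalAt_lineFun] at h1 h2
  rw [← sub_add_sub_cancel _ (K.vertex a), inner_add_right, ← neg_sub (K.vertex a),
    inner_neg_right, h3, hneg, inner_neg_left] at h2
  linarith

/-- The quadratic function `x ↦ (x - v_b) · (x - v_b')`, negative between the end points of the
`b`-th edge and positive elsewhere on the line through it. -/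
def quadFun (b : Fin K.N) : Poly :=
  ∑ l, (MvPolynomial.X l - MvPolynomial.C (K.vertex b l)) *
    (MvPolynomial.X l - MvPolynomial.C (K.next b l))

theorem quadFun_mem (b : Fin K.N) : K.quadFun b ∈ polyLE 2 :=
  Submodule.sum_mem _ fun l _ => mul_mem_polyLE (r := 1) (s := 1)
    (Submodule.sub_mem _ (X_mem_polyLE l) (C_mem_polyLE _ _))
    (Submodule.sub_mem _ (X_mem_polyLE l) (C_mem_polyLE _ _))

theorem evalAt_quadFun_edgePoint (b : Fin K.N) (s : ℝ) :
    evalAt (K.quadFun b) (K.edgePoint b s) =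
      s * (s - 1) * dist (K.vertex b) (K.next b) ^ 2 := by
  rw [K.dist_sq 0 b]
  simp only [quadFun, evalAt_add, evalAt_mul, evalAt_sub, evalAt_X, evalAt_C, Fin.sum_univ_two,
    edgePoint, lineMap_coord, show (0 : Fin 2).rev = 1 from rfl]
  ring

theorem quadFun_nonpos {b : Fin K.N} {x : Plane} (hx : x ∈ K.edge b) :
    evalAt (K.quadFun b) x ≤ 0 := by
  obtain ⟨s, hs, rfl⟩ := K.exists_edgePoint hx
  rw [evalAt_quadFun_edgePoint]
  exact mul_nonpos_of_nonpos_of_nonneg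
    (mul_nonpos_of_nonneg_of_nonpos hs.1 (by linarith [hs.2])) (sq_nonneg _)

/-- A point of another edge is not interior to the `b`-th edge, so its parameter on the line is at
most `0` or at least `1`. -/
theorem quadFun_nonneg {b c : Fin K.N} (hbc : b ≠ c) {x : Plane} (hx : x ∈ K.edge c)
    (hline : inner ℝ (K.normal b) (x - K.vertex b) = 0) : 0 ≤ evalAt (K.quadFun b) x := by
  obtain ⟨s, rfl⟩ := K.exists_edgePoint_of_inner_eq_zero hline
  by_contra hneg
  rw [evalAt_quadFun_edgePoint, not_le] at hneg
  have h1 : s * (s - 1) < 0 := by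
    by_contra h
    exact absurd hneg (not_lt.2 (mul_nonneg (not_lt.1 h) (sq_nonneg _)))
  have hs : s ∈ Set.Ioo (0 : ℝ) 1 := by
    constructor <;> nlinarith
  exact K.not_mem_edge_of_ne hbc (K.edgePoint_mem_openSegment b hs) hx

/-- On the line the roots are the end points of the `b`-th edge, and an interior point of another
edge is neither of them. -/
theorem restrictEdge_quadFun_ne_zero {a b : Fin K.N} (hab : a ≠ b) (h : K.SameLine a b) :
    K.restrictEdge a (K.quadFun b) ≠ 0 := fun h0 => by
  obtain ⟨x, hx⟩ := K.exists_mem_openSegment a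
  have hxa := K.openSegment_subset_edge a hx
  have hq := (K.restrictEdge_eq_zero_iff a _).1 h0 x hxa
  obtain ⟨s, rfl⟩ := K.exists_edgePoint_of_inner_eq_zero (h x hxa)
  rw [evalAt_quadFun_edgePoint] at hq
  have hd : dist (K.vertex b) (K.next b) ^ 2 ≠ 0 :=
    pow_ne_zero _ (dist_pos.2 (K.next_ne_vertex b).symm).ne'
  have hs := (mul_eq_zero.1 hq).resolve_right hd
  refine K.not_mem_edge_of_ne hab hx (K.edgePoint_mem_edge b ?_)
  rcases mul_eq_zero.1 hs with hs | hs
  · rw [hs]; norm_num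
  · rw [sub_eq_zero.1 hs]; norm_num

/-- Edges on the line of the `a`-th edge are on the line of each other, because their normals agree
up to sign. -/
theorem SameLine.inner_eq_zero {K : PolygonalElement} {a b c : Fin K.N} (hb : K.SameLine a b)
    (hc : K.SameLine a c) {x : Plane} (hx : x ∈ K.edge c) :
    inner ℝ (K.normal b) (x - K.vertex b) = 0 := by
  have h1 := hb _ (K.vertex_mem_edge a)
  have h2 := hc _ (K.vertex_mem_edge a)
  have h3 : inner ℝ (K.normal c) (x - K.vertex a) = 0 := by
    rw [← sub_sub_sub_cancel_right x _ (K.vertex c), inner_sub_right, h2,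
      K.sameLine_self c x hx, sub_zero]
  have h4 : inner ℝ (K.normal b) (x - K.vertex a) = 0 := by
    rcases hb.normal_eq with hb' | hb' <;> rcases hc.normal_eq with hc' | hc' <;>
      rw [hc'] at h3 <;> rw [hb'] <;> simpa using h3
  rw [← sub_add_sub_cancel x (K.vertex a), inner_add_right, h1, h4, add_zero]

end PolygonalElement

namespace PolygonalElement

variable (K : PolygonalElement)

/-! ### Edge bubble functions -/

/-- The factor for the `b`-th edge of the bubble function of the `a`-th edge. -/
def edgeFactor (a b : Fin K.N) : Poly :=
  open Classical in
  if K.SameLine a b then if K.normal b = K.normal a then 1 else K.quadFun b else K.weight b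

/-- The bubble function of the `a`-th edge. It vanishes on the edges that are not on the line
through the `a`-th edge; on the other ones its sign tells whether the normals agree. -/
def edgeBubble (a : Fin K.N) : Poly := ∏ b ∈ Finset.univ.erase a, K.edgeFactor a b

/-- The quadratic factor occurs only for opposite normals, hence only on non-convex elements, where
`expo = 2` leaves room for it. -/
theorem edgeFactor_mem (a b : Fin K.N) : K.edgeFactor a b ∈ polyLE K.expo := by
  unfold edgeFactor
  split_ifs with h1 h2
  · exact C_mem_polyLE 1 _
  · have : ¬ Convex ℝ K.carrier := fun hK => h2 (K.normal_eq_of_convex hK h1)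
    rw [show K.expo = 2 by rw [expo, if_neg this]]
    exact K.quadFun_mem b
  · exact K.weight_mem b

theorem edgeBubble_mem (a : Fin K.N) : K.edgeBubble a ∈ polyLE ((K.N - 1) * K.expo) := by
  have h := prod_mem_polyLE (Finset.univ.erase a) (K.edgeFactor a) fun b _ => K.edgeFactor_mem a b
  rwa [Finset.card_erase_of_mem (Finset.mem_univ a), Finset.card_fin] at h

/-- No single factor vanishes identically on the `a`-th edge, and the restrictions lie in an
integral domain. -/
theorem restrictEdge_edgeBubble_ne_zero (a : Fin K.N) : K.restrictEdge a (K.edgeBubble a) ≠ 0 := by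
  rw [edgeBubble, map_prod]
  refine Finset.prod_ne_zero_iff.2 fun b hb => ?_
  unfold edgeFactor
  split_ifs with h1 h2
  · rw [map_one]; exact one_ne_zero
  · exact K.restrictEdge_quadFun_ne_zero (Finset.ne_of_mem_erase hb).symm h1
  · rw [weight, map_pow]
    exact pow_ne_zero _ (K.restrictEdge_lineFun_ne_zero h1)

theorem evalAt_edgeBubble_of_not_sameLine {a c : Fin K.N} (h : ¬ K.SameLine a c) {x : Plane}
    (hx : x ∈ K.edge c) : evalAt (K.edgeBubble a) x = 0 := by
  have hca : c ≠ a := fun hca => h (hca ▸ K.sameLine_self a)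
  rw [edgeBubble, evalAt_prod]
  refine Finset.prod_eq_zero (Finset.mem_erase.2 ⟨hca, Finset.mem_univ c⟩) ?_
  rw [edgeFactor, if_neg h, K.evalAt_weight_of_mem_edge hx]

/-- On an edge `c` of the same line, the only factor that can be negative is the quadratic factor of
`c` itself, which `hbc` excludes. -/
theorem edgeFactor_nonneg {a b c : Fin K.N} (hc : K.SameLine a c)
    (hbc : b = c → K.normal b = K.normal a) {x : Plane} (hx : x ∈ K.edge c) :
    0 ≤ evalAt (K.edgeFactor a b) x := by
  unfold edgeFactor
  split_ifs with h1 h2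
  · rw [evalAt_one]; exact zero_le_one
  · exact K.quadFun_nonneg (fun h => h2 (hbc h)) hx (h1.inner_eq_zero hc hx)
  · exact K.weight_nonneg b (frontier_subset_closure (K.edge_subset_frontier c hx))

theorem edgeBubble_nonneg {a c : Fin K.N} (hc : K.SameLine a c) (hn : K.normal c = K.normal a)
    {x : Plane} (hx : x ∈ K.edge c) : 0 ≤ evalAt (K.edgeBubble a) x := by
  rw [edgeBubble, evalAt_prod]
  exact Finset.prod_nonneg fun b _ => K.edgeFactor_nonneg hc (fun h => h ▸ hn) hx

/-- Exactly one factor, the quadratic one of `c`, is nonpositive on `c`. This compensates the sign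
of the opposite normal in the jump term. -/
theorem edgeBubble_nonpos {a c : Fin K.N} (hc : K.SameLine a c) (hn : K.normal c ≠ K.normal a)
    {x : Plane} (hx : x ∈ K.edge c) : evalAt (K.edgeBubble a) x ≤ 0 := by
  have hca : c ∈ Finset.univ.erase a :=
    Finset.mem_erase.2 ⟨fun h => hn (by rw [h]), Finset.mem_univ c⟩
  rw [edgeBubble, evalAt_prod, ← Finset.mul_prod_erase _ _ hca]
  refine mul_nonpos_of_nonpos_of_nonneg ?_ (Finset.prod_nonneg fun b hb =>
    K.edgeFactor_nonneg hc (fun h => absurd h (Finset.ne_of_mem_erase hb)) hx)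
  rw [edgeFactor, if_pos hc, if_neg hn]
  exact K.quadFun_nonpos hx

/-- If jumps on the edges are balanced for each symmetric polynomial tensor, and if on the edges on
one line they are given by one polynomial of degree at most `k`, then they vanish there. -/
theorem jump_eq_zero {k : ℕ} (a : Fin K.N) {D : Fin 2 → Poly} (hD : ∀ l, D l ∈ polyLE k)
    {J : Fin K.N → Fin 2 → Plane → ℝ}
    (hJ : ∀ b, K.SameLine a b → ∀ l, ∀ x ∈ K.edge b, J b l x = evalAt (D l) x)
    (hbal : ∀ τ : Matrix (Fin 2) (Fin 2) Poly, τ.IsSymm →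
      (∀ l m, τ l m ∈ polyLE (K.gradDegree k)) →
      ∑ i, K.edgeIntegral i (fun x => ∑ l, J i l x * ∑ m, evalAt (τ l m) x * K.normal i m) = 0)
    (l : Fin 2) : ∀ x ∈ K.edge a, evalAt (D l) x = 0 := by
  set n := K.normal a with hn
  -- `S = D nᵀ + n Dᵀ - (D · n) n nᵀ` is a symmetric tensor with `S n = D`, since `|n| = 1`.
  set S : Fin 2 → Fin 2 → Poly := fun l m => D l * MvPolynomial.C (n m) +
    D m * MvPolynomial.C (n l) -
    (∑ j, D j * MvPolynomial.C (n j)) * MvPolynomial.C (n l * n m) with hS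
  have hSmem : ∀ l m, S l m ∈ polyLE k := fun l m =>
    Submodule.sub_mem _ (Submodule.add_mem _ (mul_C_mem_polyLE _ (hD l))
      (mul_C_mem_polyLE _ (hD m))) (mul_C_mem_polyLE _
        (Submodule.sum_mem _ fun j _ => mul_C_mem_polyLE _ (hD j)))
  have hSsymm : ∀ l m, S l m = S m l := fun l m => by
    simp only [hS, mul_comm (n l) (n m)]; ring
  have hnn : n 0 ^ 2 + n 1 ^ 2 = 1 := K.normal_sq 0 a
  have hSn : ∀ l x, ∑ m, evalAt (S l m) x * n m = evalAt (D l) x := fun l x => by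
    have hl : l = 0 ∨ l = 1 := by fin_cases l <;> simp
    simp only [hS, evalAt_sub, evalAt_add, evalAt_mul, evalAt_C, Fin.sum_univ_two]
    rcases hl with rfl | rfl
    · linear_combination (evalAt (D 0) x -
        (evalAt (D 0) x * n 0 + evalAt (D 1) x * n 1) * n 0) * hnn
    · linear_combination (evalAt (D 1) x -
        (evalAt (D 0) x * n 0 + evalAt (D 1) x * n 1) * n 1) * hnn
  have h := hbal (Matrix.of fun l m => K.edgeBubble a * S l m)
    (by ext1 l m; simp [hSsymm l m]) fun l m => by
      rw [K.gradDegree_eq]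
      have hN := K.three_le
      have he := K.one_le_expo
      -- The omission of the factor of edge `a` frees the degree `expo ≥ 1`, which allows `D` to
      -- have degree `k` and not only `k - 1`.
      refine polyLE_mono ?_ (mul_mem_polyLE (K.edgeBubble_mem a) (hSmem l m))
      have : K.N * K.expo = (K.N - 1) * K.expo + K.expo := by
        rw [← Nat.succ_mul, Nat.succ_eq_add_one, Nat.sub_add_cancel (by omega)]
      omega
  -- On the edges of this line `τ n_i` is plus or minus the bubble times `D`, and the bubble has the
  -- matching sign. All edge terms are therefore nonnegative, and each of them vanishes.
  have hint : ∀ i, K.SameLine a i → ∀ x ∈ K.edge i, (∑ l, J i l x *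
      ∑ m, evalAt ((Matrix.of fun l m => K.edgeBubble a * S l m) l m) x * K.normal i m) =
      (if K.normal i = n then 1 else -1) * evalAt (K.edgeBubble a) x *
        ∑ l, evalAt (D l) x ^ 2 := by
    intro i hi x hx
    have e : ∀ l, ∑ m, evalAt ((Matrix.of fun l m => K.edgeBubble a * S l m) l m) x *
        K.normal i m = (if K.normal i = n then 1 else -1) * evalAt (K.edgeBubble a) x *
          evalAt (D l) x := fun l => by
      rw [← hSn l x]
      split_ifs with hin
      · simp only [hin, Matrix.of_apply, evalAt_mul, Fin.sum_univ_two]; ring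
      · rw [hi.normal_eq.resolve_left hin]
        simp only [Matrix.of_apply, evalAt_mul, Fin.sum_univ_two, PiLp.neg_apply]; ring
    rw [Finset.mul_sum]
    refine Finset.sum_congr rfl fun l _ => ?_
    rw [e, hJ i hi l x hx]
    ring
  have hnonneg : ∀ i, ∀ x ∈ K.edge i, 0 ≤ ∑ l, J i l x *
      ∑ m, evalAt ((Matrix.of fun l m => K.edgeBubble a * S l m) l m) x * K.normal i m := by
    intro i x hx
    by_cases hi : K.SameLine a i
    · rw [hint i hi x hx]
      refine mul_nonneg ?_ (Finset.sum_nonneg fun l _ => sq_nonneg _)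
      split_ifs with hin
      · rw [one_mul]; exact K.edgeBubble_nonneg hi hin hx
      · rw [neg_one_mul]; exact neg_nonneg.2 (K.edgeBubble_nonpos hi hin hx)
    · simp [K.evalAt_edgeBubble_of_not_sameLine hi hx]
  have h0 := (Finset.sum_eq_zero_iff_of_nonneg fun i _ =>
    K.edgeIntegral_nonneg i (hnonneg i)).1 h a (Finset.mem_univ a)
  have ha : ∀ x ∈ K.edge a, _ = evalAt (K.edgeBubble a * ∑ l, D l ^ 2) x := fun x hx =>
    (hint a (K.sameLine_self a) x hx).trans (by rw [if_pos hn.symm]; simp)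
  rw [K.edgeIntegral_congr a ha] at h0
  have h1 := K.eq_zero_of_edgeIntegral_eq_zero a (continuous_evalAt _)
    (fun x hx => by rw [← ha x hx]; exact hnonneg a x hx) h0
  -- The bubble may have zeros on the edge; it is cancelled as a polynomial in one variable.
  rw [← restrictEdge_eq_zero_iff, map_mul] at h1
  have h2 := (mul_eq_zero.1 h1).resolve_left (K.restrictEdge_edgeBubble_ne_zero a)
  intro x hx
  have h3 := (K.restrictEdge_eq_zero_iff a _).1 h2 x hx
  simp only [evalAt_sum, evalAt_pow] at h3
  exact pow_eq_zero_iff (two_ne_zero) |>.1 ((Finset.sum_eq_zero_iff_of_nonneg fun l _ =>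
    sq_nonneg (evalAt (D l) x)).1 h3 l (Finset.mem_univ l))

end PolygonalElement

/-! ### Rigid motions and constants -/

/-- A polynomial with vanishing gradient that vanishes at a point is zero. -/
theorem eq_zero_of_pderiv_eq_zero {P : Poly} (h : ∀ l, MvPolynomial.pderiv l P = 0) {a : Plane}
    (ha : evalAt P a = 0) : P = 0 := by
  refine eq_zero_of_forall_evalAt fun x => ?_
  have hd : ∀ t : ℝ, HasDerivAt (fun t : ℝ => evalAt P (a + t • (x - a))) 0 t := fun t => by
    simpa [h] using hasDerivAt_evalAt_line P a (x - a) t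
  have := is_const_of_deriv_eq_zero (fun t => (hd t).differentiableAt) (fun t => (hd t).deriv) 1 0
  simpa [ha] using this

/-- A vector field with vanishing strain that vanishes at two points is zero. -/
theorem eq_zero_of_strain_eq_zero {θ : Fin 2 → Poly} (h : strain θ = 0) {a b : Plane} (hab : a ≠ b)
    (ha : ∀ l, evalAt (θ l) a = 0) (hb : ∀ l, evalAt (θ l) b = 0) : θ = 0 := by
  have hst : ∀ l m x, evalAt (MvPolynomial.pderiv m (θ l)) x +
      evalAt (MvPolynomial.pderiv l (θ m)) x = 0 := fun l m x => by
    have := congrArg (fun E : Matrix (Fin 2) (Fin 2) Poly => evalAt (E l m) x) h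
    simpa [strain] using this
  -- If `θ(c) = 0`, then `θ(x) · (x - c) = 0`: along the line from `c` to `x` the derivative of `θ ·
  -- (x - c)` is the strain applied to `x - c` twice.
  have key : ∀ c : Plane, (∀ l, evalAt (θ l) c = 0) → ∀ x : Plane,
      evalAt (θ 0) x * (x 0 - c 0) + evalAt (θ 1) x * (x 1 - c 1) = 0 := by
    intro c hc x
    have hd : ∀ t : ℝ, HasDerivAt (fun t : ℝ => evalAt (θ 0) (c + t • (x - c)) * (x 0 - c 0) +
        evalAt (θ 1) (c + t • (x - c)) * (x 1 - c 1)) 0 t := fun t => by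
      have h0 := (hasDerivAt_evalAt_line (θ 0) c (x - c) t).mul_const (x 0 - c 0)
      have h1 := (hasDerivAt_evalAt_line (θ 1) c (x - c) t).mul_const (x 1 - c 1)
      refine (h0.add h1).congr_deriv ?_
      simp only [Fin.sum_univ_two, PiLp.sub_apply]
      linear_combination (x 0 - c 0) ^ 2 / 2 * hst 0 0 (c + t • (x - c)) +
        (x 1 - c 1) ^ 2 / 2 * hst 1 1 (c + t • (x - c)) +
        (x 0 - c 0) * (x 1 - c 1) * hst 0 1 (c + t • (x - c))
    have := is_const_of_deriv_eq_zero (fun t => (hd t).differentiableAt) (fun t => (hd t).deriv) 1 0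
    simpa [hc] using this
  -- The determinant of `x - a` and `x - b`. By Cramer's rule, orthogonality of `θ(x)` to both
  -- vectors gives `Q θ = 0`.
  set Q : Poly := (MvPolynomial.X 0 - MvPolynomial.C (a 0)) *
    (MvPolynomial.X 1 - MvPolynomial.C (b 1)) -
    (MvPolynomial.X 1 - MvPolynomial.C (a 1)) * (MvPolynomial.X 0 - MvPolynomial.C (b 0)) with hQ
  have hQx : ∀ x, evalAt Q x = (x 0 - a 0) * (x 1 - b 1) - (x 1 - a 1) * (x 0 - b 0) := fun x => by
    simp [hQ]
  have hQ0 : Q ≠ 0 := fun h0 => by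
    have hz : ∀ x : Plane, (x 0 - a 0) * (x 1 - b 1) - (x 1 - a 1) * (x 0 - b 0) = 0 := fun x => by
      rw [← hQx, h0, evalAt_zero]
    -- At `a` shifted by a unit in either direction, `Q` is up to sign a coordinate of `a - b`.
    have h1 := hz (pt 0 (a 0 + 1) (a 1))
    have h2 := hz (pt 0 (a 0) (a 1 + 1))
    simp [pt] at h1 h2
    refine hab (ext_coord (l := 0) ?_ ?_)
    · linarith
    · change a 1 = b 1
      linarith
  have hl : ∀ l, Q * θ l = 0 := by
    intro l
    refine eq_zero_of_forall_evalAt fun x => ?_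
    have h1 := key a ha x
    have h2 := key b hb x
    have hl : l = 0 ∨ l = 1 := by fin_cases l <;> simp
    rw [evalAt_mul, hQx]
    rcases hl with rfl | rfl
    · linear_combination (x 1 - b 1) * h1 - (x 1 - a 1) * h2
    · linear_combination -(x 0 - b 0) * h1 + (x 0 - a 0) * h2
  funext l
  exact (mul_eq_zero.1 (hl l)).resolve_left hQ0

/-! ### Connectivity of a polygonal partition -/

namespace IsPolygonalPartition

variable {ι : Type*} {Ω : Set Plane} {T : ι → PolygonalElement}

/-- An open element that contains a closure point of another element would intersect that element.
-/
theorem mem_frontier_of_mem_closure (hT : IsPolygonalPartition Ω T) {i j : ι} (hij : i ≠ j)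
    {x : Plane} (hi : x ∈ closure (T i).carrier) (hj : x ∈ closure (T j).carrier) :
    x ∈ frontier (T j).carrier := by
  rw [(T j).isOpen_carrier.frontier_eq]
  refine ⟨hj, fun h => ?_⟩
  obtain ⟨y, hyj, hyi⟩ := mem_closure_iff.1 hi _ (T j).isOpen_carrier h
  exact Set.disjoint_left.1 (hT.disjoint i j hij) hyi hyj

/-- An interior point of an edge that lies in `Ω` is in the closure of another element. -/
theorem exists_mem_closure_of_mem [Finite ι] (hΩ : IsOpen Ω) (hT : IsPolygonalPartition Ω T)
    {i : ι} {a : Fin (T i).N} {x : Plane}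
    (hx : x ∈ openSegment ℝ ((T i).vertex a) ((T i).next a)) (hxΩ : x ∈ Ω) :
    ∃ j, i ≠ j ∧ x ∈ closure (T j).carrier := by
  have hcl : IsClosed (⋃ j ∈ {j | i ≠ j}, closure (T j).carrier) :=
    (Set.toFinite _).isClosed_biUnion fun j _ => isClosed_closure
  obtain ⟨ε, hε, hball⟩ := (T i).exists_half_disc a hx
  have htend : Filter.Tendsto (fun s : ℝ => x + s • (T i).normal a) (nhdsWithin 0 (Set.Ioi 0))
      (nhds x) := by
    have : Continuous fun s : ℝ => x + s • (T i).normal a := by fun_prop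
    simpa using (this.tendsto 0).mono_left nhdsWithin_le_nhds
  -- The points `x + s n` are in `Ω` but outside the closure of `T i`, so other elements cover them;
  -- finitely many closures have a closed union.
  have hmem : x ∈ ⋃ j ∈ {j | i ≠ j}, closure (T j).carrier := by
    refine hcl.mem_of_tendsto htend ?_
    filter_upwards [htend (hΩ.mem_nhds hxΩ), htend (Metric.ball_mem_nhds x hε),
      self_mem_nhdsWithin] with s hs hsb hs0
    obtain ⟨j, hj⟩ := Set.mem_iUnion.1 (hT.cover hs)
    refine Set.mem_biUnion (x := j) (fun hij => ?_) hj
    subst hij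
    refine (hball _ hsb).2 ?_ hj
    rw [add_sub_cancel_left, inner_smul_right, real_inner_self_eq_norm_sq, (T i).norm_normal]
    simpa using hs0
  simpa using hmem

/-- An edge that belongs to one element only lies on the boundary. -/
theorem edge_subset_frontier_of_not_shared [Finite ι] (hΩ : IsOpen Ω)
    (hT : IsPolygonalPartition Ω T) {i : ι} {a : Fin (T i).N}
    (h : ∀ j b, i ≠ j → (T i).edge a ≠ (T j).edge b) : (T i).edge a ⊆ frontier Ω := by
  have hopen : openSegment ℝ ((T i).vertex a) ((T i).next a) ⊆ frontier Ω := by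
    intro x hx
    have hxe := (T i).openSegment_subset_edge a hx
    have hxi := frontier_subset_closure ((T i).edge_subset_frontier a hxe)
    rw [hΩ.frontier_eq]
    refine ⟨closure_mono (hT.subset i) hxi, fun hxΩ => ?_⟩
    obtain ⟨j, hij, hxj⟩ := hT.exists_mem_closure_of_mem hΩ hx hxΩ
    have hxf := hT.mem_frontier_of_mem_closure hij hxi hxj
    rw [(T j).frontier_carrier] at hxf
    obtain ⟨b, hb⟩ := Set.mem_iUnion.1 hxf
    -- An interior point of an edge can lie on an edge of another element only if the two edges
    -- coincide.
    rcases hT.conforming i j hij a b with he | he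
    · exact h j b hij he
    · exact (T i).not_mem_ends_of_mem_openSegment a hx (he ⟨hxe, hb⟩).1
  have := closure_minimal hopen isClosed_frontier
  rwa [closure_openSegment] at this

/-- Near an interior point of a common edge, the two elements cover the plane. -/
theorem mem_nhds_of_shared (hT : IsPolygonalPartition Ω T) {i j : ι} (hij : i ≠ j)
    {a : Fin (T i).N} {b : Fin (T j).N} (hab : (T i).edge a = (T j).edge b) {x : Plane}
    (hxa : x ∈ openSegment ℝ ((T i).vertex a) ((T i).next a))
    (hxb : x ∈ openSegment ℝ ((T j).vertex b) ((T j).next b)) :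
    closure (T i).carrier ∪ closure (T j).carrier ∈ nhds x := by
  obtain ⟨ε, hε, hi⟩ := (T i).exists_half_disc a hxa
  obtain ⟨δ, hδ, hj⟩ := (T j).exists_half_disc b hxb
  have horth : inner ℝ ((T j).normal b) ((T i).next a - (T i).vertex a) = 0 :=
    (T j).inner_normal_eq_zero b (hab ▸ (T i).next_mem_edge a) (hab ▸ (T i).vertex_mem_edge a)
  have htend : ∀ z, Filter.Tendsto (fun s : ℝ => z - s • (T i).normal a)
      (nhdsWithin 0 (Set.Ioi 0)) (nhds z) := fun z => by
    have : Continuous fun s : ℝ => z - s • (T i).normal a := by fun_prop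
    simpa using (this.tendsto 0).mono_left nhdsWithin_le_nhds
  have hinner : ∀ (z : Plane) (s : ℝ), inner ℝ ((T i).normal a) (z - s • (T i).normal a - x) =
      inner ℝ ((T i).normal a) (z - x) - s := fun z s => by
    rw [sub_right_comm, inner_sub_right, inner_smul_right, real_inner_self_eq_norm_sq,
      (T i).norm_normal]
    ring
  -- Equal normals would place half discs of both elements on the same side of the edge, where they
  -- would overlap.
  have hn : (T j).normal b = -(T i).normal a := by
    refine (eq_or_eq_neg_of_inner_eq_zero ((T i).norm_normal a) ((T j).norm_normal b)
      (sub_ne_zero.2 ((T i).next_ne_vertex a)) ((T i).normal_orthogonal a) horth).resolve_left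
      fun hn => ?_
    have h₁ := (htend x).eventually (Metric.ball_mem_nhds x hε)
    have h₂ := (htend x).eventually (Metric.ball_mem_nhds x hδ)
    obtain ⟨s, ⟨hsε, hsδ⟩, hs0⟩ := ((h₁.and h₂).and self_mem_nhdsWithin).exists
    have hneg : inner ℝ ((T i).normal a) (x - s • (T i).normal a - x) < 0 := by
      rw [hinner, sub_self, inner_zero_right, zero_sub, neg_lt_zero]
      exact hs0
    exact Set.disjoint_left.1 (hT.disjoint i j hij) ((hi _ hsε).1 hneg)
      ((hj _ hsδ).1 (by rw [hn]; exact hneg))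
  filter_upwards [Metric.ball_mem_nhds x hε, Metric.ball_mem_nhds x hδ] with z hzε hzδ
  rcases lt_or_ge 0 (inner ℝ ((T i).normal a) (z - x)) with hz | hz
  · right
    refine subset_closure ((hj z hzδ).1 ?_)
    rw [hn, inner_neg_left]
    linarith
  -- This includes the points on the edge line, which are limits of points `z - s n` of the inner
  -- half disc.
  · left
    refine mem_closure_of_tendsto (htend z) ?_
    filter_upwards [htend z (Metric.isOpen_ball.mem_nhds hzε), self_mem_nhdsWithin] with s hs hs0
    refine (hi _ hs).1 ?_
    rw [hinner]
    have : (0 : ℝ) < s := hs0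
    linarith

/-- A quantity attached to the elements that agrees for elements with a common edge and vanishes on
elements with an edge on the boundary is zero. -/
theorem eq_zero_of_edges [Finite ι] {X : Type*} [Zero X] (hΩ : IsOpen Ω)
    (hT : IsPolygonalPartition Ω T) (R : ι → X)
    (hshared : ∀ i j a b, i ≠ j → (T i).edge a = (T j).edge b → R i = R j)
    (hbd : ∀ i a, (T i).edge a ⊆ frontier Ω → R i = 0) (i₀ : ι) : R i₀ = 0 := by
  by_contra hr
  set S : Set Plane := Set.range fun c : Σ i, Fin (T i).N => (T c.1).vertex c.2 with hS
  have hSfin : S.Finite := Set.finite_range _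
  -- The region where the quantity has the value `R i₀ ≠ 0`. It is closed, and away from the
  -- vertices it is also open.
  set U : Set Plane := ⋃ j ∈ {j | R j = R i₀}, closure (T j).carrier with hU
  have hUcl : IsClosed U := (Set.toFinite _).isClosed_biUnion fun j _ => isClosed_closure
  have hUsub : ∀ j, R j = R i₀ → closure (T j).carrier ⊆ U := fun j hj =>
    Set.subset_biUnion_of_mem (u := fun j => closure (T j).carrier) (x := j) hj
  have hseg : ∀ x ∉ S, ∀ i a, x ∈ (T i).edge a →
      x ∈ openSegment ℝ ((T i).vertex a) ((T i).next a) := by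
    intro x hx i a hxa
    refine (((T i).mem_edge_iff a x).1 hxa).resolve_right ?_
    rintro (h | h)
    · exact hx ⟨⟨i, a⟩, h.symm⟩
    · exact hx ⟨⟨i, finRotate _ a⟩, (Set.mem_singleton_iff.1 h).symm⟩
  have hint : ∀ x ∈ U, x ∉ S → x ∈ interior U := by
    intro x hxU hxS
    rw [mem_interior_iff_mem_nhds]
    obtain ⟨i, hi, hxi⟩ := Set.mem_iUnion₂.1 hxU
    have hi' : R i = R i₀ := hi
    by_cases hxT : x ∈ (T i).carrier
    · exact Filter.mem_of_superset ((T i).isOpen_carrier.mem_nhds hxT)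
        (subset_closure.trans (hUsub i hi'))
    · have hxf : x ∈ frontier (T i).carrier := by
        rw [(T i).isOpen_carrier.frontier_eq]; exact ⟨hxi, hxT⟩
      rw [(T i).frontier_carrier] at hxf
      obtain ⟨a, ha⟩ := Set.mem_iUnion.1 hxf
      -- An unshared edge lies on `∂Ω`, which would force the value zero. So the edge is shared, and
      -- both sides belong to `U`.
      by_cases hsh : ∀ j b, i ≠ j → (T i).edge a ≠ (T j).edge b
      · exact absurd (hi'.symm.trans (hbd i a (hT.edge_subset_frontier_of_not_shared hΩ hsh))) hr
      · push Not at hsh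
        obtain ⟨j, b, hij, hab⟩ := hsh
        have hj : R j = R i₀ := (hshared i j a b hij hab).symm.trans hi'
        have hxb : x ∈ (T j).edge b := by
          rw [← hab]; exact ha
        exact Filter.mem_of_superset (hT.mem_nhds_of_shared hij hab (hseg x hxS i a ha)
          (hseg x hxS j b hxb)) (Set.union_subset (hUsub i hi') (hUsub j hj))
  have hrank : 1 < Module.rank ℝ Plane := by
    rw [← Module.finrank_eq_rank, finrank_euclideanSpace_fin]
    norm_num
  -- Removing finitely many points does not disconnect the plane, so `U` and the vertices together
  -- fill it.
  have hconn := (hSfin.countable.isConnected_compl_of_one_lt_rank hrank).isPreconnected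
  have hsub : Sᶜ ⊆ interior U := by
    refine hconn.subset_of_disjoint_frontier isOpen_interior ?_ ?_
    · rw [Set.disjoint_left]
      intro x hxf hxS
      rw [isOpen_interior.frontier_eq] at hxf
      exact hxf.2 (hint x (closure_minimal interior_subset hUcl hxf.1) hxS)
    · obtain ⟨x, hxS, hx⟩ := (hSfin.countable.dense_compl ℝ).exists_mem_open
        (T i₀).isOpen_carrier (T i₀).isConnected_carrier.nonempty
      exact ⟨x, hxS, interior_maximal (subset_closure.trans (hUsub i₀ rfl))
        (T i₀).isOpen_carrier hx⟩
  have hUb : Bornology.IsBounded U :=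
    (Bornology.isBounded_biUnion (Set.toFinite _)).2 fun j _ => (T j).isBounded_carrier.closure
  refine NormedSpace.unbounded_univ ℝ Plane ((hUb.union hSfin.isBounded).subset fun x _ => ?_)
  by_cases hx : x ∈ S
  · exact Or.inr hx
  · exact Or.inl (interior_subset (hsub hx))

end IsPolygonalPartition

/-! ### Linearity of the discrete weak operators -/

namespace PolygonalElement

variable (K : PolygonalElement)

/-- Linearity is carried throughout as one identity in `u + c • v`, from which `linearMapOfAddSMul`
recovers additivity and homogeneity. -/
theorem integral_add_mul {f g : Plane → ℝ} (hf : IntegrableOn f K.carrier)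
    (hg : IntegrableOn g K.carrier) (c : ℝ) :
    K.integral (fun x => f x + c * g x) = K.integral f + c * K.integral g := by
  rw [K.integral_add hf (Integrable.const_mul hg c), K.integral_const_mul]

theorem edgeIntegral_add_mul (i : Fin K.N) {f g : Plane → ℝ} (hf : K.EdgeIntegrable i f)
    (hg : K.EdgeIntegrable i g) (c : ℝ) :
    K.edgeIntegral i (fun x => f x + c * g x) = K.edgeIntegral i f + c * K.edgeIntegral i g := by
  rw [K.edgeIntegral_add i (g := fun x => c * g x) hf (IntervalIntegrable.const_mul hg c),
    K.edgeIntegral_const_mul]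

theorem integrableOn_sum_evalAt_mul {κ : Type*} [Fintype κ] (P Q : κ → Poly) :
    IntegrableOn (fun x => ∑ l, evalAt (P l) x * evalAt (Q l) x) K.carrier :=
  K.integrableOn_of_continuous (continuous_finsetSum _ fun _ _ => continuous_evalAt_mul _ _)

theorem IsL2Proj.add_smul {K : PolygonalElement} {r : ℕ} {f f' : Fin 2 → Plane → ℝ}
    {G G' : Fin 2 → Poly} (hf : ∀ l, IntegrableOn (f l) K.carrier)
    (hf' : ∀ l, IntegrableOn (f' l) K.carrier) (h : K.IsL2Proj r f G) (h' : K.IsL2Proj r f' G')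
    (c : ℝ) : K.IsL2Proj r (fun l x => f l x + c * f' l x) (G + c • G') := by
  refine ⟨fun l => Submodule.add_mem _ (h.1 l) (Submodule.smul_mem _ c (h'.1 l)), fun q hq => ?_⟩
  have hi : ∀ {f : Fin 2 → Plane → ℝ}, (∀ l, IntegrableOn (f l) K.carrier) →
      IntegrableOn (fun x => ∑ l, f l x * evalAt (q l) x) K.carrier := fun hf =>
    integrable_finsetSum _ fun l _ => K.integrableOn_mul_of_continuous (hf l) (continuous_evalAt _)
  have e1 := K.integral_add_mul (K.integrableOn_sum_evalAt_mul G q)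
    (K.integrableOn_sum_evalAt_mul G' q) c
  have e2 := K.integral_add_mul (hi hf) (hi hf') c
  rw [h.2 q hq, h'.2 q hq, ← e2] at e1
  convert e1 using 2
  · funext x
    simp only [Pi.add_apply, Pi.smul_apply, evalAt_add, evalAt_smul, Fin.sum_univ_two]; ring
  · funext x
    simp only [Fin.sum_univ_two]; ring

theorem IsWeakGrad.add_smul {K : PolygonalElement} {r : ℕ} {w₀ w₀' : Plane → ℝ}
    {wb wb' : Fin K.N → Plane → ℝ} {G G' : Fin 2 → Poly} (h₀ : IntegrableOn w₀ K.carrier)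
    (h₀' : IntegrableOn w₀' K.carrier) (hb : ∀ i, K.EdgeIntegrable i (wb i))
    (hb' : ∀ i, K.EdgeIntegrable i (wb' i)) (h : K.IsWeakGrad r w₀ wb G)
    (h' : K.IsWeakGrad r w₀' wb' G') (c : ℝ) :
    K.IsWeakGrad r (fun x => w₀ x + c * w₀' x) (fun i x => wb i x + c * wb' i x) (G + c • G') := by
  refine ⟨fun l => Submodule.add_mem _ (h.1 l) (Submodule.smul_mem _ c (h'.1 l)), fun q hq => ?_⟩
  have hi : ∀ {f : Plane → ℝ}, IntegrableOn f K.carrier → IntegrableOn (fun x => f x *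
      ∑ l, evalAt (MvPolynomial.pderiv l (q l)) x) K.carrier := fun hf =>
    K.integrableOn_mul_of_continuous hf (continuous_finsetSum _ fun l _ => continuous_evalAt _)
  have he : ∀ {f : Fin K.N → Plane → ℝ}, (∀ i, K.EdgeIntegrable i (f i)) → ∀ i,
      K.EdgeIntegrable i (fun x => f i x * ∑ l, evalAt (q l) x * K.normal i l) := fun hf i =>
    (hf i).mul_continuous
      (continuous_finsetSum _ fun l _ => (continuous_evalAt _).mul continuous_const)
  have e1 := K.integral_add_mul (K.integrableOn_sum_evalAt_mul G q)
    (K.integrableOn_sum_evalAt_mul G' q) c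
  have e2 := K.integral_add_mul (hi h₀) (hi h₀') c
  have e3 := fun i => K.edgeIntegral_add_mul i (he hb i) (he hb' i) c
  have e4 : ∀ a b a' b' : ℝ, -a + b + c * (-a' + b') = -(a + c * a') + (b + c * b') :=
    fun a b a' b' => by ring
  rw [h.2 q hq, h'.2 q hq, e4, ← e2, Finset.mul_sum, ← Finset.sum_add_distrib] at e1
  simp_rw [← e3] at e1
  convert e1 using 2
  · funext x
    simp only [Pi.add_apply, Pi.smul_apply, evalAt_add, evalAt_smul, Fin.sum_univ_two]; ring
  · congr 2
    funext x
    ring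
  · refine Finset.sum_congr rfl fun i _ => ?_
    congr 1
    funext x
    ring

theorem IsWeakSymGrad.add_smul {K : PolygonalElement} {r : ℕ} {w₀ w₀' : Fin 2 → Plane → ℝ}
    {wb wb' : Fin K.N → Fin 2 → Plane → ℝ} {E E' : Matrix (Fin 2) (Fin 2) Poly}
    (h₀ : ∀ l, IntegrableOn (w₀ l) K.carrier) (h₀' : ∀ l, IntegrableOn (w₀' l) K.carrier)
    (hb : ∀ i l, K.EdgeIntegrable i (wb i l)) (hb' : ∀ i l, K.EdgeIntegrable i (wb' i l))
    (h : K.IsWeakSymGrad r w₀ wb E) (h' : K.IsWeakSymGrad r w₀' wb' E') (c : ℝ) :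
    K.IsWeakSymGrad r (fun l x => w₀ l x + c * w₀' l x) (fun i l x => wb i l x + c * wb' i l x)
      (E + c • E') := by
  refine ⟨⟨h.1.1.add (h'.1.1.smul c), fun l m =>
    Submodule.add_mem _ (h.1.2 l m) (Submodule.smul_mem _ c (h'.1.2 l m))⟩, fun τ hs hτ => ?_⟩
  have hi : ∀ {f : Fin 2 → Plane → ℝ}, (∀ l, IntegrableOn (f l) K.carrier) →
      IntegrableOn (fun x => ∑ l, f l x *
        ∑ m, evalAt (MvPolynomial.pderiv m (τ l m)) x) K.carrier := fun hf =>
    integrable_finsetSum _ fun l _ => K.integrableOn_mul_of_continuous (hf l)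
      (continuous_finsetSum _ fun l _ => continuous_evalAt _)
  have he : ∀ {f : Fin K.N → Fin 2 → Plane → ℝ}, (∀ i l, K.EdgeIntegrable i (f i l)) → ∀ i,
      K.EdgeIntegrable i (fun x => ∑ l, f i l x * ∑ m, evalAt (τ l m) x * K.normal i m) := by
    intro f hf i
    have h := fun l => (hf i l).mul_continuous (g := fun x => ∑ m, evalAt (τ l m) x * K.normal i m)
      (continuous_finsetSum _ fun m _ => (continuous_evalAt _).mul continuous_const)
    have h' := IntervalIntegrable.add (h 0) (h 1)
    unfold EdgeIntegrable
    simp only [Fin.sum_univ_two] at h' ⊢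
    exact h'
  have hE : ∀ E : Matrix (Fin 2) (Fin 2) Poly,
      IntegrableOn (fun x => ∑ l, ∑ m, evalAt (E l m) x * evalAt (τ l m) x) K.carrier := fun E =>
    K.integrableOn_of_continuous (continuous_finsetSum _ fun l _ =>
      continuous_finsetSum _ fun m _ => continuous_evalAt_mul _ _)
  have e1 := K.integral_add_mul (hE E) (hE E') c
  have e2 := K.integral_add_mul (hi h₀) (hi h₀') c
  have e3 := fun i => K.edgeIntegral_add_mul i (he hb i) (he hb' i) c
  have e4 : ∀ a b a' b' : ℝ, -a + b + c * (-a' + b') = -(a + c * a') + (b + c * b') :=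
    fun a b a' b' => by ring
  rw [h.2 τ hs hτ, h'.2 τ hs hτ, e4, ← e2, Finset.mul_sum, ← Finset.sum_add_distrib] at e1
  simp_rw [← e3] at e1
  convert e1 using 2
  · funext x
    simp only [Matrix.add_apply, Matrix.smul_apply, evalAt_add, evalAt_smul, Fin.sum_univ_two]
    ring
  · congr 2
    funext x
    simp only [Fin.sum_univ_two]
    ring
  · refine Finset.sum_congr rfl fun i _ => ?_
    congr 1
    funext x
    simp only [Fin.sum_univ_two]
    ring

/-- Well-definedness turns the choice by `Classical.epsilon` into the defining relation, here and in
the two analogues below. -/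
theorem isL2Proj_l2Proj (r : ℕ) (f : Fin 2 → Plane → ℝ) (hf : ∀ l, IntegrableOn (f l) K.carrier) :
    K.IsL2Proj r f (K.l2Proj r f) :=
  Classical.epsilon_spec (K.existsUnique_isL2Proj r f hf).exists

theorem isWeakGrad_weakGrad (r : ℕ) (w₀ : Plane → ℝ) (wb : Fin K.N → Plane → ℝ)
    (h₀ : IntegrableOn w₀ K.carrier) (hb : ∀ i, K.EdgeIntegrable i (wb i)) :
    K.IsWeakGrad r w₀ wb (K.weakGrad r w₀ wb) :=
  Classical.epsilon_spec (K.existsUnique_isWeakGrad r w₀ wb h₀ hb).exists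

theorem isWeakSymGrad_weakSymGrad (r : ℕ) (η₀ : Fin 2 → Plane → ℝ)
    (ηb : Fin K.N → Fin 2 → Plane → ℝ) (h₀ : ∀ l, IntegrableOn (η₀ l) K.carrier)
    (hb : ∀ i l, K.EdgeIntegrable i (ηb i l)) :
    K.IsWeakSymGrad r η₀ ηb (K.weakSymGrad r η₀ ηb) :=
  Classical.epsilon_spec (K.existsUnique_isWeakSymGrad r η₀ ηb h₀ hb).exists

end PolygonalElement

/-! ### Traces of weak functions and linearity of the operators on the partition. -/

section Mesh

variable {ι : Type*} {T : ι → PolygonalElement}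

/-- On its edge a trace is a polynomial of the plane; the discontinuous cut-off outside the edge can
thus be replaced in edge integrals. -/
theorem exists_bdry_eq_evalAt {k p : ℕ} {v : WeakFun T} (hv : v ∈ weakSpace T k p) (i : ι)
    (a : Fin (T i).N) : ∃ P ∈ polyLE p, ∀ x ∈ (T i).edge a, v.bdry i a x = evalAt P x := by
  obtain ⟨P, hP, h⟩ := hv.2 ⟨(T i).edge a, i, a, rfl⟩
  refine ⟨P, hP, fun x hx => ?_⟩
  rw [WeakFun.bdry, h, Set.indicator_of_mem hx]

theorem edgeIntegrable_congr {K : PolygonalElement} {i : Fin K.N} {f g : Plane → ℝ}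
    (hf : K.EdgeIntegrable i f) (h : ∀ x ∈ K.edge i, g x = f x) : K.EdgeIntegrable i g := by
  refine IntervalIntegrable.congr (fun s hs => ?_) hf
  rw [Set.uIoc_of_le zero_le_one] at hs
  exact (h _ (K.edgePoint_mem_edge i (Set.Ioc_subset_Icc_self hs))).symm

theorem edgeIntegrable_bdry {k p : ℕ} {v : WeakFun T} (hv : v ∈ weakSpace T k p) (i : ι)
    (a : Fin (T i).N) : (T i).EdgeIntegrable a (v.bdry i a) := by
  obtain ⟨P, -, h⟩ := exists_bdry_eq_evalAt hv i a
  exact edgeIntegrable_congr ((T i).edgeIntegrable_of_continuous a (continuous_evalAt P)) h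

theorem isWeakGrad_mesh {r k p : ℕ} {v : WeakFun T} (hv : v ∈ weakSpace T k p) (i : ι) :
    (T i).IsWeakGrad ((T i).gradDegree r) (evalAt (v.1 i)) (fun a => v.bdry i a)
      (meshWeakGrad r v i) :=
  (T i).isWeakGrad_weakGrad _ _ _ ((T i).integrableOn_of_continuous (continuous_evalAt _))
    fun a => edgeIntegrable_bdry hv i a

theorem isWeakSymGrad_mesh {r q m : ℕ} {η : Fin 2 → WeakFun T} (hη : ∀ l, η l ∈ weakSpace T q m)
    (i : ι) : (T i).IsWeakSymGrad ((T i).gradDegree r) (fun l => evalAt ((η l).1 i))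
      (fun a l => (η l).bdry i a) (meshWeakSymGrad r η i) :=
  (T i).isWeakSymGrad_weakSymGrad _ _ _
    (fun _ => (T i).integrableOn_of_continuous (continuous_evalAt _))
    fun a l => edgeIntegrable_bdry (hη l) i a

theorem bdry_add_smul (u v : WeakFun T) (c : ℝ) (i : ι) (a : Fin (T i).N) :
    (u + c • v).bdry i a = fun x => u.bdry i a x + c * v.bdry i a x := rfl

theorem evalAt_add_smul (P Q : Poly) (c : ℝ) :
    evalAt (P + c • Q) = fun x => evalAt P x + c * evalAt Q x := by
  funext x; simp

theorem weakSpace_add_smul {k p : ℕ} {u v : WeakFun T} (hu : u ∈ weakSpace T k p)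
    (hv : v ∈ weakSpace T k p) (c : ℝ) : u + c • v ∈ weakSpace T k p := by
  refine ⟨fun i => Submodule.add_mem _ (hu.1 i) (Submodule.smul_mem _ c (hv.1 i)), fun e => ?_⟩
  obtain ⟨P, hP, hPe⟩ := hu.2 e
  obtain ⟨Q, hQ, hQe⟩ := hv.2 e
  refine ⟨P + c • Q, Submodule.add_mem _ hP (Submodule.smul_mem _ c hQ), ?_⟩
  funext x
  change u.2 e x + c * v.2 e x = _
  rw [hPe, hQe]
  by_cases hx : x ∈ e.1
  · simp [hx]
  · simp [hx]

theorem weakSpace₀_add_smul {Ω : Set Plane} {k p : ℕ} {u v : WeakFun T}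
    (hu : u ∈ weakSpace₀ T Ω k p) (hv : v ∈ weakSpace₀ T Ω k p) (c : ℝ) :
    u + c • v ∈ weakSpace₀ T Ω k p := by
  refine ⟨weakSpace_add_smul hu.1 hv.1 c, fun e he => ?_⟩
  change u.2 e + c • v.2 e = 0
  rw [hu.2 e he, hv.2 e he, smul_zero, add_zero]

theorem zero_mem_weakSpace₀ (Ω : Set Plane) (k p : ℕ) : (0 : WeakFun T) ∈ weakSpace₀ T Ω k p := by
  refine ⟨⟨fun i => Submodule.zero_mem _, fun e => ⟨0, Submodule.zero_mem _, ?_⟩⟩, fun e _ => rfl⟩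
  funext x
  change (0 : ℝ) = _
  by_cases hx : x ∈ e.1
  · simp [hx]
  · simp [hx]

variable (T) in
/-- The space `W_h^0` as a linear space. -/
def weakSubmodule₀ (Ω : Set Plane) (k p : ℕ) : Submodule ℝ (WeakFun T) where
  carrier := weakSpace₀ T Ω k p
  add_mem' := fun hu hv => by simpa using weakSpace₀_add_smul hu hv 1
  zero_mem' := zero_mem_weakSpace₀ Ω k p
  smul_mem' := fun c v hv => by
    simpa using weakSpace₀_add_smul (zero_mem_weakSpace₀ Ω k p) hv c

/-- The combination of the weak gradients satisfies the defining relation of the combined function,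
which has only one solution. -/
theorem meshWeakGrad_add_smul {r k p : ℕ} {u v : WeakFun T} (hu : u ∈ weakSpace T k p)
    (hv : v ∈ weakSpace T k p) (c : ℝ) (i : ι) :
    meshWeakGrad r (u + c • v) i = meshWeakGrad r u i + c • meshWeakGrad r v i := by
  have hi : ∀ P, IntegrableOn (evalAt P) (T i).carrier := fun P =>
    (T i).integrableOn_of_continuous (continuous_evalAt P)
  have h := (isWeakGrad_mesh (r := r) hu i).add_smul (hi _) (hi _)
    (fun a => edgeIntegrable_bdry hu i a) (fun a => edgeIntegrable_bdry hv i a)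
    (isWeakGrad_mesh hv i) c
  have h' := isWeakGrad_mesh (r := r) (weakSpace_add_smul hu hv c) i
  refine ((T i).existsUnique_isWeakGrad _ _ _ (hi _)
    fun a => edgeIntegrable_bdry (weakSpace_add_smul hu hv c) i a).unique h' ?_
  have e : evalAt ((u + c • v).1 i) = fun x => evalAt (u.1 i) x + c * evalAt (v.1 i) x :=
    evalAt_add_smul _ _ _
  rw [e]
  exact h

theorem meshWeakSymGrad_add_smul {r q m : ℕ} {θ η : Fin 2 → WeakFun T}
    (hθ : ∀ l, θ l ∈ weakSpace T q m) (hη : ∀ l, η l ∈ weakSpace T q m) (c : ℝ) (i : ι) :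
    meshWeakSymGrad r (θ + c • η) i = meshWeakSymGrad r θ i + c • meshWeakSymGrad r η i := by
  have hi : ∀ P, IntegrableOn (evalAt P) (T i).carrier := fun P =>
    (T i).integrableOn_of_continuous (continuous_evalAt P)
  have hs : ∀ l, (θ + c • η) l ∈ weakSpace T q m := fun l =>
    weakSpace_add_smul (hθ l) (hη l) c
  have h := (isWeakSymGrad_mesh (r := r) hθ i).add_smul (fun l => hi _) (fun l => hi _)
    (fun a l => edgeIntegrable_bdry (hθ l) i a) (fun a l => edgeIntegrable_bdry (hη l) i a)
    (isWeakSymGrad_mesh hη i) c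
  have h' := isWeakSymGrad_mesh (r := r) hs i
  refine ((T i).existsUnique_isWeakSymGrad _ _ _ (fun l => hi _)
    fun a l => edgeIntegrable_bdry (hs l) i a).unique h' ?_
  have e : (fun l => evalAt (((θ + c • η) l).1 i)) =
      fun l x => evalAt ((θ l).1 i) x + c * evalAt ((η l).1 i) x :=
    funext fun l => evalAt_add_smul _ _ _
  rw [e]
  exact h

theorem l2Proj_add_smul (K : PolygonalElement) (r : ℕ) (P Q : Fin 2 → Poly) (c : ℝ) :
    K.l2Proj r (fun l => evalAt ((P + c • Q) l)) =
      K.l2Proj r (fun l => evalAt (P l)) + c • K.l2Proj r (fun l => evalAt (Q l)) := by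
  have hi : ∀ P : Fin 2 → Poly, ∀ l, IntegrableOn (evalAt (P l)) K.carrier := fun P l =>
    K.integrableOn_of_continuous (continuous_evalAt _)
  have h := (K.isL2Proj_l2Proj r _ (hi P)).add_smul (hi P) (hi Q) (K.isL2Proj_l2Proj r _ (hi Q)) c
  refine (K.existsUnique_isL2Proj r _ (hi (P + c • Q))).unique (K.isL2Proj_l2Proj r _ (hi _)) ?_
  have e : (fun l => evalAt ((P + c • Q) l)) = fun l x => evalAt (P l) x + c * evalAt (Q l) x :=
    funext fun l => evalAt_add_smul _ _ _
  rw [e]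
  exact h

theorem shear_add_smul {r k p : ℕ} {w v : WeakFun T} (hw : w ∈ weakSpace T k p)
    (hv : v ∈ weakSpace T k p) (θ η : Fin 2 → WeakFun T) (c : ℝ) (i : ι) :
    shear r (w + c • v) (θ + c • η) i = shear r w θ i + c • shear r v η i := by
  have h := l2Proj_add_smul (T i) ((T i).gradDegree r) (fun l => (θ l).1 i) (fun l => (η l).1 i) c
  have e : (fun l => evalAt (((θ + c • η) l).1 i)) = fun l =>
      evalAt (((fun l => (θ l).1 i) + c • fun l => (η l).1 i : Fin 2 → Poly) l) := rfl
  unfold shear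
  rw [meshWeakGrad_add_smul hw hv, e, h, smul_sub]
  abel

end Mesh

section Mesh

variable {ι : Type*} {T : ι → PolygonalElement}

/-! ### Bilinearity of the forms -/

theorem continuous_matAt (E : Matrix (Fin 2) (Fin 2) Poly) : Continuous (matAt E) :=
  continuous_matrix fun _ _ => continuous_evalAt _

theorem matAt_add_smul (E E' : Matrix (Fin 2) (Fin 2) Poly) (c : ℝ) (x : Plane) :
    matAt (E + c • E') x = matAt E x + c • matAt E' x := by
  ext l m
  simp [matAt]

theorem continuous_bending (C : Matrix (Fin 2) (Fin 2) ℝ →ₗ[ℝ] Matrix (Fin 2) (Fin 2) ℝ)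
    (E E' : Matrix (Fin 2) (Fin 2) Poly) :
    Continuous fun x => ∑ l, ∑ m, C (matAt E x) l m * matAt E' x l m := by
  have hC : Continuous fun x => C (matAt E x) :=
    C.continuous_of_finiteDimensional.comp (continuous_matAt E)
  exact continuous_finsetSum _ fun l _ => continuous_finsetSum _ fun m _ =>
    (hC.matrix_elem l m).mul ((continuous_matAt E').matrix_elem l m)

theorem edgeIntegrable_mul_jump {k p : ℕ} {w v : WeakFun T} (hw : w ∈ weakSpace T k p)
    (hv : v ∈ weakSpace T k p) (i : ι) (a : Fin (T i).N) : (T i).EdgeIntegrable a fun x =>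
      (evalAt (w.1 i) x - w.bdry i a x) * (evalAt (v.1 i) x - v.bdry i a x) := by
  obtain ⟨P, -, hP⟩ := exists_bdry_eq_evalAt hw i a
  obtain ⟨Q, -, hQ⟩ := exists_bdry_eq_evalAt hv i a
  refine edgeIntegrable_congr ((T i).edgeIntegrable_of_continuous a
    (continuous_evalAt_mul (w.1 i - P) (v.1 i - Q))) fun x hx => ?_
  rw [hP x hx, hQ x hx, evalAt_sub, evalAt_sub]

theorem meshSize_nonneg : 0 ≤ meshSize T := Real.iSup_nonneg fun _ => Metric.diam_nonneg

variable [Fintype ι]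

theorem sum_integral_add_mul {F G H : ι → Plane → ℝ} (hF : ∀ i, IntegrableOn (F i) (T i).carrier)
    (hG : ∀ i, IntegrableOn (G i) (T i).carrier) (c : ℝ) (h : ∀ i x, H i x = F i x + c * G i x) :
    ∑ i, (T i).integral (H i) = ∑ i, (T i).integral (F i) + c * ∑ i, (T i).integral (G i) := by
  rw [Finset.mul_sum, ← Finset.sum_add_distrib]
  refine Finset.sum_congr rfl fun i _ => ?_
  rw [← (T i).integral_add_mul (hF i) (hG i) c, funext (h i)]

theorem bendingForm_add_smul_left {r q m : ℕ}
    (C : Matrix (Fin 2) (Fin 2) ℝ →ₗ[ℝ] Matrix (Fin 2) (Fin 2) ℝ) {θ θ' : Fin 2 → WeakFun T}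
    (hθ : ∀ l, θ l ∈ weakSpace T q m) (hθ' : ∀ l, θ' l ∈ weakSpace T q m) (c : ℝ)
    (η : Fin 2 → WeakFun T) :
    bendingForm r C (θ + c • θ') η = bendingForm r C θ η + c * bendingForm r C θ' η := by
  refine sum_integral_add_mul
    (fun i => (T i).integrableOn_of_continuous (continuous_bending C _ _))
    (fun i => (T i).integrableOn_of_continuous (continuous_bending C _ _)) c fun i x => ?_
  rw [meshWeakSymGrad_add_smul hθ hθ', matAt_add_smul, map_add, map_smul]
  simp only [Matrix.add_apply, Matrix.smul_apply, smul_eq_mul, Fin.sum_univ_two]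
  ring

/-- `C` is not assumed symmetric, so the two slots are treated separately. -/
theorem bendingForm_add_smul_right {r q m : ℕ}
    (C : Matrix (Fin 2) (Fin 2) ℝ →ₗ[ℝ] Matrix (Fin 2) (Fin 2) ℝ) (θ : Fin 2 → WeakFun T)
    {η η' : Fin 2 → WeakFun T} (hη : ∀ l, η l ∈ weakSpace T q m)
    (hη' : ∀ l, η' l ∈ weakSpace T q m) (c : ℝ) :
    bendingForm r C θ (η + c • η') = bendingForm r C θ η + c * bendingForm r C θ η' := by
  refine sum_integral_add_mul
    (fun i => (T i).integrableOn_of_continuous (continuous_bending C _ _))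
    (fun i => (T i).integrableOn_of_continuous (continuous_bending C _ _)) c fun i x => ?_
  rw [meshWeakSymGrad_add_smul hη hη', matAt_add_smul]
  simp only [Matrix.add_apply, Matrix.smul_apply, smul_eq_mul, Fin.sum_univ_two]
  ring

theorem shearForm_comm (k : ℕ) (w v : WeakFun T) (θ η : Fin 2 → WeakFun T) :
    shearForm k w θ v η = shearForm k v η w θ := by
  simp only [shearForm, mul_comm]

theorem shearForm_add_smul_left {r k p : ℕ} {w w' : WeakFun T} (hw : w ∈ weakSpace T k p)
    (hw' : w' ∈ weakSpace T k p) (θ θ' : Fin 2 → WeakFun T) (c : ℝ) (v : WeakFun T)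
    (η : Fin 2 → WeakFun T) :
    shearForm r (w + c • w') (θ + c • θ') v η =
      shearForm r w θ v η + c * shearForm r w' θ' v η := by
  refine sum_integral_add_mul (fun i => (T i).integrableOn_sum_evalAt_mul _ _)
    (fun i => (T i).integrableOn_sum_evalAt_mul _ _) c fun i x => ?_
  rw [shear_add_smul hw hw']
  simp only [Pi.add_apply, Pi.smul_apply, evalAt_add, evalAt_smul, Fin.sum_univ_two]
  ring

theorem stabilizer_comm (w v : WeakFun T) : stabilizer w v = stabilizer v w := by
  simp only [stabilizer, mul_comm]

theorem stabilizer_add_smul_left {k p : ℕ} {w w' v : WeakFun T} (hw : w ∈ weakSpace T k p)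
    (hw' : w' ∈ weakSpace T k p) (hv : v ∈ weakSpace T k p) (c : ℝ) :
    stabilizer (w + c • w') v = stabilizer w v + c * stabilizer w' v := by
  unfold stabilizer
  rw [Finset.mul_sum, ← Finset.sum_add_distrib]
  refine Finset.sum_congr rfl fun i _ => ?_
  rw [mul_left_comm, ← mul_add]
  congr 1
  rw [Finset.mul_sum, ← Finset.sum_add_distrib]
  refine Finset.sum_congr rfl fun a _ => ?_
  rw [← (T i).edgeIntegral_add_mul a (edgeIntegrable_mul_jump hw hv i a)
    (edgeIntegrable_mul_jump hw' hv i a)]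
  congr 1
  funext x
  have e : evalAt ((w + c • w').1 i) x = evalAt (w.1 i) x + c * evalAt (w'.1 i) x :=
    congrFun (evalAt_add_smul _ _ _) x
  rw [e, bdry_add_smul]
  ring

theorem load_add_smul {g : Plane → ℝ} (hg : ∀ i, IntegrableOn g (T i).carrier) (v v' : WeakFun T)
    (c : ℝ) : load g (v + c • v') = load g v + c * load g v' := by
  have hi : ∀ (v : WeakFun T) i, IntegrableOn (fun x => g x * evalAt (v.1 i) x) (T i).carrier :=
    fun v i => (T i).integrableOn_mul_of_continuous (hg i) (continuous_evalAt _)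
  refine sum_integral_add_mul (hi v) (hi v') c fun i x => ?_
  have e : evalAt ((v + c • v').1 i) x = evalAt (v.1 i) x + c * evalAt (v'.1 i) x :=
    congrFun (evalAt_add_smul _ _ _) x
  rw [e]
  ring

/-! ### Vanishing of the forms -/

theorem sum_matAt_nonneg {C : Matrix (Fin 2) (Fin 2) ℝ →ₗ[ℝ] Matrix (Fin 2) (Fin 2) ℝ}
    (hC : ∀ τ : Matrix (Fin 2) (Fin 2) ℝ, τ.IsSymm → τ ≠ 0 → 0 < ∑ i, ∑ j, C τ i j * τ i j)
    {E : Matrix (Fin 2) (Fin 2) Poly} (hE : E.IsSymm) (x : Plane) :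
    0 ≤ ∑ l, ∑ m, C (matAt E x) l m * matAt E x l m := by
  by_cases h : matAt E x = 0
  · simp [h]
  · exact (hC _ (hE.map _) h).le

theorem bendingForm_self_nonneg {C : Matrix (Fin 2) (Fin 2) ℝ →ₗ[ℝ] Matrix (Fin 2) (Fin 2) ℝ}
    (hC : ∀ τ : Matrix (Fin 2) (Fin 2) ℝ, τ.IsSymm → τ ≠ 0 → 0 < ∑ i, ∑ j, C τ i j * τ i j)
    {r q m : ℕ} {θ : Fin 2 → WeakFun T} (hθ : ∀ l, θ l ∈ weakSpace T q m) :
    0 ≤ bendingForm r C θ θ :=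
  Finset.sum_nonneg fun i _ => (T i).integral_nonneg fun x =>
    sum_matAt_nonneg hC (isWeakSymGrad_mesh hθ i).1.1 x

theorem meshWeakSymGrad_eq_zero {C : Matrix (Fin 2) (Fin 2) ℝ →ₗ[ℝ] Matrix (Fin 2) (Fin 2) ℝ}
    (hC : ∀ τ : Matrix (Fin 2) (Fin 2) ℝ, τ.IsSymm → τ ≠ 0 → 0 < ∑ i, ∑ j, C τ i j * τ i j)
    {r q m : ℕ} {θ : Fin 2 → WeakFun T} (hθ : ∀ l, θ l ∈ weakSpace T q m)
    (h : bendingForm r C θ θ = 0) (i : ι) : meshWeakSymGrad r θ i = 0 := by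
  have hnn : ∀ i x, 0 ≤ ∑ l, ∑ m, C (matAt (meshWeakSymGrad r θ i) x) l m *
      matAt (meshWeakSymGrad r θ i) x l m := fun i x =>
    sum_matAt_nonneg hC (isWeakSymGrad_mesh hθ i).1.1 x
  have h0 := (Finset.sum_eq_zero_iff_of_nonneg fun i _ =>
    (T i).integral_nonneg (hnn i)).1 h i (Finset.mem_univ i)
  have h1 := (T i).eq_zero_of_integral_eq_zero (continuous_bending C _ _) (fun x _ => hnn i x) h0
  ext1 l m
  refine eq_zero_of_evalAt_eq_zero (T i).isOpen_carrier (T i).isConnected_carrier.nonempty _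
    fun x hx => ?_
  have h2 : matAt (meshWeakSymGrad r θ i) x = 0 := by
    by_contra hne
    exact (hC _ ((isWeakSymGrad_mesh hθ i).1.1.map _) hne).ne' (h1 x hx)
  exact congrFun (congrFun h2 l) m

theorem shearForm_self_nonneg (r : ℕ) (w : WeakFun T) (θ : Fin 2 → WeakFun T) :
    0 ≤ shearForm r w θ w θ :=
  Finset.sum_nonneg fun i _ => (T i).integral_nonneg fun _ =>
    Finset.sum_nonneg fun _ _ => mul_self_nonneg _

theorem shear_eq_zero {r : ℕ} {w : WeakFun T} {θ : Fin 2 → WeakFun T}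
    (h : shearForm r w θ w θ = 0) (i : ι) : shear r w θ i = 0 := by
  have hnn : ∀ i x, 0 ≤ ∑ l, evalAt (shear r w θ i l) x * evalAt (shear r w θ i l) x :=
    fun i x => Finset.sum_nonneg fun _ _ => mul_self_nonneg _
  have h0 := (Finset.sum_eq_zero_iff_of_nonneg fun i _ =>
    (T i).integral_nonneg (hnn i)).1 h i (Finset.mem_univ i)
  have h1 := (T i).eq_zero_of_integral_eq_zero
    (continuous_finsetSum _ fun _ _ => continuous_evalAt_mul _ _) (fun x _ => hnn i x) h0
  funext l
  refine eq_zero_of_evalAt_eq_zero (T i).isOpen_carrier (T i).isConnected_carrier.nonempty _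
    fun x hx => ?_
  exact mul_self_eq_zero.1 ((Finset.sum_eq_zero_iff_of_nonneg fun l _ =>
    mul_self_nonneg (evalAt (shear r w θ i l) x)).1 (h1 x hx) l (Finset.mem_univ l))

theorem PolygonalElement.diam_pos (K : PolygonalElement) : 0 < Metric.diam K.carrier := by
  obtain ⟨x, hx⟩ := K.isConnected_carrier.nonempty
  obtain ⟨ε, hε, hb⟩ := Metric.isOpen_iff.1 K.isOpen_carrier x hx
  have hy : x + (ε / 2) • K.normal ⟨0, by have := K.three_le; omega⟩ ∈ K.carrier := hb (by
    rw [Metric.mem_ball, dist_self_add_left, norm_smul, K.norm_normal, mul_one, Real.norm_eq_abs,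
      abs_of_pos (by linarith)]
    linarith)
  refine lt_of_lt_of_le ?_ (Metric.dist_le_diam_of_mem K.isBounded_carrier hy hx)
  rw [dist_self_add_left, norm_smul, K.norm_normal, mul_one, Real.norm_eq_abs,
    abs_of_pos (by linarith)]
  linarith

/-- Ensures that `h⁻¹` is not zero. The index is needed, because the supremum over no elements is
`0`. -/
theorem meshSize_pos (i : ι) : 0 < meshSize T :=
  (T i).diam_pos.trans_le (le_ciSup (f := fun i => Metric.diam (T i).carrier)
    (Set.finite_range _).bddAbove i)

theorem stabilizer_self_nonneg (w : WeakFun T) : 0 ≤ stabilizer w w :=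
  Finset.sum_nonneg fun i _ => mul_nonneg (inv_nonneg.2 meshSize_nonneg)
    (Finset.sum_nonneg fun a _ => (T i).edgeIntegral_nonneg a fun _ _ => mul_self_nonneg _)

theorem bdry_eq_of_stabilizer_eq_zero {k p : ℕ} {w : WeakFun T} (hw : w ∈ weakSpace T k p)
    (h : stabilizer w w = 0) (i : ι) (a : Fin (T i).N) :
    ∀ x ∈ (T i).edge a, w.bdry i a x = evalAt (w.1 i) x := by
  have hnn : ∀ i (a : Fin (T i).N), 0 ≤ (T i).edgeIntegral a fun x =>
      (evalAt (w.1 i) x - w.bdry i a x) * (evalAt (w.1 i) x - w.bdry i a x) := fun i a =>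
    (T i).edgeIntegral_nonneg a fun _ _ => mul_self_nonneg _
  have h0 := (Finset.sum_eq_zero_iff_of_nonneg fun i _ => mul_nonneg
    (inv_nonneg.2 (meshSize_nonneg (T := T))) (Finset.sum_nonneg fun a _ => hnn i a)).1 h i
    (Finset.mem_univ i)
  have h1 := (mul_eq_zero.1 h0).resolve_left (inv_pos.2 (meshSize_pos i)).ne'
  have h2 := (Finset.sum_eq_zero_iff_of_nonneg fun a _ => hnn i a).1 h1 a (Finset.mem_univ a)
  obtain ⟨P, -, hP⟩ := exists_bdry_eq_evalAt hw i a
  rw [(T i).edgeIntegral_congr a (g := fun x => evalAt (w.1 i - P) x * evalAt (w.1 i - P) x)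
    fun x hx => by rw [hP x hx, evalAt_sub]] at h2
  intro x hx
  have h3 := mul_self_eq_zero.1 ((T i).eq_zero_of_edgeIntegral_eq_zero a
    (continuous_evalAt_mul _ _) (fun _ _ => mul_self_nonneg _) h2 x hx)
  rw [evalAt_sub] at h3
  rw [hP x hx]
  linarith

end Mesh

section Mesh

variable {ι : Type*} {T : ι → PolygonalElement}

/-! ### Definiteness of the scheme -/

theorem bdry_eq_of_edge_eq (v : WeakFun T) {i j : ι} {a : Fin (T i).N} {b : Fin (T j).N}
    (h : (T i).edge a = (T j).edge b) : v.bdry i a = v.bdry j b := by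
  unfold WeakFun.bdry
  exact congrArg v.2 (Subtype.ext h)

/-- Edge functions are normalized to be zero off their edge, so their vanishing on the edge is
enough. -/
theorem eq_zero_of_bdry_eq {k p : ℕ} {v : WeakFun T} (hv : v ∈ weakSpace T k p)
    (h₀ : ∀ i, v.1 i = 0) (hb : ∀ i a, ∀ x ∈ (T i).edge a, v.bdry i a x = evalAt (v.1 i) x) :
    v = 0 := by
  refine Prod.ext (funext h₀) (funext fun e => ?_)
  obtain ⟨e, i, a, rfl⟩ := e
  obtain ⟨P, -, hP⟩ := hv.2 ⟨(T i).edge a, i, a, rfl⟩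
  funext x
  by_cases hx : x ∈ (T i).edge a
  · have := hb i a x hx
    rwa [h₀, evalAt_zero] at this
  · rw [hP, Set.indicator_of_notMem hx]
    rfl

theorem strain_sub (θ η : Fin 2 → Poly) : strain (θ - η) = strain θ - strain η := by
  ext1 l m
  simp only [strain, Matrix.of_apply, Matrix.sub_apply, Pi.sub_apply, map_sub]
  ring

theorem sum_pderiv_mul_eq (θ : Fin 2 → Poly) {τ : Matrix (Fin 2) (Fin 2) Poly} (hτ : τ.IsSymm)
    (x : Plane) : ∑ l, ∑ m, evalAt (MvPolynomial.pderiv m (θ l)) x * evalAt (τ l m) x =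
      ∑ l, ∑ m, evalAt (strain θ l m) x * evalAt (τ l m) x := by
  have h : τ 1 0 = τ 0 1 := hτ.apply 0 1
  simp only [Fin.sum_univ_two, strain, Matrix.of_apply, evalAt_mul, evalAt_add, evalAt_C, h]
  ring

variable {Ω : Set Plane}

/-- The jump of a rotation with vanishing discrete weak symmetric gradient is zero. -/
theorem bdry_eq_of_meshWeakSymGrad_eq_zero
    (hline : ∀ (i : ι) (a b : Fin (T i).N), a ≠ b →
      Collinear ℝ ((T i).edge a ∪ (T i).edge b) →
        (T i).edge a ⊆ frontier Ω ∧ (T i).edge b ⊆ frontier Ω)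
    {k q m : ℕ} (hqk : q ≤ k) (hmk : m ≤ k) {θ : Fin 2 → WeakFun T}
    (hθ : θ ∈ rotationSpace₀ T Ω q m) {i : ι} (h : meshWeakSymGrad k θ i = 0)
    (hs : strain (fun l => (θ l).1 i) = 0) (l : Fin 2) (a : Fin (T i).N) :
    ∀ x ∈ (T i).edge a, (θ l).bdry i a x = evalAt ((θ l).1 i) x := by
  have hsym := isWeakSymGrad_mesh (r := k) (fun l => (hθ l).1) i
  rw [h] at hsym
  have hb : ∀ (a : Fin (T i).N) l, (T i).EdgeIntegrable a ((θ l).bdry i a) := fun a l =>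
    edgeIntegrable_bdry (hθ l).1 i a
  have hbal : ∀ τ : Matrix (Fin 2) (Fin 2) Poly, τ.IsSymm →
      (∀ l m, τ l m ∈ polyLE ((T i).gradDegree k)) →
      ∑ a, (T i).edgeIntegral a (fun x => ∑ l, ((θ l).bdry i a x - evalAt ((θ l).1 i) x) *
        ∑ m, evalAt (τ l m) x * (T i).normal a m) = 0 := fun τ hτs hτ => by
    have h1 := (T i).strain_add_jump_eq_zero (fun l => (θ l).1 i) hb hsym hτs hτ
    simp only [sum_pderiv_mul_eq _ hτs, hs, Matrix.zero_apply, evalAt_zero, zero_mul,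
      Finset.sum_const_zero] at h1
    rwa [show (T i).integral (fun _ => 0) = 0 from MeasureTheory.integral_zero .., zero_add] at h1
  have hθk : ∀ l, (θ l).1 i ∈ polyLE k := fun l => polyLE_mono hqk ((hθ l).1.1 i)
  have hfr : ∀ b l, (T i).edge b ⊆ frontier Ω → ∀ x, (θ l).bdry i b x = 0 := fun b l hbΩ x =>
    congrFun ((hθ l).2 ⟨(T i).edge b, i, b, rfl⟩ hbΩ) x
  -- On a boundary edge all edges of the same line are boundary edges, and the jump on each of them
  -- is the one polynomial `-θ_0`. Any other edge is alone on its line, and `D` is its own jump, of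
  -- degree at most `k`.
  by_cases haΩ : (T i).edge a ⊆ frontier Ω
  · have h0 := (T i).jump_eq_zero a (D := fun l => -(θ l).1 i)
      (fun l => Submodule.neg_mem _ (hθk l)) (fun b hab l x _ => by
        have hbΩ : (T i).edge b ⊆ frontier Ω := by
          by_cases hba : a = b
          · exact hba ▸ haΩ
          · exact (hline i a b hba hab.collinear).2
        rw [hfr b l hbΩ, evalAt_neg, zero_sub]) hbal l
    intro x hx
    have := h0 x hx
    rw [evalAt_neg, neg_eq_zero] at this
    rw [hfr a l haΩ, this]
  · choose P hP hPe using fun l => exists_bdry_eq_evalAt (hθ l).1 i a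
    have h0 := (T i).jump_eq_zero a (D := fun l => P l - (θ l).1 i)
      (fun l => Submodule.sub_mem _ (polyLE_mono hmk (hP l)) (hθk l)) (fun b hab l x hx => by
        have hba : a = b := by
          by_contra hba
          exact haΩ (hline i a b hba hab.collinear).1
        subst hba
        rw [hPe l x hx, evalAt_sub]) hbal l
    intro x hx
    have := h0 x hx
    rw [evalAt_sub, sub_eq_zero] at this
    rw [hPe l x hx, this]

variable (T Ω) in
/-- The space `Θ_h^0 × W_h^0` as a linear space. -/
abbrev SchemeSpace (k p q m : ℕ) : Type _ :=
  (Fin 2 → weakSubmodule₀ T Ω q m) × weakSubmodule₀ T Ω k p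

/-- The rotation of an element of `Θ_h^0 × W_h^0`. -/
def SchemeSpace.rot {k p q m : ℕ} (u : SchemeSpace T Ω k p q m) : Fin 2 → WeakFun T :=
  fun l => u.1 l

/-- The displacement of an element of `Θ_h^0 × W_h^0`. -/
def SchemeSpace.disp {k p q m : ℕ} (u : SchemeSpace T Ω k p q m) : WeakFun T := u.2

theorem SchemeSpace.rot_mem {k p q m : ℕ} (u : SchemeSpace T Ω k p q m) :
    u.rot ∈ rotationSpace₀ T Ω q m := fun l => (u.1 l).2

theorem SchemeSpace.disp_mem {k p q m : ℕ} (u : SchemeSpace T Ω k p q m) :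
    u.disp ∈ weakSpace₀ T Ω k p := u.2.2

theorem SchemeSpace.rot_add_smul {k p q m : ℕ} (u v : SchemeSpace T Ω k p q m) (s : ℝ) :
    (u + s • v).rot = u.rot + s • v.rot := rfl

theorem SchemeSpace.disp_add_smul {k p q m : ℕ} (u v : SchemeSpace T Ω k p q m) (s : ℝ) :
    (u + s • v).disp = u.disp + s • v.disp := rfl

theorem IsPolygonalPartition.integrableOn_of_memLp (hT : IsPolygonalPartition Ω T) {g : Plane → ℝ}
    (hg : MemLp g 2 (volume.restrict Ω)) (i : ι) : IntegrableOn g (T i).carrier := by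
  have : IsFiniteMeasure (volume.restrict (T i).carrier) :=
    ⟨by rw [Measure.restrict_apply_univ]; exact (T i).isBounded_carrier.measure_lt_top⟩
  exact (hg.mono_measure (Measure.restrict_mono (hT.subset i) le_rfl)).integrable
    (by norm_num)

variable [Fintype ι]

/-- A rotation with vanishing discrete weak symmetric gradient is zero (Korn's inequality). -/
theorem rotation_eq_zero (hΩ : IsOpen Ω) (hT : IsPolygonalPartition Ω T)
    (hline : ∀ (i : ι) (a b : Fin (T i).N), a ≠ b →
      Collinear ℝ ((T i).edge a ∪ (T i).edge b) →
        (T i).edge a ⊆ frontier Ω ∧ (T i).edge b ⊆ frontier Ω)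
    {k q m : ℕ} (hk : 1 ≤ k) (hqk : q ≤ k) (hmk : m ≤ k) {θ : Fin 2 → WeakFun T}
    (hθ : θ ∈ rotationSpace₀ T Ω q m) (h : ∀ i, meshWeakSymGrad k θ i = 0) : θ = 0 := by
  have hs : ∀ i, strain (fun l => (θ l).1 i) = 0 := fun i => by
    have hsym := isWeakSymGrad_mesh (r := k) (fun l => (hθ l).1) i
    rw [h] at hsym
    exact (T i).strain_eq_zero hk (fun l => polyLE_mono hqk ((hθ l).1.1 i))
      (fun a l => edgeIntegrable_bdry (hθ l).1 i a) hsym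
  have hb : ∀ l i a, ∀ x ∈ (T i).edge a, (θ l).bdry i a x = evalAt ((θ l).1 i) x := fun l i a =>
    bdry_eq_of_meshWeakSymGrad_eq_zero hline hqk hmk hθ (h i) (hs i) l a
  -- The propagated quantity is the rigid motion on each element, determined by its values at the
  -- two ends of any edge.
  have hR := hT.eq_zero_of_edges hΩ (fun i l => (θ l).1 i) (fun i j a b _ hab => by
    have hz : ∀ l, ∀ x ∈ (T i).edge a,
        evalAt (((fun l => (θ l).1 i) - fun l => (θ l).1 j) l) x = 0 := fun l x hx => by
      rw [Pi.sub_apply, evalAt_sub, ← hb l i a x hx, ← hb l j b x (hab ▸ hx),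
        bdry_eq_of_edge_eq (θ l) hab, sub_self]
    refine sub_eq_zero.1 (eq_zero_of_strain_eq_zero (by rw [strain_sub, hs, hs, sub_zero])
      ((T i).next_ne_vertex a) (fun l => hz l _ ((T i).next_mem_edge a))
      fun l => hz l _ ((T i).vertex_mem_edge a))) (fun i a haΩ => by
    have hz : ∀ l, ∀ x ∈ (T i).edge a, evalAt ((θ l).1 i) x = 0 := fun l x hx => by
      rw [← hb l i a x hx]
      exact congrFun ((hθ l).2 ⟨(T i).edge a, i, a, rfl⟩ haΩ) x
    exact eq_zero_of_strain_eq_zero (hs i) ((T i).next_ne_vertex a)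
      (fun l => hz l _ ((T i).next_mem_edge a)) fun l => hz l _ ((T i).vertex_mem_edge a))
  funext l
  exact eq_zero_of_bdry_eq (hθ l).1 (fun i => congrFun (hR i) l) (hb l)

/-- A displacement with vanishing discrete weak gradient and without jumps is zero. -/
theorem displacement_eq_zero (hΩ : IsOpen Ω) (hT : IsPolygonalPartition Ω T) {k p : ℕ}
    {w : WeakFun T} (hw : w ∈ weakSpace₀ T Ω k p) (h : ∀ i, meshWeakGrad k w i = 0)
    (hb : ∀ i a, ∀ x ∈ (T i).edge a, w.bdry i a x = evalAt (w.1 i) x) : w = 0 := by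
  have hg : ∀ i l, MvPolynomial.pderiv l (w.1 i) = 0 := fun i l => by
    have hgrad := isWeakGrad_mesh (r := k) hw.1 i
    rw [h] at hgrad
    refine (T i).pderiv_eq_zero_of_isWeakGrad_zero (polyLE_mono ?_ (hw.1.1 i)) (hb i) hgrad l
    have h1 := (T i).three_le
    rw [(T i).gradDegree_eq]
    have h2 := Nat.mul_pos (show 0 < (T i).N by omega) (T i).one_le_expo
    omega
  -- The propagated quantity is now a constant on each element, so one vertex of an edge is enough
  -- for the comparison.
  refine eq_zero_of_bdry_eq hw.1 (hT.eq_zero_of_edges hΩ w.1 (fun i j a b _ hab => ?_)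
    fun i a haΩ => ?_) hb
  · refine sub_eq_zero.1 (eq_zero_of_pderiv_eq_zero (a := (T i).vertex a) (fun l => ?_) ?_)
    · rw [map_sub, hg, hg, sub_zero]
    · have hx := (T i).vertex_mem_edge a
      rw [evalAt_sub, ← hb i a _ hx, ← hb j b _ (hab ▸ hx), bdry_eq_of_edge_eq w hab, sub_self]
  · refine eq_zero_of_pderiv_eq_zero (a := (T i).vertex a) (hg i) ?_
    rw [← hb i a _ ((T i).vertex_mem_edge a)]
    exact congrFun (hw.2 ⟨(T i).edge a, i, a, rfl⟩ haΩ) _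

theorem l2Proj_zero (K : PolygonalElement) (r : ℕ) :
    K.l2Proj r (fun l => evalAt ((0 : Fin 2 → Poly) l)) = 0 := by
  have h := l2Proj_add_smul K r 0 0 1
  simpa using h

/-- The bending term alone gives `θ = 0`. Then the shear strain is the weak gradient of `w`, and the
stabilizer provides the absence of jumps. -/
theorem eq_zero_of_form_eq_zero (hΩ : IsOpen Ω) (hT : IsPolygonalPartition Ω T)
    (hline : ∀ (i : ι) (a b : Fin (T i).N), a ≠ b →
      Collinear ℝ ((T i).edge a ∪ (T i).edge b) →
        (T i).edge a ⊆ frontier Ω ∧ (T i).edge b ⊆ frontier Ω)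
    {k p q m : ℕ} (hk : 1 ≤ k) (hqk : q ≤ k) (hmk : m ≤ k)
    {C : Matrix (Fin 2) (Fin 2) ℝ →ₗ[ℝ] Matrix (Fin 2) (Fin 2) ℝ}
    (hC : ∀ τ : Matrix (Fin 2) (Fin 2) ℝ, τ.IsSymm → τ ≠ 0 → 0 < ∑ i, ∑ j, C τ i j * τ i j)
    {c : ℝ} (hc : 0 < c) {θ : Fin 2 → WeakFun T} {w : WeakFun T}
    (hθ : θ ∈ rotationSpace₀ T Ω q m) (hw : w ∈ weakSpace₀ T Ω k p)
    (h : bendingForm k C θ θ + c * shearForm k w θ w θ + stabilizer w w = 0) : θ = 0 ∧ w = 0 := by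
  have h1 := bendingForm_self_nonneg (r := k) hC fun l => (hθ l).1
  have h2 := mul_nonneg hc.le (shearForm_self_nonneg k w θ)
  have h3 := stabilizer_self_nonneg w
  have hθ0 : θ = 0 := rotation_eq_zero hΩ hT hline hk hqk hmk hθ
    (meshWeakSymGrad_eq_zero hC (fun l => (hθ l).1) (by linarith))
  refine ⟨hθ0, displacement_eq_zero hΩ hT hw (fun i => ?_)
    (bdry_eq_of_stabilizer_eq_zero hw.1 (by linarith))⟩
  have hs := shear_eq_zero ((mul_eq_zero.1 (by linarith :
    c * shearForm k w θ w θ = 0)).resolve_left hc.ne') i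
  rw [shear, hθ0] at hs
  exact (sub_eq_zero.1 hs).trans (l2Proj_zero _ _)

/-! ### The linear system -/

variable (T) in
/-- The weak function given by polynomials on the elements and on the edges. -/
def toWeakFun (k p : ℕ) : ((ι → polyLE k) × (edges T → polyLE p)) →ₗ[ℝ] WeakFun T where
  toFun P := (fun i => P.1 i, fun e => e.1.indicator (evalAt (P.2 e)))
  map_add' P Q := by
    refine Prod.ext rfl (funext fun e => funext fun x => ?_)
    change e.1.indicator (evalAt ((P.2 e : Poly) + Q.2 e)) x =
      e.1.indicator (evalAt (P.2 e)) x + e.1.indicator (evalAt (Q.2 e)) x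
    by_cases hx : x ∈ e.1 <;> simp [hx]
  map_smul' c P := by
    refine Prod.ext rfl (funext fun e => funext fun x => ?_)
    change e.1.indicator (evalAt (c • (P.2 e : Poly))) x = c * e.1.indicator (evalAt (P.2 e)) x
    by_cases hx : x ∈ e.1 <;> simp [hx]

instance : Finite (edges T) := by
  have : edges T = Set.range fun c : Σ i, Fin (T i).N => (T c.1).edge c.2 := by
    ext e
    constructor
    · rintro ⟨i, a, rfl⟩
      exact ⟨⟨i, a⟩, rfl⟩
    · rintro ⟨⟨i, a⟩, rfl⟩
      exact ⟨i, a, rfl⟩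
  rw [this]
  exact Set.finite_range _

/-- The space lies in the range of a map from polynomial coefficients. Different polynomials may
agree on an edge, so this map need not be injective; its range is all that matters. -/
instance (k p : ℕ) : FiniteDimensional ℝ (weakSubmodule₀ T Ω k p) := by
  have hle : weakSubmodule₀ T Ω k p ≤ LinearMap.range (toWeakFun T k p) := by
    rintro v ⟨⟨hv, hb⟩, -⟩
    choose P hP hPe using hb
    exact ⟨(fun i => ⟨v.1 i, hv i⟩, fun e => ⟨P e, hP e⟩),
      Prod.ext rfl (funext fun e => (hPe e).symm)⟩
  exact Submodule.finiteDimensional_of_le hle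

/-- An additive and homogeneous function, as a linear map. -/
def linearMapOfAddSMul {V W : Type*} [AddCommGroup V] [Module ℝ V] [AddCommGroup W] [Module ℝ W]
    (f : V → W) (h : ∀ (u v : V) (c : ℝ), f (u + c • v) = f u + c • f v) : V →ₗ[ℝ] W :=
  -- The choice `u = v = 0`, `c = 1` gives `f 0 = f 0 + f 0`.
  have h0 : f 0 = 0 := by simpa using h 0 0 1
  { toFun := f
    map_add' := fun u v => by simpa using h u v 1
    map_smul' := fun c v => by simpa [h0] using h 0 v c }

/-- The left-hand side of the scheme. -/
def schemeValue {k p q m : ℕ} (C : Matrix (Fin 2) (Fin 2) ℝ →ₗ[ℝ] Matrix (Fin 2) (Fin 2) ℝ)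
    (c : ℝ) (u v : SchemeSpace T Ω k p q m) : ℝ :=
  bendingForm k C u.rot v.rot + c * shearForm k u.disp u.rot v.disp v.rot +
    stabilizer u.disp v.disp

theorem schemeValue_add_smul_left {k p q m : ℕ}
    (C : Matrix (Fin 2) (Fin 2) ℝ →ₗ[ℝ] Matrix (Fin 2) (Fin 2) ℝ) (c : ℝ)
    (u u' v : SchemeSpace T Ω k p q m) (s : ℝ) :
    schemeValue C c (u + s • u') v = schemeValue C c u v + s * schemeValue C c u' v := by
  have h1 := bendingForm_add_smul_left (r := k) C (fun l => (u.rot_mem l).1)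
    (fun l => (u'.rot_mem l).1) s v.rot
  have h2 := shearForm_add_smul_left (r := k) u.disp_mem.1 u'.disp_mem.1 u.rot u'.rot s v.disp v.rot
  have h3 := stabilizer_add_smul_left u.disp_mem.1 u'.disp_mem.1 v.disp_mem.1 s
  rw [schemeValue, SchemeSpace.rot_add_smul, SchemeSpace.disp_add_smul, h1, h2, h3]
  unfold schemeValue
  ring

theorem schemeValue_add_smul_right {k p q m : ℕ}
    (C : Matrix (Fin 2) (Fin 2) ℝ →ₗ[ℝ] Matrix (Fin 2) (Fin 2) ℝ) (c : ℝ)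
    (u v v' : SchemeSpace T Ω k p q m) (s : ℝ) :
    schemeValue C c u (v + s • v') = schemeValue C c u v + s * schemeValue C c u v' := by
  have h1 := bendingForm_add_smul_right (r := k) C u.rot (fun l => (v.rot_mem l).1)
    (fun l => (v'.rot_mem l).1) s
  have h2 := shearForm_add_smul_left (r := k) v.disp_mem.1 v'.disp_mem.1 v.rot v'.rot s u.disp u.rot
  have h3 := stabilizer_add_smul_left v.disp_mem.1 v'.disp_mem.1 u.disp_mem.1 s
  unfold schemeValue
  rw [SchemeSpace.rot_add_smul, SchemeSpace.disp_add_smul, h1,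
    shearForm_comm k u.disp, shearForm_comm k u.disp, shearForm_comm k u.disp, h2,
    stabilizer_comm u.disp, stabilizer_comm u.disp, stabilizer_comm u.disp, h3]
  ring

variable (T Ω) in
/-- The bilinear form of the scheme. -/
def schemeForm (k p q m : ℕ) (C : Matrix (Fin 2) (Fin 2) ℝ →ₗ[ℝ] Matrix (Fin 2) (Fin 2) ℝ)
    (c : ℝ) : SchemeSpace T Ω k p q m →ₗ[ℝ] SchemeSpace T Ω k p q m →ₗ[ℝ] ℝ :=
  linearMapOfAddSMul
    (fun u => linearMapOfAddSMul (schemeValue C c u) (schemeValue_add_smul_right C c u))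
    fun u u' s => LinearMap.ext fun v => schemeValue_add_smul_left C c u u' v s

end Mesh

end

end WG

/-! ### Existence and uniqueness for the scheme. -/

theorem mainTheorem1 {ι : Type*} [Fintype ι] (Ω : Set WG.Plane) (hΩ : IsOpen Ω)
    (T : ι → WG.PolygonalElement) (hT : WG.IsPolygonalPartition Ω T)
    (hline : ∀ (i : ι) (a b : Fin (T i).N), a ≠ b →
      Collinear ℝ ((T i).edge a ∪ (T i).edge b) →
        (T i).edge a ⊆ frontier Ω ∧ (T i).edge b ⊆ frontier Ω)
    (k p q m : ℕ) (hk : 1 ≤ k) (hp : 1 ≤ p) (hq : 1 ≤ q) (hm : 1 ≤ m)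
    (hqk : q ≤ k) (hmk : m ≤ k)
    (C : Matrix (Fin 2) (Fin 2) ℝ →ₗ[ℝ] Matrix (Fin 2) (Fin 2) ℝ)
    (hC : ∀ τ : Matrix (Fin 2) (Fin 2) ℝ, τ.IsSymm → τ ≠ 0 → 0 < ∑ i, ∑ j, C τ i j * τ i j)
    (lam d : ℝ) (hlam : 0 < lam) (hd : 0 < d)
    (g : WG.Plane → ℝ) (hg : MeasureTheory.MemLp g 2 (MeasureTheory.volume.restrict Ω)) :
    ∃! u : (Fin 2 → WG.WeakFun T) × WG.WeakFun T,
      WG.IsWGSolution Ω k p q m C lam d g u.1 u.2 := by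
  have hc : 0 < lam * (d ^ 2)⁻¹ := by positivity
  let L : WG.SchemeSpace T Ω k p q m →ₗ[ℝ] ℝ := WG.linearMapOfAddSMul (fun v => WG.load g v.disp)
    fun v v' s => WG.load_add_smul (hT.integrableOn_of_memLp hg) v.disp v'.disp s
  obtain ⟨u, hu, huniq⟩ := WG.existsUnique_of_definite
    (WG.schemeForm T Ω k p q m C (lam * (d ^ 2)⁻¹)) (fun v hv => by
      obtain ⟨h1, h2⟩ := WG.eq_zero_of_form_eq_zero hΩ hT hline hk hqk hmk hC hc v.rot_mem
        v.disp_mem hv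
      exact Prod.ext (funext fun l => Subtype.ext (congrFun h1 l)) (Subtype.ext h2)) L
  refine ⟨(u.rot, u.disp), ⟨u.rot_mem, u.disp_mem, fun η hη v hv =>
    hu (fun l => ⟨η l, hη l⟩, ⟨v, hv⟩)⟩, ?_⟩
  -- Any solution carries its membership in the spaces, so it lifts to `SchemeSpace`, where
  -- uniqueness holds.
  rintro ⟨θ, w⟩ ⟨hθ, hw, heq⟩
  have h := huniq (fun l => ⟨θ l, hθ l⟩, ⟨w, hw⟩) fun v => heq v.rot v.rot_mem v.disp v.disp_mem
  rw [← h]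
  rfl
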